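/- Let $\mathcal L$ be the set of isotopy classes of (nonempty) oriented links and $\mathcal L^{(\mu)}$ ($\mu\ge 1$) the subset of links with $\mu$ components. An invariant $v$ on $\mathcal L$ (or on $\mathcal L^{(\mu)}$) with values in an abelian group is a Vassiliev invariant if, for some $n$, its extension to links with transverse self-intersections (with $\mu$ components) by $v(L_\times)=v(L_+)-v(L_-)$ vanishes on all links with $n+1$ self-intersections. (1) Let $f:\mathcal L\to\mathbb Q$. Then $f$ is a pointwise limit of rational Vassiliev invariants on $\mathcal L$ if and only if, for every $\mu\ge 1$, the restriction $f|_{\mathcal L^{(\mu)}}$ is a pointwise limit of rational Vassiliev invariants on $\mathcal L^{(\mu)}$. (2) There is exactly one map $L\mapsto P_L(v,z)=\sum_{k,j}a_{kj}(L)v^kz^j\in\mathbb Z[v^{\pm1},z^{\pm1}]$ on $\mathcal L$ with $v^{-1}P_{L_+}-vP_{L_-}=zP_{L_0}$ and $P_{\text{unknot}}=1$ (the HOMFLYPT polynomial). For $m\in\mathbb N$, $k,j\in\mathbb Z$ put $$B_{mj}(L)=\sum_k a_{kj}(L)\frac{k^m}{m!},\qquad \lambda_{m,k}=\frac1{2\pi}\int_0^{2\pi}(it)^me^{-ikt}\,dt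 ,$$ let $M_n$ be the $(2n+1)\times(2n+1)$ Vandermonde matrix with entries $c^r$ (row $0\le r\le 2n$, column $-n\le c\le n$), which is invertible, and let $$(s^{n,j}_k(L))_{-n\le k\le n}=M_n^{-1}\bigl(0!\,B_{0j}(L),1!\,B_{1j}(L),\dots,(2n)!\,B_{2n,j}(L)\bigr)^{T},\qquad v^{N}_{kj}(L)=\sum_{m=0}^N\lambda_{m,k}B_{mj}(L),$$ with $s^{n,j}_k=0$ for $|k|>n$. Then for all $k,j\in\mathbb Z$: (a) for every $\mu\ge1$, the restrictions to $\mathcal L^{(\mu)}$ of all $B_{mj}$, of all $s^{n,j}_k$ (rational-valued) and of all $v^N_{kj}$ (complex-valued) are Vassiliev invariants on $\mathcal L^{(\mu)}$, and $a_{kj}|_{\mathcal L^{(\mu)}}$ is a pointwise limit of rational Vassiliev invariants on $\mathcal L^{(\mu)}$; (b) for every $L\in\mathcal L$, $s^{n,j}_k(L)=a_{kj}(L)$ for all sufficiently large $n$, and $a_{kj}(L)=\sum_{m=0}^\infty\lambda_{m,k}B_{mj}(L)$ with absolute convergence; (c) the function $w_n$ on $\mathcal L$ that equals $s^{n,j}_k$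 on $\mathcal L^{(\mu)}$ for $\mu\le n$ and $0$ on $\mathcal L^{(\mu)}$ for $\mu>n$ is, for each $n$, a Vassiliev invariant on $\mathcal L$, and $\lim_{n\to\infty}w_n(L)=a_{kj}(L)$ for every $L\in\mathcal L$; the same holds with the complex-valued $v^n_{kj}$ in place of $s^{n,j}_k$. In particular $a_{kj}$ is a pointwise limit of rational Vassiliev invariants on all oriented links. -/

import Mathlib

open Filter Topology

namespace OrientedLinks

/-! ### Oriented (singular) link diagrams

A plane diagram in general position with respect to the height function is cut by horizontal
lines into layers, each of which contains one elementary piece besides vertical strands.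
A strand crossing a horizontal line is recorded by its orientation there: `true` means that it
is oriented upwards, `false` that it is oriented downwards.  Words are read from bottom to top. -/

/-- The elementary pieces of a diagram.
* `cup d`: a local minimum; its left leg has orientation `d`, its right leg orientation `!d`.
* `cap d`: a local maximum; its left leg has orientation `d`, its right leg orientation `!d`.
* `cross o s t`: a crossing.  The strand from the bottom left to the top right ("rising") has
  orientation `s`, the strand from the bottom right to the top left ("falling") has
  orientation `t`.  If `o = true` the rising strand is the upper one, otherwise the falling one.
* `double s t`: the same with a transverse self-intersection (singular crossing). -/
inductive Piece where
  | cup (d : Bool)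
  | cap (d : Bool)
  | cross (o s t : Bool)
  | double (s t : Bool)

/-- The orientations of the strands at the bottom of a piece, from left to right. -/
def Piece.bot : Piece → List Bool
  | .cup _ => []
  | .cap d => [d, !d]
  | .cross _ s t => [s, t]
  | .double s t => [s, t]

/-- The orientations of the strands at the top of a piece, from left to right. -/
def Piece.top : Piece → List Bool
  | .cup d => [d, !d]
  | .cap _ => []
  | .cross _ s t => [t, s]
  | .double s t => [t, s]

/-- A layer: one piece, with `pos` vertical strands on its left (and any number on its right). -/
structure Layer where
  pos : ℕ
  piece : Piece

/-- A layer leads from the strands `a` on the horizontal line below it to the strands `b` on the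
horizontal line above it. -/
def Layer.Step (ℓ : Layer) (a b : List Bool) : Prop :=
  ∃ l r : List Bool, l.length = ℓ.pos ∧ a = l ++ ℓ.piece.bot ++ r ∧ b = l ++ ℓ.piece.top ++ r

/-- The stack of layers `w` fits together and leads from the strands `a` to the strands `b`. -/
def Runs : List Layer → List Bool → List Bool → Prop
  | [], a, b => a = b
  | ℓ :: w, a, b => ∃ c, ℓ.Step a c ∧ Runs w c b

/-- A nonempty closed oriented diagram, possibly with singular crossings: a diagram of an
oriented link with finitely many transverse self-intersections. -/
structure SingularDiagram where
  word : List Layer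
  closed : Runs word [] []
  nonempty : word ≠ []

/-- Whether a layer contains a singular crossing. -/
def Layer.isDouble (ℓ : Layer) : Bool :=
  match ℓ.piece with
  | .double _ _ => true
  | _ => false

/-- The number of singular crossings. -/
def SingularDiagram.doublePoints (D : SingularDiagram) : ℕ :=
  D.word.countP Layer.isDouble

/-- A diagram of an oriented link: no singular crossings. -/
abbrev LinkDiagram := {D : SingularDiagram // D.doublePoints = 0}

/-- The positive crossing at position `i` with strand orientations `s`, `t`. -/
def posCross (i : ℕ) (s t : Bool) : Layer := ⟨i, .cross (s == t) s t⟩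

/-- The negative crossing at position `i` with strand orientations `s`, `t`. -/
def negCross (i : ℕ) (s t : Bool) : Layer := ⟨i, .cross (s != t) s t⟩

/-- The smoothing, respecting orientations, of a crossing at position `i` with strand
orientations `s`, `t`: two vertical strands if both strands of the crossing go up or both go down,
and a local maximum below a local minimum otherwise. -/
def smoothing (i : ℕ) (s t : Bool) : List Layer :=
  if s = t then [] else [⟨i, .cap s⟩, ⟨i, .cup t⟩]

/-! ### The number of components -/

/-- The number of strands on the horizontal line above the first `n` layers of `w`. -/
def width (w : List Layer) (n : ℕ) : ℕ :=
  (w.take n).foldl (fun c ℓ => c - ℓ.piece.bot.length + ℓ.piece.top.length) 0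

/-- The pair `(n, p)` stands for the `p`-th strand (counted from `0`) on the horizontal line above
the first `n` layers.  `Joined w x y` says that `x` and `y` are the ends of an arc of the diagram
inside one layer; at crossings, singular or not, the two strands pass through each other. -/
inductive Joined (w : List Layer) : ℕ × ℕ → ℕ × ℕ → Prop
  | left {n p i : ℕ} {e : Piece} :
      w[n]? = some ⟨i, e⟩ → p < i → Joined w (n, p) (n + 1, p)
  | right {n p i : ℕ} {e : Piece} :
      w[n]? = some ⟨i, e⟩ → Joined w (n, i + e.bot.length + p) (n + 1, i + e.top.length + p)
  | cup {n i : ℕ} {d : Bool} :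
      w[n]? = some ⟨i, .cup d⟩ → Joined w (n + 1, i) (n + 1, i + 1)
  | cap {n i : ℕ} {d : Bool} :
      w[n]? = some ⟨i, .cap d⟩ → Joined w (n, i) (n, i + 1)
  | crossRising {n i : ℕ} {o s t : Bool} :
      w[n]? = some ⟨i, .cross o s t⟩ → Joined w (n, i) (n + 1, i + 1)
  | crossFalling {n i : ℕ} {o s t : Bool} :
      w[n]? = some ⟨i, .cross o s t⟩ → Joined w (n, i + 1) (n + 1, i)
  | doubleRising {n i : ℕ} {s t : Bool} :
      w[n]? = some ⟨i, .double s t⟩ → Joined w (n, i) (n + 1, i + 1)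
  | doubleFalling {n i : ℕ} {s t : Bool} :
      w[n]? = some ⟨i, .double s t⟩ → Joined w (n, i + 1) (n + 1, i)

/-- The points in which the diagram meets the horizontal lines between its layers. -/
def SingularDiagram.Point (D : SingularDiagram) : Type :=
  {x : ℕ × ℕ // x.2 < width D.word x.1}

/-- The number of components: points up to the equivalence relation generated by the arcs. -/
noncomputable def SingularDiagram.numComponents (D : SingularDiagram) : ℕ :=
  Nat.card (Quot fun x y : D.Point => Joined D.word x.1 y.1)

/-! ### Isotopy -/

/-- The local moves: isotopies of the plane (the first five) and the Reidemeister moves,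
for all orientations of the strands. -/
inductive LocalMove : List Layer → List Layer → Prop
  /-- Two distant pieces exchange their heights. -/
  | exchange (i k : ℕ) (e f : Piece) :
      LocalMove [⟨i, e⟩, ⟨i + e.top.length + k, f⟩] [⟨i + e.bot.length + k, f⟩, ⟨i, e⟩]
  /-- Straightening a zigzag, in both directions. -/
  | zigzagRight (i : ℕ) (s : Bool) :
      LocalMove [⟨i + 1, .cup (!s)⟩, ⟨i, .cap s⟩] []
  | zigzagLeft (i : ℕ) (s : Bool) :
      LocalMove [⟨i, .cup s⟩, ⟨i + 1, .cap (!s)⟩] []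
  /-- A crossing is pushed past a maximum of one of its two strands. -/
  | capSlide (i : ℕ) (o d s : Bool) :
      LocalMove [⟨i, .cross o d s⟩, ⟨i + 1, .cap d⟩] [⟨i + 1, .cross (!o) s (!d)⟩, ⟨i, .cap d⟩]
  /-- A crossing is pushed past a minimum of one of its two strands. -/
  | cupSlide (i : ℕ) (o d s : Bool) :
      LocalMove [⟨i + 1, .cup d⟩, ⟨i, .cross o s d⟩] [⟨i, .cup d⟩, ⟨i + 1, .cross (!o) (!d) s⟩]
  /-- The first Reidemeister move, at a maximum and at a minimum. -/
  | capCurl (i : ℕ) (o d : Bool) :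
      LocalMove [⟨i, .cross o d (!d)⟩, ⟨i, .cap (!d)⟩] [⟨i, .cap d⟩]
  | cupCurl (i : ℕ) (o d : Bool) :
      LocalMove [⟨i, .cup d⟩, ⟨i, .cross o d (!d)⟩] [⟨i, .cup (!d)⟩]
  /-- The second Reidemeister move. -/
  | reidemeisterTwo (i : ℕ) (o s t : Bool) :
      LocalMove [⟨i, .cross o s t⟩, ⟨i, .cross (!o) t s⟩] []
  /-- The third Reidemeister move.  The strands `s`, `t`, `u` cross pairwise; the condition says
  that one of them is the uppermost and one the lowermost. -/
  | reidemeisterThree (i : ℕ) (a b c s t u : Bool) (h : a = c → b = a) :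
      LocalMove [⟨i, .cross a s t⟩, ⟨i + 1, .cross b s u⟩, ⟨i, .cross c t u⟩]
        [⟨i + 1, .cross c t u⟩, ⟨i, .cross b s u⟩, ⟨i + 1, .cross a s t⟩]

/-- Two link diagrams differ by one local move. -/
def Move (D E : LinkDiagram) : Prop :=
  ∃ x y p q : List Layer, LocalMove p q ∧ D.1.word = x ++ p ++ y ∧ E.1.word = x ++ q ++ y

/-- Isotopy classes of (nonempty) oriented links: link diagrams up to the equivalence relation
generated by the moves. -/
def OrientedLink : Type := Quot Move

/-- `D` has no singular crossings and is a diagram of the link `L`. -/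
def SingularDiagram.Represents (D : SingularDiagram) (L : OrientedLink) : Prop :=
  ∃ h : D.doublePoints = 0, (Quot.mk Move ⟨D, h⟩ : OrientedLink) = L

/-- The link `L` has `μ` components. -/
def OrientedLink.HasComponents (L : OrientedLink) (μ : ℕ) : Prop :=
  ∃ D : SingularDiagram, D.Represents L ∧ D.numComponents = μ

/-- The set of oriented links with `μ` components. -/
abbrev OrientedLinkOf (μ : ℕ) := {L : OrientedLink // L.HasComponents μ}

/-! ### Vassiliev invariants -/

/-- `D`, `Dp`, `Dm` agree except that a singular crossing of `D` is replaced by a positive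
crossing in `Dp` and by a negative crossing in `Dm`. -/
def VassilievTriple (D Dp Dm : SingularDiagram) : Prop :=
  ∃ (x y : List Layer) (i : ℕ) (s t : Bool),
    D.word = x ++ [⟨i, .double s t⟩] ++ y ∧
    Dp.word = x ++ [posCross i s t] ++ y ∧
    Dm.word = x ++ [negCross i s t] ++ y

/-- The link invariant `v` is a Vassiliev invariant of order at most `n`: its extension `V` to
singular diagrams by the Vassiliev relation vanishes on diagrams with `n + 1` singular
crossings. -/
def IsVassilievOfOrder {A : Type*} [AddCommGroup A] (n : ℕ) (v : OrientedLink → A) : Prop :=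
  ∃ V : SingularDiagram → A,
    (∀ D L, D.Represents L → V D = v L) ∧
    (∀ D Dp Dm, VassilievTriple D Dp Dm → V D = V Dp - V Dm) ∧
    ∀ D, D.doublePoints = n + 1 → V D = 0

/-- `v` is a Vassiliev invariant (of some order). -/
def IsVassiliev {A : Type*} [AddCommGroup A] (v : OrientedLink → A) : Prop :=
  ∃ n, IsVassilievOfOrder n v

/-- The invariant `v` of links with `μ` components is a Vassiliev invariant of order at most `n`:
its extension `V` to singular diagrams with `μ` components by the Vassiliev relation vanishes
on those with `n + 1` singular crossings. -/
def IsVassilievOfOrderOn {A : Type*} [AddCommGroup A] (μ n : ℕ) (v : OrientedLinkOf μ → A) :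
    Prop :=
  ∃ V : {D : SingularDiagram // D.numComponents = μ} → A,
    (∀ D L, D.1.Represents L.1 → V D = v L) ∧
    (∀ D Dp Dm, VassilievTriple D.1 Dp.1 Dm.1 → V D = V Dp - V Dm) ∧
    ∀ D, D.1.doublePoints = n + 1 → V D = 0

/-- `v` is a Vassiliev invariant (of some order) of links with `μ` components. -/
def IsVassilievOn {A : Type*} [AddCommGroup A] (μ : ℕ) (v : OrientedLinkOf μ → A) : Prop :=
  ∃ n, IsVassilievOfOrderOn μ n v

/-! ### The HOMFLYPT polynomial -/

/-- Integral Laurent polynomials in two variables; the exponent `(k, j)` stands for `v ^ k z ^ j`. -/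
abbrev Laurent := AddMonoidAlgebra ℤ (ℤ × ℤ)

/-- The monomial `v ^ k z ^ j`. -/
noncomputable def monomial (k j : ℤ) : Laurent := AddMonoidAlgebra.single (k, j) 1

/-- The diagram of the unknot with one minimum and one maximum. -/
def unknotDiagram : SingularDiagram where
  word := [⟨0, .cup true⟩, ⟨0, .cap true⟩]
  closed := ⟨[true, false], ⟨[], [], rfl, rfl, rfl⟩, [], ⟨[], [], rfl, rfl, rfl⟩, rfl⟩
  nonempty := List.cons_ne_nil _ _

/-- `Lp`, `Lm`, `Lo` have diagrams that agree except for a positive crossing in the first, a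
negative crossing in the second, and its oriented smoothing in the third. -/
def SkeinTriple (Lp Lm Lo : OrientedLink) : Prop :=
  ∃ Dp Dm Do : SingularDiagram, Dp.Represents Lp ∧ Dm.Represents Lm ∧ Do.Represents Lo ∧
    ∃ (x y : List Layer) (i : ℕ) (s t : Bool),
      Dp.word = x ++ [posCross i s t] ++ y ∧
      Dm.word = x ++ [negCross i s t] ++ y ∧
      Do.word = x ++ smoothing i s t ++ y

/-- The defining properties of the HOMFLYPT polynomial: the skein relation
`v⁻¹ P(L₊) - v P(L₋) = z P(L₀)` and the value `1` on the unknot. -/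
structure IsHOMFLYPT (P : OrientedLink → Laurent) : Prop where
  skein : ∀ Lp Lm Lo, SkeinTriple Lp Lm Lo →
    monomial (-1) 0 * P Lp - monomial 1 0 * P Lm = monomial 0 1 * P Lo
  unknot : ∀ L, unknotDiagram.Represents L → P L = 1

/-- The coefficient `a_{kj}(L)` of `v ^ k z ^ j`, as a rational number. -/
noncomputable def coeffA (P : OrientedLink → Laurent) (k j : ℤ) (L : OrientedLink) : ℚ :=
  ((P L).coeff (k, j) : ℚ)

/-- `B_{mj}(L) = ∑_k a_{kj}(L) k ^ m / m!`, a finite sum over the exponents of `v` in `P(L)`. -/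
noncomputable def coeffB (P : OrientedLink → Laurent) (m : ℕ) (j : ℤ) (L : OrientedLink) : ℚ :=
  ∑ k ∈ (P L).coeff.support.image Prod.fst, coeffA P k j L * (k : ℚ) ^ m / (m.factorial : ℚ)

/-- The Vandermonde matrix `M_n` of size `2 n + 1`: the entry in row `r` and in the column of
`k ∈ {-n, …, n}` is `k ^ r`; the column of `k` has index `k + n`. -/
def vandermondeM (n : ℕ) : Matrix (Fin (2 * n + 1)) (Fin (2 * n + 1)) ℚ :=
  Matrix.of fun r c => ((c.val : ℚ) - (n : ℚ)) ^ r.val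

/-- The entry `s_k^{n,j}(L)`, `-n ≤ k ≤ n`, of the solution
`s = M_n⁻¹ (0! B_{0j}(L), 1! B_{1j}(L), …, (2n)! B_{2n,j}(L))` of the Vandermonde system;
`0` for other `k`. -/
noncomputable def vandermondeS (P : OrientedLink → Laurent) (n : ℕ) (k j : ℤ)
    (L : OrientedLink) : ℚ :=
  if h : -(n : ℤ) ≤ k ∧ k ≤ n then
    ((vandermondeM n)⁻¹.mulVec fun r => (r.val.factorial : ℚ) * coeffB P r.val j L)
      ⟨(k + n).toNat, by omega⟩
  else 0

/-- `λ_{m,n} = (1 / 2π) ∫_0^{2π} (i t) ^ m e^{- i n t} dt`. -/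
noncomputable def fourierLambda (m : ℕ) (n : ℤ) : ℂ :=
  1 / (2 * (Real.pi : ℂ)) *
    ∫ t in (0 : ℝ)..(2 * Real.pi),
      (Complex.I * (t : ℂ)) ^ m * Complex.exp (-(Complex.I * (n : ℂ) * (t : ℂ)))

/-- The partial sum `∑_{m = 0}^N λ_{m,k} B_{mj}(L)`. -/
noncomputable def fourierSum (P : OrientedLink → Laurent) (N : ℕ) (k j : ℤ)
    (L : OrientedLink) : ℂ :=
  ∑ m ∈ Finset.range (N + 1), fourierLambda m k * ((coeffB P m j L : ℚ) : ℂ)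

/-- The link invariant `f` is a pointwise limit of rational Vassiliev invariants. -/
def IsVassilievLimit (f : OrientedLink → ℚ) : Prop :=
  ∃ w : ℕ → OrientedLink → ℚ, (∀ n, IsVassiliev (w n)) ∧
    ∀ L, Tendsto (fun n => w n L) atTop (𝓝 (f L))

/-- The invariant `f` of links with `μ` components is a pointwise limit of rational Vassiliev
invariants of links with `μ` components. -/
def IsVassilievLimitOn (μ : ℕ) (f : OrientedLinkOf μ → ℚ) : Prop :=
  ∃ w : ℕ → OrientedLinkOf μ → ℚ, (∀ n, IsVassilievOn μ (w n)) ∧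
    ∀ L, Tendsto (fun n => w n L) atTop (𝓝 (f L))

end OrientedLinks

namespace OrientedLinks

/-! ### Words of layers -/

theorem Runs_append {x y : List Layer} {a b : List Bool} :
    Runs (x ++ y) a b ↔ ∃ c, Runs x a c ∧ Runs y c b := by
  induction x generalizing a with
  | nil => simp [Runs]
  | cons ℓ x ih =>
    simp only [List.cons_append, Runs, ih]
    constructor
    · rintro ⟨c, h, d, h1, h2⟩; exact ⟨d, ⟨c, h, h1⟩, h2⟩
    · rintro ⟨d, ⟨c, h, h1⟩, h2⟩; exact ⟨c, h, d, h1, h2⟩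

theorem Layer.Step.det {ℓ : Layer} {a b b' : List Bool} (h : ℓ.Step a b) (h' : ℓ.Step a b') :
    b = b' := by
  obtain ⟨l, r, hl, rfl, rfl⟩ := h
  obtain ⟨l', r', hl', h1, rfl⟩ := h'
  simp only [List.append_assoc] at h1
  obtain ⟨rfl, h2⟩ := List.append_inj h1 (hl.trans hl'.symm)
  rw [List.append_cancel_left h2]

theorem Runs.det {w : List Layer} {a b b' : List Bool} (h : Runs w a b) (h' : Runs w a b') :
    b = b' := by
  induction w generalizing a with
  | nil => exact h.symm.trans h'
  | cons ℓ w ih =>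
    obtain ⟨c, h1, h2⟩ := h
    obtain ⟨c', h1', h2'⟩ := h'
    obtain rfl := h1.det h1'
    exact ih h2 h2'

theorem Runs_singleton {ℓ : Layer} {a b : List Bool} : Runs [ℓ] a b ↔ ℓ.Step a b := by
  simp [Runs]

/-- Move a word `n` strands to the right. -/
def shift (n : ℕ) (w : List Layer) : List Layer := w.map fun ℓ => ⟨n + ℓ.pos, ℓ.piece⟩

@[simp] theorem shift_nil (n : ℕ) : shift n [] = [] := rfl

@[simp] theorem shift_cons (n i : ℕ) (e : Piece) (w : List Layer) :
    shift n (⟨i, e⟩ :: w) = ⟨n + i, e⟩ :: shift n w := rfl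

@[simp] theorem shift_append (n : ℕ) (x y : List Layer) :
    shift n (x ++ y) = shift n x ++ shift n y := List.map_append

theorem shift_zero (w : List Layer) : shift 0 w = w := by simp [shift]

theorem Runs.shift_left {w : List Layer} {a b : List Bool} (h : Runs w a b) (l : List Bool) :
    Runs (shift l.length w) (l ++ a) (l ++ b) := by
  induction w generalizing a with
  | nil => obtain rfl := h; rfl
  | cons ℓ w ih =>
    obtain ⟨c, ⟨l', r, h1, rfl, rfl⟩, h2⟩ := h
    exact ⟨_, ⟨l ++ l', r, by simp [h1], by simp, rfl⟩, by simpa [shift] using ih h2⟩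

theorem runs_shift_of {n : ℕ} {w : List Layer} {l a b : List Bool} (hl : l.length = n)
    (h : Runs (shift n w) (l ++ a) b) : ∃ b', b = l ++ b' ∧ Runs w a b' := by
  induction w generalizing a with
  | nil => exact ⟨a, h.symm, rfl⟩
  | cons ℓ w ih =>
    obtain ⟨c, ⟨l', r, h1, h2, rfl⟩, h3⟩ := h
    simp only at h1 h2 h3
    obtain ⟨m, rfl⟩ : ∃ m, l' = l ++ m := by
      have h4 : l ++ a = l' ++ (ℓ.piece.bot ++ r) := by rw [h2, List.append_assoc]
      rcases List.append_eq_append_iff.1 h4 with ⟨m, hm, _⟩ | ⟨m, hm, _⟩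
      · exact ⟨m, hm⟩
      · have : m = [] := by
          apply List.eq_nil_of_length_eq_zero
          have := congrArg List.length hm
          simp at this; omega
        subst this
        exact ⟨[], by simpa using hm.symm⟩
    simp only [List.append_assoc, List.append_cancel_left_eq] at h2
    obtain ⟨b', hb, h5⟩ := ih (a := m ++ ℓ.piece.top ++ r) (by simpa [shift] using h3)
    exact ⟨b', hb, _, ⟨m, r, by simp at h1; omega, by simp [h2], rfl⟩, h5⟩

theorem runs_shift_cons {n : ℕ} {ℓ : Layer} {w : List Layer} {a b : List Bool}
    (h : Runs (shift n (ℓ :: w)) a b) :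
    ∃ l a' b', l.length = n ∧ a = l ++ a' ∧ b = l ++ b' ∧ Runs (ℓ :: w) a' b' := by
  obtain ⟨c, ⟨l', r, h1, h2, h2'⟩, h3⟩ := id h
  have hlen : n ≤ a.length := by
    rw [h2]; simp at h1 ⊢; omega
  refine ⟨a.take n, a.drop n, ?_⟩
  have hl : (a.take n).length = n := by simpa using hlen
  obtain ⟨b', hb, hr⟩ := runs_shift_of (a := a.drop n) (w := ℓ :: w) hl
    (by rwa [List.take_append_drop])
  exact ⟨b', hl, (List.take_append_drop _ _).symm, hb, hr⟩

theorem runs_zero {e : Piece} {w : List Layer} {a b : List Bool} :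
    Runs (⟨0, e⟩ :: w) a b ↔ ∃ r, a = e.bot ++ r ∧ Runs w (e.top ++ r) b := by
  constructor
  · rintro ⟨c, ⟨l, r, h1, rfl, rfl⟩, h⟩
    obtain rfl := List.eq_nil_of_length_eq_zero h1
    exact ⟨r, rfl, h⟩
  · rintro ⟨r, rfl, h⟩
    exact ⟨_, ⟨[], r, rfl, rfl, rfl⟩, h⟩

theorem runs_one {e : Piece} {w : List Layer} {a b : List Bool} :
    Runs (⟨1, e⟩ :: w) a b ↔ ∃ x r, a = x :: (e.bot ++ r) ∧ Runs w (x :: (e.top ++ r)) b := by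
  constructor
  · rintro ⟨c, ⟨l, r, h1, rfl, rfl⟩, h⟩
    obtain ⟨x, rfl⟩ := List.length_eq_one_iff.1 h1
    exact ⟨x, r, rfl, h⟩
  · rintro ⟨x, r, rfl, h⟩
    exact ⟨_, ⟨[x], r, rfl, rfl, rfl⟩, h⟩

/-! ### Directed moves -/

/-- The moves at the left end of a diagram, except for most orientations of the third
Reidemeister move, as rewriting rules: if the left side fits the strands below it, so does the
right side. -/
inductive BasicRule : List Layer → List Layer → Prop
  | exchange (k : ℕ) (e f : Piece) :
      BasicRule [⟨0, e⟩, ⟨e.top.length + k, f⟩] [⟨e.bot.length + k, f⟩, ⟨0, e⟩]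
  | exchangeRev (k : ℕ) (e f : Piece) :
      BasicRule [⟨e.bot.length + k, f⟩, ⟨0, e⟩] [⟨0, e⟩, ⟨e.top.length + k, f⟩]
  | zigzagRight (s : Bool) : BasicRule [⟨1, .cup (!s)⟩, ⟨0, .cap s⟩] []
  | zigzagLeft (s : Bool) : BasicRule [⟨0, .cup s⟩, ⟨1, .cap (!s)⟩] []
  | capSlide (o d s : Bool) :
      BasicRule [⟨0, .cross o d s⟩, ⟨1, .cap d⟩] [⟨1, .cross (!o) s (!d)⟩, ⟨0, .cap d⟩]
  | capSlideRev (o d s : Bool) :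
      BasicRule [⟨1, .cross (!o) s (!d)⟩, ⟨0, .cap d⟩] [⟨0, .cross o d s⟩, ⟨1, .cap d⟩]
  | cupSlide (o d s : Bool) :
      BasicRule [⟨1, .cup d⟩, ⟨0, .cross o s d⟩] [⟨0, .cup d⟩, ⟨1, .cross (!o) (!d) s⟩]
  | cupSlideRev (o d s : Bool) :
      BasicRule [⟨0, .cup d⟩, ⟨1, .cross (!o) (!d) s⟩] [⟨1, .cup d⟩, ⟨0, .cross o s d⟩]
  | capCurl (o d : Bool) :
      BasicRule [⟨0, .cross o d (!d)⟩, ⟨0, .cap (!d)⟩] [⟨0, .cap d⟩]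
  | capCurlRev (o d : Bool) :
      BasicRule [⟨0, .cap d⟩] [⟨0, .cross o d (!d)⟩, ⟨0, .cap (!d)⟩]
  | cupCurl (o d : Bool) :
      BasicRule [⟨0, .cup d⟩, ⟨0, .cross o d (!d)⟩] [⟨0, .cup (!d)⟩]
  | cupCurlRev (o d : Bool) :
      BasicRule [⟨0, .cup (!d)⟩] [⟨0, .cup d⟩, ⟨0, .cross o d (!d)⟩]
  | reidemeisterTwo (o s t : Bool) :
      BasicRule [⟨0, .cross o s t⟩, ⟨0, .cross (!o) t s⟩] []

/-- All moves at the left end of a diagram, as rewriting rules. -/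
inductive Rule : List Layer → List Layer → Prop
  | basic {p q : List Layer} (h : BasicRule p q) : Rule p q
  | reidemeisterThree (a b c s t u : Bool) (h : a = c → b = a) :
      Rule [⟨0, .cross a s t⟩, ⟨1, .cross b s u⟩, ⟨0, .cross c t u⟩]
        [⟨1, .cross c t u⟩, ⟨0, .cross b s u⟩, ⟨1, .cross a s t⟩]
  | reidemeisterThreeRev (a b c s t u : Bool) (h : a = c → b = a) :
      Rule [⟨1, .cross c t u⟩, ⟨0, .cross b s u⟩, ⟨1, .cross a s t⟩]
        [⟨0, .cross a s t⟩, ⟨1, .cross b s u⟩, ⟨0, .cross c t u⟩]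

/-- Rewriting a word by rules from `R` anywhere in the diagram. -/
inductive Rewrites (R : List Layer → List Layer → Prop) : List Layer → List Layer → Prop
  | refl (w : List Layer) : Rewrites R w w
  | head {x y p q w : List Layer} {i : ℕ} (h : R p q)
      (hw : Rewrites R (x ++ shift i q ++ y) w) : Rewrites R (x ++ shift i p ++ y) w

namespace Rewrites

variable {R : List Layer → List Layer → Prop}

theorem trans {u v w : List Layer} (h : Rewrites R u v) (h' : Rewrites R v w) :
    Rewrites R u w := by
  induction h with
  | refl => exact h'
  | head hr _ ih => exact .head hr (ih h')

theorem of_rule {p q : List Layer} (h : R p q) (i : ℕ) : Rewrites R (shift i p) (shift i q) := by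
  have := Rewrites.head (x := []) (y := []) (i := i) h (.refl _)
  simpa using this

theorem of_rule_zero {p q : List Layer} (h : R p q) : Rewrites R p q := by
  simpa [shift_zero] using of_rule h 0

theorem ctx {p q : List Layer} (h : Rewrites R p q) (x y : List Layer) :
    Rewrites R (x ++ p ++ y) (x ++ q ++ y) := by
  induction h with
  | refl => exact .refl _
  | @head x' y' p q w i hr _ ih =>
    have := Rewrites.head (x := x ++ x') (y := y' ++ y) (i := i) hr (by simpa using ih)
    simpa using this

theorem left {p q : List Layer} (h : Rewrites R p q) (x : List Layer) :
    Rewrites R (x ++ p) (x ++ q) := by simpa using h.ctx x []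

theorem right {p q : List Layer} (h : Rewrites R p q) (y : List Layer) :
    Rewrites R (p ++ y) (q ++ y) := by simpa using h.ctx [] y

theorem cons {p q : List Layer} (h : Rewrites R p q) (ℓ : Layer) :
    Rewrites R (ℓ :: p) (ℓ :: q) := h.left [ℓ]

theorem mono {R' : List Layer → List Layer → Prop} (hR : ∀ p q, R p q → R' p q)
    {p q : List Layer} (h : Rewrites R p q) : Rewrites R' p q := by
  induction h with
  | refl => exact .refl _
  | head hr _ ih => exact .head (hR _ _ hr) ih

end Rewrites

theorem exchange_runs {i j : ℕ} {e f : Piece} {a b : List Bool}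
    (hj : e.bot.length ≤ j) (hi : i + e.bot.length = j + e.top.length) :
    Runs [⟨0, e⟩, ⟨i, f⟩] a b ↔ Runs [⟨j, f⟩, ⟨0, e⟩] a b := by
  rw [runs_zero]
  constructor
  · rintro ⟨r, rfl, c, ⟨l, r', h1, h2, rfl⟩, h3⟩
    obtain rfl := h3
    simp only at h1 h2
    have h4 : e.top ++ r = l ++ (f.bot ++ r') := by rw [h2, List.append_assoc]
    obtain ⟨m, rfl⟩ : ∃ m, l = e.top ++ m := by
      rcases List.append_eq_append_iff.1 h4 with ⟨m, hm, _⟩ | ⟨m, hm, _⟩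
      · exact ⟨m, hm⟩
      · have : m = [] := by
          apply List.eq_nil_of_length_eq_zero
          have := congrArg List.length hm
          simp at this; omega
        subst this
        exact ⟨[], by simpa using hm.symm⟩
    simp only [List.append_assoc, List.append_cancel_left_eq] at h2
    subst h2
    refine ⟨_, ⟨e.bot ++ m, r', by simp at h1 ⊢; omega, by simp, rfl⟩, ?_⟩
    rw [runs_zero]
    exact ⟨m ++ f.top ++ r', by simp, by simp [Runs]⟩
  · rintro ⟨c, ⟨l, r', h1, h2, rfl⟩, h3⟩
    simp only at h1 h2
    rw [runs_zero] at h3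
    obtain ⟨r, h4, h5⟩ := h3
    obtain rfl := h5
    simp only [List.append_assoc] at h4
    obtain ⟨m, rfl⟩ : ∃ m, l = e.bot ++ m := by
      rcases List.append_eq_append_iff.1 h4.symm with ⟨m, hm, _⟩ | ⟨m, hm, _⟩
      · exact ⟨m, hm⟩
      · have : m = [] := by
          apply List.eq_nil_of_length_eq_zero
          have := congrArg List.length hm
          simp at this; omega
        subst this
        exact ⟨[], by simpa using hm.symm⟩
    simp only [List.append_assoc, List.append_cancel_left_eq] at h4
    subst h4 h2
    exact ⟨m ++ f.bot ++ r', by simp,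
      _, ⟨e.top ++ m, r', by simp at h1 ⊢; omega, by simp, rfl⟩, by simp [Runs]⟩

theorem BasicRule.runs {p q : List Layer} (h : BasicRule p q) {a b : List Bool}
    (hp : Runs p a b) : Runs q a b := by
  cases h with
  | exchange k e f => exact (exchange_runs (by omega) (by omega)).1 hp
  | exchangeRev k e f => exact (exchange_runs (by omega) (by omega)).2 hp
  | _ =>
    simp only [runs_zero, runs_one, Piece.bot, Piece.top, List.cons_append, List.nil_append,
      List.cons.injEq, Bool.not_not] at hp ⊢
    try simp only [Runs] at hp ⊢
    grind

theorem Rule.runs {p q : List Layer} (h : Rule p q) {a b : List Bool}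
    (hp : Runs p a b) : Runs q a b := by
  cases h with
  | basic h => exact h.runs hp
  | _ =>
    simp only [runs_zero, runs_one, Piece.bot, Piece.top, List.cons_append, List.nil_append,
      List.cons.injEq] at hp ⊢
    simp only [Runs] at hp ⊢
    grind

theorem Rule.ne_nil {p q : List Layer} (h : Rule p q) : p ≠ [] := by
  cases h with
  | basic h => cases h <;> simp
  | _ => simp

theorem Rule.runs_shift {p q : List Layer} (h : Rule p q) {i : ℕ} {a b : List Bool}
    (hp : Runs (shift i p) a b) : Runs (shift i q) a b := by
  obtain ⟨ℓ, p, rfl⟩ := List.exists_cons_of_ne_nil h.ne_nil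
  obtain ⟨l, a', b', rfl, rfl, rfl, hr⟩ := runs_shift_cons hp
  exact (h.runs hr).shift_left l

theorem Rewrites.runs {w w' : List Layer} (h : Rewrites Rule w w') {a b : List Bool}
    (hw : Runs w a b) : Runs w' a b := by
  induction h with
  | refl => exact hw
  | head hr _ ih =>
    refine ih ?_
    simp only [Runs_append] at hw ⊢
    obtain ⟨d, ⟨c, h1, h2⟩, h3⟩ := hw
    exact ⟨d, ⟨c, h1, hr.runs_shift h2⟩, h3⟩


/-! ### Words and links -/

/-- `w` is the word of a link diagram. -/
structure IsLinkWord (w : List Layer) : Prop where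
  closed : Runs w [] []
  ne_nil : w ≠ []
  noDouble : w.countP Layer.isDouble = 0

/-- The diagram with a given word. -/
def IsLinkWord.diagram {w : List Layer} (h : IsLinkWord w) : LinkDiagram :=
  ⟨⟨w, h.closed, h.ne_nil⟩, h.noDouble⟩

/-- The link with a given word. -/
def IsLinkWord.link {w : List Layer} (h : IsLinkWord w) : OrientedLink := Quot.mk Move h.diagram

theorem LinkDiagram.isLinkWord (D : LinkDiagram) : IsLinkWord D.1.word :=
  ⟨D.1.closed, D.1.nonempty, D.2⟩

theorem SingularDiagram.isLinkWord {D : SingularDiagram} (h : D.doublePoints = 0) :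
    IsLinkWord D.word := ⟨D.closed, D.nonempty, h⟩

theorem IsLinkWord.represents {w : List Layer} (h : IsLinkWord w) :
    h.diagram.1.Represents h.link := ⟨h.noDouble, rfl⟩

theorem OrientedLink.exists_word (L : OrientedLink) :
    ∃ (w : List Layer) (h : IsLinkWord w), h.link = L := by
  induction L using Quot.ind with
  | mk D => exact ⟨D.1.word, D.isLinkWord, rfl⟩

theorem Rule.localMove {p q : List Layer} (h : Rule p q) (i : ℕ) :
    LocalMove (shift i p) (shift i q) ∨ LocalMove (shift i q) (shift i p) := by
  rcases h with h | ⟨a, b, c, s, t, u, h⟩ | ⟨a, b, c, s, t, u, h⟩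
  · cases h with
    | exchange k e f => exact .inl (by simpa [add_assoc] using LocalMove.exchange i k e f)
    | exchangeRev k e f => exact .inr (by simpa [add_assoc] using LocalMove.exchange i k e f)
    | zigzagRight s => exact .inl (.zigzagRight i s)
    | zigzagLeft s => exact .inl (.zigzagLeft i s)
    | capSlide o d s => exact .inl (.capSlide i o d s)
    | capSlideRev o d s => exact .inr (.capSlide i o d s)
    | cupSlide o d s => exact .inl (.cupSlide i o d s)
    | cupSlideRev o d s => exact .inr (.cupSlide i o d s)
    | capCurl o d => exact .inl (.capCurl i o d)
    | capCurlRev o d => exact .inr (.capCurl i o d)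
    | cupCurl o d => exact .inl (.cupCurl i o d)
    | cupCurlRev o d => exact .inr (.cupCurl i o d)
    | reidemeisterTwo o s t => exact .inl (.reidemeisterTwo i o s t)
  · exact .inl (.reidemeisterThree i a b c s t u h)
  · exact .inr (.reidemeisterThree i a b c s t u h)

theorem LocalMove.exists_rule {p q : List Layer} (h : LocalMove p q) :
    ∃ i p' q', Rule p' q' ∧ p = shift i p' ∧ q = shift i q' := by
  cases h with
  | exchange i k e f => exact ⟨i, _, _, .basic (.exchange k e f), by simp [add_assoc],
      by simp [add_assoc]⟩
  | zigzagRight i s => exact ⟨i, _, _, .basic (.zigzagRight s), rfl, rfl⟩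
  | zigzagLeft i s => exact ⟨i, _, _, .basic (.zigzagLeft s), rfl, rfl⟩
  | capSlide i o d s => exact ⟨i, _, _, .basic (.capSlide o d s), rfl, rfl⟩
  | cupSlide i o d s => exact ⟨i, _, _, .basic (.cupSlide o d s), rfl, rfl⟩
  | capCurl i o d => exact ⟨i, _, _, .basic (.capCurl o d), rfl, rfl⟩
  | cupCurl i o d => exact ⟨i, _, _, .basic (.cupCurl o d), rfl, rfl⟩
  | reidemeisterTwo i o s t => exact ⟨i, _, _, .basic (.reidemeisterTwo o s t), rfl, rfl⟩
  | reidemeisterThree i a b c s t u h =>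
    exact ⟨i, _, _, .reidemeisterThree a b c s t u h, rfl, rfl⟩

theorem countP_shift (i : ℕ) (w : List Layer) :
    (shift i w).countP Layer.isDouble = w.countP Layer.isDouble := by
  rw [shift, List.countP_map]
  rfl

theorem Rule.countP_eq {p q : List Layer} (h : Rule p q) :
    q.countP Layer.isDouble = p.countP Layer.isDouble := by
  cases h with
  | basic h =>
    cases h <;> simp [List.countP_cons, Layer.isDouble, add_comm] <;> rfl
  | _ => simp [Layer.isDouble]

theorem Rule.not_runs_nil {p : List Layer} (h : Rule p []) (i : ℕ) (b : List Bool) :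
    ¬ Runs (shift i p) [] b := by
  intro hr
  obtain ⟨ℓ, p, rfl⟩ := List.exists_cons_of_ne_nil h.ne_nil
  obtain ⟨l, a', b', _, h1, _, hr⟩ := runs_shift_cons hr
  obtain ⟨rfl, rfl⟩ := List.append_eq_nil_iff.1 h1.symm
  generalize hq : ([] : List Layer) = q at h
  cases h with
  | basic h =>
    cases h <;> simp [runs_zero, runs_one, Piece.bot, Piece.top] at hr hq
  | _ => simp at hq

theorem IsLinkWord.rule {x y p q : List Layer} {i : ℕ} (hr : Rule p q)
    (h : IsLinkWord (x ++ shift i p ++ y)) :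
    ∃ h' : IsLinkWord (x ++ shift i q ++ y), h'.link = h.link := by
  have h' : IsLinkWord (x ++ shift i q ++ y) := by
    refine ⟨(Rewrites.head hr (.refl _)).runs h.closed, fun h0 => ?_, ?_⟩
    · simp only [List.append_eq_nil_iff] at h0
      obtain ⟨⟨rfl, hq⟩, rfl⟩ := h0
      obtain rfl : q = [] := by simpa [shift] using hq
      exact hr.not_runs_nil i [] (by simpa using h.closed)
    · have := h.noDouble
      simp only [List.countP_append, countP_shift, hr.countP_eq] at this ⊢
      exact this
  refine ⟨h', ?_⟩
  rcases hr.localMove i with hm | hm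
  · exact (Quot.sound ⟨x, y, _, _, hm, rfl, rfl⟩).symm
  · exact Quot.sound ⟨x, y, _, _, hm, rfl, rfl⟩

theorem IsLinkWord.rewrites {w w' : List Layer} (hr : Rewrites Rule w w') (h : IsLinkWord w) :
    ∃ h' : IsLinkWord w', h'.link = h.link := by
  induction hr with
  | refl => exact ⟨h, rfl⟩
  | head hr _ ih =>
    obtain ⟨h1, e1⟩ := h.rule hr
    obtain ⟨h2, e2⟩ := ih h1
    exact ⟨h2, e2.trans e1⟩

end OrientedLinks

namespace OrientedLinks

/-! ### Sliding strands -/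

theorem Rewrites.exchange {i j j' : ℕ} {e f : Piece} (h : i + e.bot.length ≤ j)
    (h' : j' + e.bot.length = j + e.top.length) :
    Rewrites BasicRule [⟨i, e⟩, ⟨j', f⟩] [⟨j, f⟩, ⟨i, e⟩] := by
  obtain ⟨k, rfl⟩ := Nat.exists_eq_add_of_le h
  obtain rfl : j' = i + (e.top.length + k) := by omega
  simpa [add_assoc] using Rewrites.of_rule (BasicRule.exchange k e f) i

theorem Rewrites.exchange_rev {i j j' : ℕ} {e f : Piece} (h : i + e.bot.length ≤ j)
    (h' : j' + e.bot.length = j + e.top.length) :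
    Rewrites BasicRule [⟨j, f⟩, ⟨i, e⟩] [⟨i, e⟩, ⟨j', f⟩] := by
  obtain ⟨k, rfl⟩ := Nat.exists_eq_add_of_le h
  obtain rfl : j' = i + (e.top.length + k) := by omega
  simpa [add_assoc] using Rewrites.of_rule (BasicRule.exchangeRev k e f) i

theorem Rewrites.layer_past (i : ℕ) (e : Piece) (w : List Layer) :
    Rewrites BasicRule (⟨i, e⟩ :: OrientedLinks.shift (i + e.top.length) w)
      (OrientedLinks.shift (i + e.bot.length) w ++ [⟨i, e⟩]) := by
  induction w with
  | nil => exact .refl _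
  | cons ℓ w ih =>
    obtain ⟨j, f⟩ := ℓ
    refine .trans (v := ⟨i + e.bot.length + j, f⟩ :: ⟨i, e⟩ ::
      OrientedLinks.shift (i + e.top.length) w) ?_ ?_
    · exact (Rewrites.exchange (by omega) (by simp only; omega)).right _
    · exact ih.cons _

theorem Rewrites.past_layer (i : ℕ) (e : Piece) (w : List Layer) :
    Rewrites BasicRule (OrientedLinks.shift (i + e.bot.length) w ++ [⟨i, e⟩])
      (⟨i, e⟩ :: OrientedLinks.shift (i + e.top.length) w) := by
  induction w with
  | nil => exact .refl _
  | cons ℓ w ih =>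
    obtain ⟨j, f⟩ := ℓ
    refine .trans (v := ⟨i + e.bot.length + j, f⟩ :: ⟨i, e⟩ ::
      OrientedLinks.shift (i + e.top.length) w) ?_ ?_
    · exact ih.cons _
    · exact (Rewrites.exchange_rev (by omega) (by simp only; omega)).right _

theorem Rewrites.full {p q : List Layer} (h : Rewrites BasicRule p q) : Rewrites Rule p q :=
  h.mono fun _ _ => .basic

/-- The strand at position `i`, with orientation `s`, is pulled to the right over strands with
orientations `u`. -/
def pull (i : ℕ) (s : Bool) : List Bool → List Layer
  | [] => []
  | t :: u => ⟨i, .cross true s t⟩ :: pull (i + 1) s u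

@[simp] theorem pull_nil (i : ℕ) (s : Bool) : pull i s [] = [] := rfl

@[simp] theorem pull_cons (i : ℕ) (s t : Bool) (u : List Bool) :
    pull i s (t :: u) = ⟨i, .cross true s t⟩ :: pull (i + 1) s u := rfl

theorem pull_append (i : ℕ) (s : Bool) (u v : List Bool) :
    pull i s (u ++ v) = pull i s u ++ pull (i + u.length) s v := by
  induction u generalizing i with
  | nil => rfl
  | cons t u ih => simp [ih, add_assoc, add_comm 1]

theorem shift_pull (n i : ℕ) (s : Bool) (u : List Bool) :
    shift n (pull i s u) = pull (n + i) s u := by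
  induction u generalizing i with
  | nil => rfl
  | cons t u ih => simp [ih, add_assoc]

theorem runs_pull (s : Bool) (u r : List Bool) (l : List Bool) :
    Runs (pull l.length s u) (l ++ s :: u ++ r) (l ++ u ++ s :: r) := by
  induction u generalizing l with
  | nil => simp [Runs]
  | cons t u ih =>
    refine ⟨l ++ [t, s] ++ (u ++ r), ⟨l, u ++ r, rfl, by simp [Piece.bot], rfl⟩, ?_⟩
    simpa using ih (l ++ [t])

theorem Rewrites.pull_past_right {i j : ℕ} {s : Bool} {u : List Bool} {e : Piece}
    (h : i + u.length + 1 ≤ j) :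
    Rewrites BasicRule (pull i s u ++ [⟨j, e⟩]) (⟨j, e⟩ :: pull i s u) := by
  induction u generalizing i with
  | nil => exact .refl _
  | cons t u ih =>
    simp only [List.length_cons] at h
    refine .trans (v := ⟨i, .cross true s t⟩ :: ⟨j, e⟩ :: pull (i + 1) s u) ?_ ?_
    · exact (ih (by omega)).cons _
    · exact (Rewrites.exchange (by simp [Piece.bot]; omega) (by simp [Piece.bot, Piece.top])).right _

/-- A layer to the left of a strand being pulled. -/
theorem Rewrites.pull_past_left {i j j' : ℕ} {s : Bool} {u : List Bool} {e : Piece}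
    (h : i + e.bot.length ≤ j) (h' : j' + e.bot.length = j + e.top.length) :
    Rewrites BasicRule (pull j s u ++ [⟨i, e⟩]) (⟨i, e⟩ :: pull j' s u) := by
  obtain ⟨k, rfl⟩ := Nat.exists_eq_add_of_le h
  obtain rfl : j' = i + e.top.length + k := by omega
  have := Rewrites.past_layer i e (pull k s u)
  simpa [shift_pull] using this

theorem Rewrites.pull_cross (i : ℕ) (s o x y : Bool) (u v : List Bool) :
    Rewrites Rule (pull i s (u ++ x :: y :: v) ++ [⟨i + u.length, .cross o x y⟩])
      (⟨i + u.length + 1, .cross o x y⟩ :: pull i s (u ++ y :: x :: v)) := by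
  simp only [pull_append, pull_cons]
  generalize hj : i + u.length = j
  refine .trans (v := pull i s u ++ [⟨j, .cross true s x⟩, ⟨j + 1, .cross true s y⟩,
    ⟨j, .cross o x y⟩] ++ pull (j + 1 + 1) s v) ?_ ?_
  · have := (Rewrites.pull_past_left (i := j) (j := j + 1 + 1) (j' := j + 1 + 1) (s := s) (u := v)
      (e := .cross o x y) (by simp [Piece.bot]) (by simp [Piece.bot, Piece.top])).full
    have := this.left (pull i s u ++ [⟨j, .cross true s x⟩, ⟨j + 1, .cross true s y⟩])
    simpa using this
  refine .trans (v := pull i s u ++ [⟨j + 1, .cross o x y⟩, ⟨j, .cross true s y⟩,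
    ⟨j + 1, .cross true s x⟩] ++ pull (j + 1 + 1) s v) ?_ ?_
  · exact (Rewrites.of_rule (Rule.reidemeisterThree true true o s x y (fun _ => rfl)) j).ctx _ _
  · have := (Rewrites.pull_past_right (i := i) (j := j + 1) (s := s) (u := u)
      (e := .cross o x y) (by omega)).full
    have := this.right
      ([⟨j, .cross true s y⟩, ⟨j + 1, .cross true s x⟩] ++ pull (j + 1 + 1) s v)
    simpa using this

theorem Rewrites.pull_cap (i : ℕ) (s x : Bool) (u v : List Bool) :
    Rewrites Rule (pull i s (u ++ x :: (!x) :: v) ++ [⟨i + u.length, .cap x⟩])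
      (⟨i + u.length + 1, .cap x⟩ :: pull i s (u ++ v)) := by
  simp only [pull_append, pull_cons]
  generalize hj : i + u.length = j
  refine .trans (v := pull i s u ++ [⟨j, .cross true s x⟩, ⟨j + 1, .cross true s (!x)⟩,
    ⟨j, .cap x⟩] ++ pull j s v) ?_ ?_
  · have := (Rewrites.pull_past_left (i := j) (j := j + 1 + 1) (j' := j) (s := s) (u := v)
      (e := .cap x) (by simp [Piece.bot]) (by simp [Piece.bot, Piece.top])).full
    have := this.left (pull i s u ++ [⟨j, .cross true s x⟩, ⟨j + 1, .cross true s (!x)⟩])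
    simpa using this
  refine .trans (v := pull i s u ++ [⟨j, .cross true s x⟩, ⟨j, .cross false x s⟩,
    ⟨j + 1, .cap x⟩] ++ pull j s v) ?_ ?_
  · have := (Rewrites.of_rule (BasicRule.capSlideRev false x s) j).full
    have := this.ctx (pull i s u ++ [⟨j, .cross true s x⟩]) (pull j s v)
    simpa using this
  refine .trans (v := pull i s u ++ [⟨j + 1, .cap x⟩] ++ pull j s v) ?_ ?_
  · have := (Rewrites.of_rule (BasicRule.reidemeisterTwo true s x) j).full
    have := this.ctx (pull i s u) (⟨j + 1, .cap x⟩ :: pull j s v)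
    simpa using this
  · have := (Rewrites.pull_past_right (i := i) (j := j + 1) (s := s) (u := u)
      (e := .cap x) (by omega)).full
    have := this.right (pull j s v)
    simpa using this

theorem Rewrites.cup_pull (i : ℕ) (s x : Bool) (u v : List Bool) :
    Rewrites Rule (⟨i + u.length + 1, .cup x⟩ :: pull i s (u ++ x :: (!x) :: v))
      (pull i s (u ++ v) ++ [⟨i + u.length, .cup x⟩]) := by
  simp only [pull_append, pull_cons]
  generalize hj : i + u.length = j
  refine .trans (v := pull i s u ++ [⟨j + 1, .cup x⟩, ⟨j, .cross true s x⟩,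
    ⟨j + 1, .cross true s (!x)⟩] ++ pull (j + 1 + 1) s v) ?_ ?_
  · have : Rewrites BasicRule (⟨j + 1, .cup x⟩ :: pull i s u)
        (pull i s u ++ [⟨j + 1, .cup x⟩]) := by
      clear v
      induction u generalizing i with
      | nil => exact .refl _
      | cons t u ih =>
        simp only [List.length_cons] at hj
        refine .trans (v := ⟨i, .cross true s t⟩ :: ⟨j + 1, .cup x⟩ :: pull (i + 1) s u) ?_ ?_
        · exact (Rewrites.exchange_rev (by simp [Piece.bot]; omega)
            (by simp [Piece.bot, Piece.top])).right _
        · exact (ih (i + 1) (by omega)).cons _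
    have := this.full.right
      ([⟨j, .cross true s x⟩, ⟨j + 1, .cross true s (!x)⟩] ++ pull (j + 1 + 1) s v)
    simpa using this
  refine .trans (v := pull i s u ++ [⟨j, .cup x⟩, ⟨j + 1, .cross false (!x) s⟩,
    ⟨j + 1, .cross true s (!x)⟩] ++ pull (j + 1 + 1) s v) ?_ ?_
  · have := (Rewrites.of_rule (BasicRule.cupSlide true x s) j).full
    have := this.ctx (pull i s u) (⟨j + 1, .cross true s (!x)⟩ :: pull (j + 1 + 1) s v)
    simpa using this
  refine .trans (v := pull i s u ++ [⟨j, .cup x⟩] ++ pull (j + 1 + 1) s v) ?_ ?_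
  · have := (Rewrites.of_rule (BasicRule.reidemeisterTwo false (!x) s) (j + 1)).full
    have := this.ctx (pull i s u ++ [⟨j, .cup x⟩]) (pull (j + 1 + 1) s v)
    simpa using this
  · have := (Rewrites.layer_past j (.cup x) (pull 0 s v)).full
    simp only [shift_pull] at this
    simpa [Piece.bot, Piece.top] using this.left (pull i s u)

/-- An arc from the leftmost position, with orientation `d` there, over strands with
orientations `u`. -/
def arc (d : Bool) (u : List Bool) : List Layer := ⟨0, .cup d⟩ :: pull 1 (!d) u

theorem runs_arc (d : Bool) (u r : List Bool) :
    Runs (arc d u) (u ++ r) (d :: u ++ (!d) :: r) :=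
  ⟨[d, !d] ++ (u ++ r), ⟨[], u ++ r, rfl, rfl, rfl⟩, by simpa using runs_pull (!d) u r [d]⟩

theorem Rewrites.arc_cross (d o x y : Bool) (u v : List Bool) :
    Rewrites Rule (arc d (u ++ x :: y :: v) ++ [⟨u.length + 1, .cross o x y⟩])
      (⟨u.length, .cross o x y⟩ :: arc d (u ++ y :: x :: v)) := by
  have h := (Rewrites.pull_cross 1 (!d) o x y u v).cons ⟨0, .cup d⟩
  rw [add_comm 1] at h
  refine .trans h ?_
  exact (Rewrites.exchange (by simp [Piece.bot]) (by simp [Piece.bot, Piece.top])).full.right _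

theorem Rewrites.arc_cap (d x : Bool) (u v : List Bool) :
    Rewrites Rule (arc d (u ++ x :: (!x) :: v) ++ [⟨u.length + 1, .cap x⟩])
      (⟨u.length, .cap x⟩ :: arc d (u ++ v)) := by
  have h := (Rewrites.pull_cap 1 (!d) x u v).cons ⟨0, .cup d⟩
  rw [add_comm 1] at h
  refine .trans h ?_
  exact (Rewrites.exchange (by simp [Piece.bot]) (by simp [Piece.bot, Piece.top])).full.right _

theorem Rewrites.cup_arc (d x : Bool) (u v : List Bool) :
    Rewrites Rule (⟨u.length, .cup x⟩ :: arc d (u ++ x :: (!x) :: v))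
      (arc d (u ++ v) ++ [⟨u.length + 1, .cup x⟩]) := by
  have h := (Rewrites.cup_pull 1 (!d) x u v).cons ⟨0, .cup d⟩
  rw [add_comm 1] at h
  refine .trans ?_ h
  exact (Rewrites.exchange_rev (by simp [Piece.bot]) (by simp [Piece.bot, Piece.top])).full.right _

theorem Rewrites.arc_past_right (d : Bool) (u : List Bool) (j : ℕ) (e : Piece) :
    Rewrites Rule (arc d u ++ [⟨u.length + 2 + j, e⟩]) (⟨u.length + j, e⟩ :: arc d u) := by
  have h := ((Rewrites.pull_past_right (i := 1) (j := u.length + 2 + j) (s := !d) (u := u)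
    (e := e) (by omega)).cons ⟨0, .cup d⟩).full
  refine .trans h ?_
  exact (Rewrites.exchange (by simp [Piece.bot]) (by simp [Piece.bot, Piece.top]; omega)).full.right _

theorem arc_append_singleton (d t : Bool) (u : List Bool) :
    arc d (u ++ [t]) = arc d u ++ [⟨u.length + 1, .cross true (!d) t⟩] := by
  simp [arc, pull_append, add_comm]

theorem Rewrites.arc_uncross (d t : Bool) (u : List Bool) :
    Rewrites Rule (arc d (u ++ [t]) ++ [⟨u.length + 1, .cross false t (!d)⟩]) (arc d u) := by
  rw [arc_append_singleton]
  have := (Rewrites.of_rule (BasicRule.reidemeisterTwo true (!d) t) (u.length + 1)).full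
  have := this.left (arc d u)
  simpa using this

theorem Rewrites.arc_nil_cross (d o : Bool) :
    Rewrites Rule (arc d [] ++ [⟨0, .cross o d (!d)⟩]) (arc (!d) []) :=
  .of_rule_zero (.basic (.cupCurl o d))

theorem Rewrites.arc_cons_cross (d t : Bool) (u : List Bool) :
    Rewrites Rule (arc d (t :: u) ++ [⟨0, .cross true d t⟩])
      (⟨1, .cup d⟩ :: pull 2 (!d) u) := by
  refine .trans (v := [⟨0, .cup d⟩, ⟨1, .cross true (!d) t⟩, ⟨0, .cross true d t⟩] ++
    pull 2 (!d) u) ?_ ?_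
  · have := (Rewrites.pull_past_left (i := 0) (j := 2) (j' := 2) (s := !d) (u := u)
      (e := .cross true d t) (by simp [Piece.bot]) (by simp [Piece.bot, Piece.top])).full
    exact this.left [⟨0, .cup d⟩, ⟨1, .cross true (!d) t⟩]
  refine .trans (v := [⟨1, .cup d⟩, ⟨0, .cross false t d⟩, ⟨0, .cross true d t⟩] ++
    pull 2 (!d) u) ?_ ?_
  · have := (Rewrites.of_rule_zero (BasicRule.cupSlideRev false d t)).full
    exact this.right (⟨0, .cross true d t⟩ :: pull 2 (!d) u)
  · have := (Rewrites.of_rule_zero (BasicRule.reidemeisterTwo false t d)).full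
    exact this.ctx [⟨1, .cup d⟩] (pull 2 (!d) u)

theorem Rewrites.arc_append_cap (d t : Bool) (u : List Bool) :
    Rewrites Rule (arc d (u ++ [t]) ++ [⟨u.length + 2, .cap (!d)⟩])
      (⟨u.length, .cross false t d⟩ :: (arc d u ++ [⟨u.length + 1, .cap (!d)⟩])) := by
  rw [arc_append_singleton]
  refine .trans (v := arc d u ++ [⟨u.length + 2, .cross false t d⟩,
    ⟨u.length + 1, .cap (!d)⟩]) ?_ ?_
  · have := (Rewrites.of_rule (BasicRule.capSlide true (!d) t) (u.length + 1)).full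
    have := this.left (arc d u)
    simpa using this
  · simpa using (Rewrites.arc_past_right d u 0 (.cross false t d)).right
      [⟨u.length + 1, .cap (!d)⟩]

theorem Rewrites.arc_nil_cap (d : Bool) :
    Rewrites Rule (arc d [] ++ [⟨1, .cap (!d)⟩]) [] :=
  .of_rule_zero (.basic (.zigzagLeft d))

theorem Rewrites.arc_curl (d : Bool) (u : List Bool) :
    Rewrites Rule (arc d (u ++ [d]) ++ [⟨u.length + 1, .cap d⟩])
      (arc d u ++ [⟨u.length + 1, .cap (!d)⟩]) := by
  rw [arc_append_singleton]
  have := (Rewrites.of_rule (BasicRule.capCurl true (!d)) (u.length + 1)).full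
  have := this.left (arc d u)
  simpa using this

theorem Rewrites.arc_cons_cap (d : Bool) (u : List Bool) :
    Rewrites Rule (arc d ((!d) :: u) ++ [⟨0, .cap d⟩]) (pull 0 (!d) u) := by
  refine .trans (v := [⟨0, .cup d⟩, ⟨1, .cross true (!d) (!d)⟩, ⟨0, .cap d⟩] ++
    pull 0 (!d) u) ?_ ?_
  · have := (Rewrites.pull_past_left (i := 0) (j := 2) (j' := 0) (s := !d) (u := u)
      (e := .cap d) (by simp [Piece.bot]) (by simp [Piece.bot, Piece.top])).full
    exact this.left [⟨0, .cup d⟩, ⟨1, .cross true (!d) (!d)⟩]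
  refine .trans (v := [⟨0, .cup d⟩, ⟨0, .cross false d (!d)⟩, ⟨1, .cap d⟩] ++
    pull 0 (!d) u) ?_ ?_
  · have := (Rewrites.of_rule_zero (BasicRule.capSlideRev false d (!d))).full
    exact this.ctx [⟨0, .cup d⟩] (pull 0 (!d) u)
  refine .trans (v := [⟨0, .cup (!d)⟩, ⟨1, .cap d⟩] ++ pull 0 (!d) u) ?_ ?_
  · have := (Rewrites.of_rule_zero (BasicRule.cupCurl false d)).full
    exact this.right (⟨1, .cap d⟩ :: pull 0 (!d) u)
  · have := (Rewrites.of_rule_zero (BasicRule.zigzagLeft (!d))).full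
    rw [Bool.not_not] at this
    exact this.right (pull 0 (!d) u)

end OrientedLinks

namespace OrientedLinks

/-! ### Induction over the skein relation -/

/-- Standard diagrams: some circles, followed by arcs that lie on top of each other. -/
inductive Standard : List Bool → List Layer → Prop
  | nil : Standard [] []
  | circle {w : List Layer} (h : Standard [] w) :
      Standard [] (w ++ [⟨0, .cup true⟩, ⟨0, .cap true⟩])
  | arc {w : List Layer} (d : Bool) (u r : List Bool) (h : Standard (u ++ r) w) :
      Standard (d :: u ++ (!d) :: r) (w ++ arc d u)

/-- Words that can be reduced to standard ones by moves and the skein relation. -/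
inductive Reducible : List Layer → Prop
  | standard {b : List Bool} {w : List Layer} (h : Standard b w) : Reducible w
  | rewrite {w w' : List Layer} (h : Rewrites Rule w w') (h' : Reducible w') : Reducible w
  | rewriteBack {b : List Bool} {w w' : List Layer} (h : Rewrites Rule w w') (hw : Runs w [] b)
      (h' : Reducible w) : Reducible w'
  | skein {x y : List Layer} {i : ℕ} {o s t : Bool}
      (h : Reducible (x ++ [⟨i, .cross (!o) s t⟩] ++ y))
      (h' : Reducible (x ++ smoothing i s t ++ y)) :
      Reducible (x ++ [⟨i, .cross o s t⟩] ++ y)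

theorem runs_change_cross {x y : List Layer} {i : ℕ} {o s t : Bool} (o' : Bool) {a b : List Bool}
    (h : Runs (x ++ [⟨i, .cross o s t⟩] ++ y) a b) :
    Runs (x ++ [⟨i, .cross o' s t⟩] ++ y) a b := by
  simp only [Runs_append] at h ⊢
  exact h

theorem runs_smoothing {i : ℕ} {o s t : Bool} {a b : List Bool}
    (h : Runs [⟨i, .cross o s t⟩] a b) : Runs (smoothing i s t) a b := by
  obtain ⟨c, ⟨l, r, rfl, rfl, rfl⟩, rfl⟩ := h
  unfold smoothing
  split_ifs with hst
  · subst hst; rfl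
  · obtain rfl : t = !s := by cases s <;> cases t <;> simp_all
    exact ⟨l ++ r, ⟨l, r, rfl, rfl, by simp [Piece.top]⟩,
      _, ⟨l, r, rfl, by simp [Piece.bot], rfl⟩, by simp [Runs, Piece.top]⟩

theorem runs_smooth {x y : List Layer} {i : ℕ} {o s t : Bool} {a b : List Bool}
    (h : Runs (x ++ [⟨i, .cross o s t⟩] ++ y) a b) : Runs (x ++ smoothing i s t ++ y) a b := by
  simp only [Runs_append] at h ⊢
  obtain ⟨d, ⟨c, h1, h2⟩, h3⟩ := h
  exact ⟨d, ⟨c, h1, runs_smoothing h2⟩, h3⟩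

theorem Standard.runs {b : List Bool} {w : List Layer} (h : Standard b w) : Runs w [] b := by
  induction h with
  | nil => rfl
  | circle _ ih =>
    rw [Runs_append]
    exact ⟨[], ih, unknotDiagram.closed⟩
  | arc d u r _ ih =>
    rw [Runs_append]
    exact ⟨_, ih, runs_arc d u r⟩

theorem Standard.circle_append {b : List Bool} {w : List Layer} (h : Standard b w) :
    Standard b ([⟨0, .cup true⟩, ⟨0, .cap true⟩] ++ w) := by
  induction h with
  | nil => exact .circle .nil
  | circle _ ih => rw [← List.append_assoc]; exact .circle ih
  | arc d u r _ ih => rw [← List.append_assoc]; exact .arc d u r ih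

theorem Reducible.extend {b c : List Bool} {y w : List Layer} (hy : Runs y b c)
    (H : ∀ w, Standard b w → Reducible (w ++ y)) (hw : Reducible w) (hr : Runs w [] b) :
    Reducible (w ++ y) := by
  induction hw with
  | standard h =>
    obtain rfl := h.runs.det hr
    exact H _ h
  | rewrite h _ ih => exact .rewrite (h.right y) (ih (h.runs hr))
  | @rewriteBack b' w w' h hw' _ ih =>
    obtain rfl := (h.runs hw').det hr
    exact .rewriteBack (h.right y) (Runs_append.2 ⟨_, hw', hy⟩) (ih hw')
  | @skein x y' i o s t _ _ ih ih' =>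
    have h1 := ih (runs_change_cross _ hr)
    have h2 := ih' (runs_smooth hr)
    rw [List.append_assoc] at h1 h2 ⊢
    exact .skein h1 h2

/-- All one-layer extensions of reducible words ending at `b` are reducible. -/
def ExtendsReducible (b : List Bool) : Prop :=
  ∀ (ℓ : Layer) (c : List Bool) (w : List Layer), ℓ.isDouble = false → ℓ.Step b c →
    Reducible w → Runs w [] b → Reducible (w ++ [ℓ])

theorem Reducible.arc {w : List Layer} (d : Bool) {u r : List Bool} (hw : Reducible w)
    (hr : Runs w [] (u ++ r)) : Reducible (w ++ arc d u) :=
  hw.extend (runs_arc d u r) (fun _ h => .standard (.arc d u r h)) hr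

theorem Reducible.pull {n k : ℕ}
    (H : ∀ (l r : List Bool) (s t : Bool) (w : List Layer), (l ++ s :: t :: r).length = n →
      k ≤ l.length → Reducible w → Runs w [] (l ++ s :: t :: r) →
      Reducible (w ++ [⟨l.length, .cross true s t⟩]))
    {l u r : List Bool} {s : Bool} {w : List Layer} (hn : (l ++ s :: u ++ r).length = n)
    (hk : k ≤ l.length) (hw : Reducible w) (hr : Runs w [] (l ++ s :: u ++ r)) :
    Reducible (w ++ pull l.length s u) := by
  induction u generalizing l w with
  | nil => simpa using hw
  | cons t u ih =>
    have h1 := H l (u ++ r) s t w (by simpa using hn) hk hw (by simpa using hr)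
    have h2 := ih (l := l ++ [t]) (by simp at hn ⊢; omega) (by simp; omega) h1
      (Runs_append.2 ⟨_, hr, _, ⟨l, u ++ r, rfl, by simp [Piece.bot], rfl⟩,
        by simp [Runs, Piece.top]⟩)
    simpa using h2

theorem reducible_cup {n : ℕ} (IH : ∀ b : List Bool, b.length < n → ExtendsReducible b)
    {l r : List Bool} (x : Bool) (hn : (l ++ r).length = n) {w : List Layer}
    (hw : Standard (l ++ r) w) : Reducible (w ++ [⟨l.length, .cup x⟩]) := by
  rcases l with _ | ⟨y, l⟩
  · exact .standard (.arc x [] r hw)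
  generalize hb : y :: l ++ r = b at hw hn
  have key : ∀ (d : Bool) (u v r' : List Bool) (w : List Layer),
      (d :: (u ++ v) ++ (!d) :: r').length = n → Standard (u ++ v ++ r') w →
      Reducible (w ++ OrientedLinks.arc d (u ++ v) ++ [⟨u.length + 1, .cup x⟩]) := by
    intro d u v r' w hn h
    have h1 : Runs (w ++ [⟨u.length, .cup x⟩]) [] (u ++ x :: (!x) :: v ++ r') :=
      Runs_append.2 ⟨_, h.runs, _, ⟨u, v ++ r', rfl, by simp [Piece.bot], rfl⟩,
        by simp [Runs, Piece.top]⟩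
    have h2 := IH (u ++ v ++ r') (by simp at hn ⊢; omega) ⟨u.length, .cup x⟩ _ w rfl
      ⟨u, v ++ r', rfl, by simp [Piece.bot], rfl⟩ (.standard h) h.runs
    have h3 := h2.arc d h1
    have h4 := (Rewrites.cup_arc d x u v).left w
    rw [← List.append_assoc] at h4
    refine .rewriteBack h4 (b := d :: (u ++ x :: (!x) :: v) ++ (!d) :: r') ?_ ?_
    · have := Runs_append.2 ⟨_, h1, runs_arc d (u ++ x :: (!x) :: v) r'⟩
      simpa using this
    · simpa using h3
  cases hw with
  | nil => simp at hb
  | circle => simp at hb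
  | @arc w d u r' h =>
    simp only [List.cons_append, List.cons.injEq] at hb
    obtain ⟨rfl, hb⟩ := hb
    rcases List.append_eq_append_iff.1 hb with ⟨m, rfl, hm⟩ | ⟨m, rfl, hm⟩
    · exact key y l m r' w hn h
    · rcases m with _ | ⟨z, m⟩
      · simpa using key y u [] r' w (by simpa using hn) (by simpa using h)
      · simp only [List.cons_append, List.cons.injEq] at hm
        obtain ⟨rfl, rfl⟩ := hm
        have h2 := IH (u ++ (m ++ r)) (by simp at hn ⊢; omega) ⟨u.length + m.length, .cup x⟩ _ w rfl
          ⟨u ++ m, r, by simp, by simp [Piece.bot], rfl⟩ (.standard h) h.runs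
        have h3 := h2.arc y (u := u) (r := m ++ x :: (!x) :: r)
          (Runs_append.2 ⟨_, h.runs, _, ⟨u ++ m, r, by simp, by simp [Piece.bot], rfl⟩,
            by simp [Runs, Piece.top]⟩)
        have h4 := (Rewrites.arc_past_right y u m.length (.cup x)).left w
        refine .rewrite (w' := w ++ [⟨u.length + m.length, .cup x⟩] ++ OrientedLinks.arc y u) ?_ h3
        have e : (y :: (u ++ (!y) :: m)).length = u.length + 2 + m.length := by
          simp; omega
        rw [e]
        simpa using h4

theorem reducible_arc_cap {n : ℕ} (IH : ∀ b : List Bool, b.length < n → ExtendsReducible b)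
    {d : Bool} {u r : List Bool} {w : List Layer}
    (hn : (u ++ d :: r).length < n) (hw : Reducible w) (hr : Runs w [] (u ++ d :: r)) :
    Reducible (w ++ arc d u ++ [⟨u.length + 1, .cap (!d)⟩]) := by
  induction u using List.reverseRecOn generalizing w r with
  | nil =>
    have := (Rewrites.arc_nil_cap d).left w
    rw [← List.append_assoc, List.append_nil] at this
    exact .rewrite this hw
  | append_singleton u t ih =>
    have hs : Layer.Step ⟨u.length, .cross false t d⟩ (u ++ [t] ++ d :: r) (u ++ d :: t :: r) :=
      ⟨u, r, rfl, by simp [Piece.bot], by simp [Piece.top]⟩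
    have h1 := IH _ hn ⟨u.length, .cross false t d⟩ _ w rfl hs hw hr
    have h2 := ih (r := t :: r) (by simpa using hn) h1
      (Runs_append.2 ⟨_, hr, _, hs, rfl⟩)
    have h3 := (Rewrites.arc_append_cap d t u).left w
    refine .rewrite ?_ h2
    simpa using h3

theorem reducible_cap {n : ℕ} (IH : ∀ b : List Bool, b.length < n → ExtendsReducible b)
    {l r : List Bool} {x : Bool} (hn : (l ++ x :: (!x) :: r).length = n)
    {w : List Layer} (hw : Standard (l ++ x :: (!x) :: r) w) :
    Reducible (w ++ [⟨l.length, .cap x⟩]) := by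
  generalize hb : l ++ x :: (!x) :: r = b at hw hn
  cases hw with
  | nil => simp at hb
  | circle => simp at hb
  | @arc w d u r' h =>
    have hlen : ∀ r' : List Bool, (d :: u ++ (!d) :: r').length = n → (u ++ r').length < n := by
      intro r' hn; simp at hn ⊢; omega
    rcases l with _ | ⟨y, l⟩
    · simp only [List.nil_append, List.cons_append, List.cons.injEq] at hb
      obtain ⟨rfl, hb⟩ := hb
      rcases u with _ | ⟨z, u⟩
      · have h1 : Reducible (w ++ [⟨0, .cup true⟩, ⟨0, .cap true⟩]) := by
          refine .rewrite (w' := [⟨0, .cup true⟩, ⟨0, .cap true⟩] ++ w) ?_ (.standard h.circle_append)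
          refine .trans (v := ⟨0, .cup true⟩ :: shift 2 w ++ [⟨0, .cap true⟩]) ?_ ?_
          · have := (Rewrites.past_layer 0 (.cup true) w).full.right [⟨0, .cap true⟩]
            simpa [shift_zero, Piece.bot, Piece.top] using this
          · have := (Rewrites.past_layer 0 (.cap true) w).full.cons ⟨0, .cup true⟩
            simpa [shift_zero, Piece.bot, Piece.top] using this
        cases x with
        | true => simpa [OrientedLinks.arc] using h1
        | false =>
          refine .rewrite ?_ h1
          have h2 := (Rewrites.of_rule_zero (BasicRule.cupCurlRev true true)).full.ctx w
            [⟨0, .cap false⟩]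
          have h3 := (Rewrites.of_rule_zero (BasicRule.capCurl true true)).full.left
            (w ++ [⟨0, .cup true⟩])
          have := h2.trans (by simpa using h3)
          simpa [OrientedLinks.arc] using this
      · simp only [List.cons_append, List.cons.injEq] at hb
        obtain ⟨rfl, rfl⟩ := hb
        have h1 := (Rewrites.arc_cons_cap x u).left w
        rw [← List.append_assoc] at h1
        refine .rewrite h1 ?_
        refine Reducible.pull (n := (((!x) :: u) ++ r').length) (k := 0) (l := []) (r := r')
          ?_ (by simp) (by simp) (.standard h) (by simpa using h.runs)
        intro l r s t w hl _ hw hr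
        exact IH _ (by rw [hl]; exact hlen r' hn) _ _ w rfl ⟨l, r, rfl, by simp [Piece.bot], rfl⟩ hw hr
    · simp only [List.cons_append, List.cons.injEq] at hb
      obtain ⟨rfl, hb⟩ := hb
      rcases List.append_eq_append_iff.1 hb with ⟨m, rfl, hm⟩ | ⟨m, rfl, hm⟩
      · rcases m with _ | ⟨z, _ | ⟨z', m⟩⟩
        · simp only [List.nil_append, List.cons.injEq] at hm
          obtain ⟨rfl, rfl⟩ := hm
          rw [List.append_nil] at h ⊢
          rw [Bool.not_not] at h
          have := reducible_arc_cap IH (w := w) (by simpa using hlen _ hn) (.standard h) h.runs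
          simpa using this
        · simp only [List.cons_append, List.nil_append, List.cons.injEq, Bool.not_inj_iff] at hm
          obtain ⟨rfl, rfl, rfl⟩ := hm
          have h1 := (Rewrites.arc_curl x l).left w
          simp only [← List.append_assoc] at h1
          refine .rewrite h1 ?_
          exact reducible_arc_cap IH (r := r) (by simpa using hlen _ hn) (.standard h)
            (by simpa using h.runs)
        · simp only [List.cons_append, List.cons.injEq] at hm
          obtain ⟨rfl, rfl, rfl⟩ := hm
          have h1 := (Rewrites.arc_cap y x l m).left w
          rw [← List.append_assoc] at h1
          refine .rewrite h1 ?_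
          have hs : Layer.Step ⟨l.length, .cap x⟩ (l ++ x :: (!x) :: m ++ r') (l ++ m ++ r') :=
            ⟨l, m ++ r', rfl, by simp [Piece.bot], by simp [Piece.top]⟩
          have h2 := IH _ (hlen _ hn) _ _ w rfl hs (.standard h) h.runs
          have h3 := h2.arc y (Runs_append.2 ⟨_, h.runs, _, hs, rfl⟩)
          simpa using h3
      · rcases m with _ | ⟨z, m⟩
        · simp only [List.nil_append, List.cons.injEq] at hm
          obtain ⟨rfl, rfl⟩ := hm
          rw [Bool.not_not] at h
          have := reducible_arc_cap IH (w := w) (by simpa using hlen _ hn) (.standard h) h.runs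
          simpa using this
        · simp only [List.cons_append, List.cons.injEq] at hm
          obtain ⟨rfl, rfl⟩ := hm
          have hs : Layer.Step ⟨u.length + m.length, .cap x⟩ (u ++ (m ++ x :: (!x) :: r))
              (u ++ (m ++ r)) :=
            ⟨u ++ m, r, by simp, by simp [Piece.bot], by simp [Piece.top]⟩
          have h2 := IH _ (hlen _ hn) _ _ w rfl hs (.standard h) h.runs
          have h3 := h2.arc y (Runs_append.2 ⟨_, h.runs, _, hs, rfl⟩)
          have h4 := (Rewrites.arc_past_right y u m.length (.cap x)).left w
          refine .rewrite (w' := w ++ [⟨u.length + m.length, .cap x⟩] ++ OrientedLinks.arc y u) ?_ h3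
          have e : (y :: (u ++ (!y) :: m)).length = u.length + 2 + m.length := by
            simp; omega
          rw [e]
          simpa using h4

theorem reducible_smoothing {n : ℕ} (IH : ∀ b : List Bool, b.length < n → ExtendsReducible b)
    {l r : List Bool} {s t : Bool} (hn : (l ++ s :: t :: r).length = n) {w : List Layer}
    (hw : Standard (l ++ s :: t :: r) w) : Reducible (w ++ smoothing l.length s t) := by
  unfold smoothing
  split_ifs with hst
  · simpa using Reducible.standard hw
  · obtain rfl : t = !s := by cases s <;> cases t <;> simp_all
    have h1 := reducible_cap IH hn hw
    have hs : Layer.Step ⟨l.length, .cap s⟩ (l ++ s :: (!s) :: r) (l ++ r) :=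
      ⟨l, r, rfl, by simp [Piece.bot], by simp [Piece.top]⟩
    have h2 := IH (l ++ r) (by simp at hn ⊢; omega) ⟨l.length, .cup (!s)⟩ _ _ rfl
      ⟨l, r, rfl, by simp [Piece.bot], rfl⟩ h1 (Runs_append.2 ⟨_, hw.runs, _, hs, rfl⟩)
    simpa using h2

theorem reducible_flip {n : ℕ} (IH : ∀ b : List Bool, b.length < n → ExtendsReducible b)
    {l r : List Bool} {s t : Bool} (hn : (l ++ s :: t :: r).length = n) {w : List Layer}
    (hw : Standard (l ++ s :: t :: r) w) {o : Bool} (o' : Bool)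
    (h : Reducible (w ++ [⟨l.length, .cross o s t⟩])) :
    Reducible (w ++ [⟨l.length, .cross o' s t⟩]) := by
  by_cases ho : o' = o
  · rwa [ho]
  · obtain rfl : o = !o' := by cases o <;> cases o' <;> simp_all
    have := reducible_smoothing IH hn hw
    simpa using Reducible.skein (x := w) (y := []) (by simpa using h) (by simpa using this)

theorem reducible_cross_of_ne_nil {n : ℕ}
    (IH : ∀ b : List Bool, b.length < n → ExtendsReducible b) {l r : List Bool} {s t : Bool}
    (o : Bool) (hn : (l ++ s :: t :: r).length = n) (hl : l ≠ []) {w : List Layer}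
    (hw : Standard (l ++ s :: t :: r) w) : Reducible (w ++ [⟨l.length, .cross o s t⟩]) := by
  have flip : ∀ o', Reducible (w ++ [⟨l.length, .cross o' s t⟩]) →
      Reducible (w ++ [⟨l.length, .cross o s t⟩]) := fun o' h => reducible_flip IH hn hw o h
  generalize hb : l ++ s :: t :: r = b at hw hn
  cases hw with
  | nil => simp at hb
  | circle => simp at hb
  | @arc w d u r' h =>
    have hlen : (u ++ r').length < n := by simp at hn ⊢; omega
    obtain ⟨y, l, rfl⟩ := List.exists_cons_of_ne_nil hl
    simp only [List.cons_append, List.cons.injEq] at hb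
    obtain ⟨rfl, hb⟩ := hb
    have key : u = l → s = !y → r' = t :: r →
        Reducible (w ++ arc y u ++ [⟨(y :: l).length, .cross o s t⟩]) := by
      rintro rfl rfl rfl
      refine flip true ?_
      have := Reducible.standard (.arc y (u ++ [t]) r (by simpa using h))
      rw [arc_append_singleton, ← List.append_assoc] at this
      simpa using this
    rcases List.append_eq_append_iff.1 hb with ⟨m, rfl, hm⟩ | ⟨m, rfl, hm⟩
    · rcases m with _ | ⟨z, _ | ⟨z', m⟩⟩
      · simp only [List.nil_append, List.cons.injEq] at hm
        exact key (by simp) hm.1 hm.2.symm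
      · simp only [List.cons_append, List.nil_append, List.cons.injEq] at hm
        obtain ⟨rfl, rfl, rfl⟩ := hm
        refine flip false ?_
        have h1 := (Rewrites.arc_uncross y s l).left w
        rw [← List.append_assoc] at h1
        exact .rewrite h1 (.standard (.arc y l (s :: r) (by simpa using h)))
      · simp only [List.cons_append, List.cons.injEq] at hm
        obtain ⟨rfl, rfl, rfl⟩ := hm
        have h1 := (Rewrites.arc_cross y o s t l m).left w
        rw [← List.append_assoc] at h1
        refine .rewrite h1 ?_
        have hs : Layer.Step ⟨l.length, .cross o s t⟩ (l ++ s :: t :: m ++ r')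
            (l ++ t :: s :: m ++ r') :=
          ⟨l, m ++ r', rfl, by simp [Piece.bot], by simp [Piece.top]⟩
        have h2 := IH _ hlen _ _ w rfl hs (.standard h) h.runs
        have h3 := h2.arc y (Runs_append.2 ⟨_, h.runs, _, hs, rfl⟩)
        simpa using h3
    · rcases m with _ | ⟨z, m⟩
      · simp only [List.nil_append, List.cons.injEq] at hm
        exact key (by simp) hm.1.symm hm.2
      · simp only [List.cons_append, List.cons.injEq] at hm
        obtain ⟨rfl, rfl⟩ := hm
        have hs : Layer.Step ⟨u.length + m.length, .cross o s t⟩ (u ++ (m ++ s :: t :: r))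
            (u ++ (m ++ t :: s :: r)) :=
          ⟨u ++ m, r, by simp, by simp [Piece.bot], by simp [Piece.top]⟩
        have h2 := IH _ hlen _ _ w rfl hs (.standard h) h.runs
        have h3 := h2.arc y (Runs_append.2 ⟨_, h.runs, _, hs, rfl⟩)
        have h4 := (Rewrites.arc_past_right y u m.length (.cross o s t)).left w
        refine .rewrite
          (w' := w ++ [⟨u.length + m.length, .cross o s t⟩] ++ OrientedLinks.arc y u) ?_ h3
        have e : (y :: (u ++ (!y) :: m)).length = u.length + 2 + m.length := by
          simp; omega
        rw [e]
        simpa using h4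

theorem reducible_cross {n : ℕ} (IH : ∀ b : List Bool, b.length < n → ExtendsReducible b)
    {l r : List Bool} {s t : Bool} (o : Bool) (hn : (l ++ s :: t :: r).length = n)
    {w : List Layer} (hw : Standard (l ++ s :: t :: r) w) :
    Reducible (w ++ [⟨l.length, .cross o s t⟩]) := by
  rcases l with _ | ⟨y, l⟩
  swap
  · exact reducible_cross_of_ne_nil IH o hn (by simp) hw
  have flip : ∀ o', Reducible (w ++ [⟨0, .cross o' s t⟩]) →
      Reducible (w ++ [⟨0, .cross o s t⟩]) := fun o' h => reducible_flip IH hn hw o h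
  generalize hb : [] ++ s :: t :: r = b at hw hn
  cases hw with
  | nil => simp at hb
  | circle => simp at hb
  | @arc w d u r' h =>
    have hlen : (u ++ r').length < n := by simp at hn ⊢; omega
    simp only [List.nil_append, List.cons_append, List.cons.injEq] at hb
    obtain ⟨rfl, hb⟩ := hb
    rcases u with _ | ⟨z, u⟩
    · simp only [List.nil_append, List.cons.injEq] at hb
      obtain ⟨rfl, rfl⟩ := hb
      have h1 := (Rewrites.arc_nil_cross s o).left w
      rw [← List.append_assoc] at h1
      exact .rewrite h1 (.standard (.arc (!s) [] r h))
    · simp only [List.cons_append, List.cons.injEq] at hb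
      obtain ⟨rfl, rfl⟩ := hb
      refine flip true ?_
      have h1 := (Rewrites.arc_cons_cross s t u).left w
      rw [← List.append_assoc] at h1
      refine .rewrite h1 ?_
      have hs : Layer.Step ⟨1, .cup s⟩ (t :: u ++ r') ([t, s] ++ (!s) :: u ++ r') :=
        ⟨[t], u ++ r', rfl, by simp [Piece.bot], by simp [Piece.top]⟩
      have h2 := IH _ hlen _ _ w rfl hs (.standard h) h.runs
      have h3 : Reducible (w ++ [⟨1, .cup s⟩] ++ pull 2 (!s) u) := by
        refine Reducible.pull (n := n) (k := 1) (l := [t, s]) (r := r')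
          ?_ (by simp; simp at hn; omega) (by simp) h2
          (Runs_append.2 ⟨_, h.runs, _, hs, rfl⟩)
        intro l r s t w hl hl' hw hr
        have hs' : Layer.Step ⟨l.length, .cross true s t⟩ (l ++ s :: t :: r) (l ++ t :: s :: r) :=
          ⟨l, r, rfl, by simp [Piece.bot], by simp [Piece.top]⟩
        refine hw.extend ⟨_, hs', rfl⟩ (fun w hw => ?_) hr
        exact reducible_cross_of_ne_nil IH true hl (by rintro rfl; simp at hl') hw
      simpa using h3

theorem extendsReducible (b : List Bool) : ExtendsReducible b := by
  induction hn : b.length using Nat.strong_induction_on generalizing b with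
  | _ n IH =>
    replace IH : ∀ b : List Bool, b.length < n → ExtendsReducible b :=
      fun b hb => IH _ hb b rfl
    intro ℓ c w hd hs hw hr
    refine hw.extend ⟨c, hs, rfl⟩ (fun w hw => ?_) hr
    obtain ⟨i, e⟩ := ℓ
    obtain ⟨l, r, rfl, rfl, rfl⟩ := hs
    cases e with
    | cup d => exact reducible_cup IH d (by simpa [Piece.bot] using hn) (by simpa [Piece.bot] using hw)
    | cap d => exact reducible_cap IH (by simpa [Piece.bot] using hn) (by simpa [Piece.bot] using hw)
    | cross o s t =>
      exact reducible_cross IH o (by simpa [Piece.bot] using hn) (by simpa [Piece.bot] using hw)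
    | double s t => simp [Layer.isDouble] at hd

theorem Runs.reducible {w : List Layer} {b : List Bool} (hr : Runs w [] b)
    (hd : w.countP Layer.isDouble = 0) : Reducible w := by
  induction w using List.reverseRecOn generalizing b with
  | nil => exact .standard .nil
  | append_singleton w ℓ ih =>
    obtain ⟨c, h1, h2⟩ := Runs_append.1 hr
    simp only [List.countP_append, Nat.add_eq_zero_iff] at hd
    refine extendsReducible c ℓ b w ?_ (Runs_singleton.1 h2) (ih h1 hd.1) h1
    simpa using hd.2

/-- `n` circles. -/
def circles (n : ℕ) : List Layer :=
  (List.replicate n [(⟨0, .cup true⟩ : Layer), ⟨0, .cap true⟩]).flatten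

theorem circles_succ (n : ℕ) :
    circles (n + 1) = circles n ++ [⟨0, .cup true⟩, ⟨0, .cap true⟩] := by
  simp [circles, List.replicate_succ']

theorem Standard.eq_circles {w : List Layer} (h : Standard [] w) : ∃ n, w = circles n := by
  generalize hb : ([] : List Bool) = b at h
  induction h with
  | nil => exact ⟨0, rfl⟩
  | circle _ ih =>
    obtain ⟨n, rfl⟩ := ih rfl
    exact ⟨n + 1, (circles_succ n).symm⟩
  | arc => simp at hb

theorem Rewrites.countP_eq {w w' : List Layer} (h : Rewrites Rule w w') :
    w'.countP Layer.isDouble = w.countP Layer.isDouble := by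
  induction h with
  | refl => rfl
  | head hr _ ih =>
    rw [ih]
    simp only [List.countP_append, countP_shift, hr.countP_eq]

theorem Rewrites.ne_nil {w w' : List Layer} (h : Rewrites Rule w w') (hw : w' ≠ []) : w ≠ [] := by
  cases h with
  | refl => exact hw
  | head hr _ =>
    intro h0
    simp only [List.append_eq_nil_iff] at h0
    exact hr.ne_nil (List.map_eq_nil_iff.1 h0.1.2)

theorem smoothing_countP (i : ℕ) (s t : Bool) :
    (smoothing i s t).countP Layer.isDouble = 0 := by
  unfold smoothing
  split_ifs <;> simp [Layer.isDouble]

theorem IsLinkWord.change_cross {x y : List Layer} {i : ℕ} {o s t : Bool}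
    (h : IsLinkWord (x ++ [⟨i, .cross o s t⟩] ++ y)) (o' : Bool) :
    IsLinkWord (x ++ [⟨i, .cross o' s t⟩] ++ y) :=
  ⟨runs_change_cross o' h.closed, by simp, by
    simpa [Layer.isDouble] using h.noDouble⟩

theorem smooth_ne_nil {x y : List Layer} {i : ℕ} {o s t : Bool}
    (h : Runs (x ++ [⟨i, .cross o s t⟩] ++ y) [] []) : x ++ smoothing i s t ++ y ≠ [] := by
  intro h0
  simp only [List.append_eq_nil_iff] at h0
  obtain ⟨⟨rfl, _⟩, rfl⟩ := h0
  obtain ⟨c, ⟨l, r, _, h1, _⟩, _⟩ := h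
  simp [Piece.bot] at h1

theorem IsLinkWord.smooth {x y : List Layer} {i : ℕ} {o s t : Bool}
    (h : IsLinkWord (x ++ [⟨i, .cross o s t⟩] ++ y)) :
    IsLinkWord (x ++ smoothing i s t ++ y) :=
  ⟨runs_smooth h.closed, smooth_ne_nil h.closed, by
    simpa [Layer.isDouble, smoothing_countP] using h.noDouble⟩

theorem skeinTriple_of_words {x y : List Layer} {i : ℕ} {s t : Bool}
    (hp : IsLinkWord (x ++ [posCross i s t] ++ y)) (hm : IsLinkWord (x ++ [negCross i s t] ++ y))
    (ho : IsLinkWord (x ++ smoothing i s t ++ y)) : SkeinTriple hp.link hm.link ho.link :=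
  ⟨_, _, _, hp.represents, hm.represents, ho.represents, x, y, i, s, t, rfl, rfl, rfl⟩

/-- Induction over the skein relation: a set of links that contains the trivial links and is
closed under changing a crossing whose smoothing it contains, contains all links. -/
theorem skein_induction {S : OrientedLink → Prop}
    (hcirc : ∀ n (h : IsLinkWord (circles (n + 1))), S h.link)
    (hskein : ∀ Lp Lm Lo, SkeinTriple Lp Lm Lo → S Lo → (S Lp ↔ S Lm)) (L : OrientedLink) :
    S L := by
  obtain ⟨w, hw, rfl⟩ := L.exists_word
  have hred := hw.closed.reducible hw.noDouble
  induction hred with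
  | standard h =>
    obtain rfl := h.runs.det hw.closed
    obtain ⟨n, rfl⟩ := h.eq_circles
    cases n with
    | zero => exact absurd rfl hw.ne_nil
    | succ n => exact hcirc n hw
  | rewrite h _ ih =>
    obtain ⟨h', e⟩ := hw.rewrites h
    rw [← e]
    exact ih h'
  | @rewriteBack b w w' h hr _ ih =>
    obtain rfl := (h.runs hr).det hw.closed
    have hw' : IsLinkWord w := ⟨hr, h.ne_nil hw.ne_nil, h.countP_eq.symm.trans hw.noDouble⟩
    obtain ⟨h', e⟩ := hw'.rewrites h
    rw [e]
    exact ih hw'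
  | @skein x y i o s t _ _ ih ih' =>
    have h1 := ih (hw.change_cross _)
    have h2 := ih' hw.smooth
    have hp : IsLinkWord (x ++ [posCross i s t] ++ y) := hw.change_cross (s == t)
    have hm : IsLinkWord (x ++ [negCross i s t] ++ y) := hw.change_cross (s != t)
    have h3 := hskein _ _ _ (skeinTriple_of_words hp hm hw.smooth) h2
    by_cases ho : o = (s == t)
    · subst ho
      exact h3.2 h1
    · obtain rfl : o = (s != t) := by cases o <;> cases s <;> cases t <;> simp_all
      refine h3.1 ?_
      convert h1 using 5
      cases s <;> cases t <;> rfl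

end OrientedLinks

namespace OrientedLinks

/-! ### State sums -/

section StateSum

variable {N : ℕ}

/-- The weight with which the two strands of a positive (`o = true`) or negative crossing of two
upward strands with colours `a`, `b` pass through each other. -/
noncomputable def passWeight (q : ℝ) (o : Bool) (a b : Fin N) : ℝ :=
  if o then (q ^ N)⁻¹ * (if a = b then q else 1) else q ^ N * (if a = b then q⁻¹ else 1)

/-- The weight with which the two strands of a positive (`o = true`) or negative crossing of two
upward strands with colours `a`, `b` turn back. -/
noncomputable def turnWeight (q : ℝ) (o : Bool) (a b : Fin N) : ℝ :=
  if o then (if a < b then (q ^ N)⁻¹ * (q - q⁻¹) else 0)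
  else (if b < a then -(q ^ N * (q - q⁻¹)) else 0)

/-- The weight of a counterclockwise maximum. -/
noncomputable def bendWeight (q : ℝ) (a : Fin N) : ℝ := q ^ ((N : ℤ) - 1 - 2 * (a : ℕ))

/-- The transfer operator of a piece at the left end of a horizontal line. -/
noncomputable def pieceOp (q : ℝ) (e : Piece) (G : List (Fin N) → ℝ) (x : List (Fin N)) : ℝ :=
  match e, x with
  | .cup d, x => ∑ a, (if d then (bendWeight q a)⁻¹ else 1) * G (a :: a :: x)
  | .cap d, a :: b :: x => if a = b then (if d then 1 else bendWeight q a) * G x else 0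
  | .cross o true true, a :: b :: x =>
      passWeight q o a b * G (b :: a :: x) + turnWeight q o a b * G (a :: b :: x)
  | .cross o false false, a :: b :: x =>
      passWeight q o a b * G (b :: a :: x) + turnWeight q o b a * G (a :: b :: x)
  | .cross o true false, a :: b :: x =>
      passWeight q (!o) a b * G (b :: a :: x) +
        if a = b then ∑ c, turnWeight q (!o) c a * G (c :: c :: x) else 0
  | .cross o false true, a :: b :: x =>
      passWeight q (!o) a b * G (b :: a :: x) +
        if a = b then
          ∑ c, bendWeight q a * (bendWeight q c)⁻¹ * turnWeight q (!o) a c * G (c :: c :: x)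
        else 0
  | .double _ _, a :: b :: x => G (b :: a :: x)
  | _, _ => 0

/-- The transfer operator of a layer. -/
noncomputable def layerOp (q : ℝ) (ℓ : Layer) (G : List (Fin N) → ℝ) (x : List (Fin N)) : ℝ :=
  pieceOp q ℓ.piece (fun y => G (x.take ℓ.pos ++ y)) (x.drop ℓ.pos)

/-- The transfer operator of a word. -/
noncomputable def wordOp (q : ℝ) : List Layer → (List (Fin N) → ℝ) → List (Fin N) → ℝ
  | [], G => G
  | ℓ :: w, G => layerOp q ℓ (wordOp q w G)

@[simp] theorem wordOp_nil (q : ℝ) (G : List (Fin N) → ℝ) : wordOp q [] G = G := rfl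

@[simp] theorem wordOp_cons (q : ℝ) (ℓ : Layer) (w : List Layer) (G : List (Fin N) → ℝ) :
    wordOp q (ℓ :: w) G = layerOp q ℓ (wordOp q w G) := rfl

theorem wordOp_append (q : ℝ) (w w' : List Layer) (G : List (Fin N) → ℝ) :
    wordOp q (w ++ w') G = wordOp q w (wordOp q w' G) := by
  induction w with
  | nil => rfl
  | cons ℓ w ih => simp [ih]

@[simp] theorem layerOp_zero (q : ℝ) (e : Piece) (G : List (Fin N) → ℝ) (x : List (Fin N)) :
    layerOp q ⟨0, e⟩ G x = pieceOp q e G x := rfl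

@[simp] theorem layerOp_one_cons (q : ℝ) (e : Piece) (G : List (Fin N) → ℝ) (a : Fin N)
    (x : List (Fin N)) :
    layerOp q ⟨1, e⟩ G (a :: x) = pieceOp q e (fun y => G (a :: y)) x := rfl

theorem layerOp_shift (q : ℝ) (i n : ℕ) (e : Piece) (G : List (Fin N) → ℝ) {l : List (Fin N)}
    (hl : l.length = n) (x : List (Fin N)) :
    layerOp q ⟨n + i, e⟩ G (l ++ x) = layerOp q ⟨i, e⟩ (fun y => G (l ++ y)) x := by
  subst hl
  simp only [layerOp, List.take_length_add_append, List.append_assoc, List.drop_length_add_append]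

theorem wordOp_shift (q : ℝ) (w : List Layer) (n : ℕ) (G : List (Fin N) → ℝ) {l : List (Fin N)}
    (hl : l.length = n) (x : List (Fin N)) :
    wordOp q (shift n w) G (l ++ x) = wordOp q w (fun y => G (l ++ y)) x := by
  induction w generalizing x with
  | nil => rfl
  | cons ℓ w ih =>
    obtain ⟨i, e⟩ := ℓ
    simp only [shift_cons, wordOp_cons, layerOp_shift q i n e _ hl, ih]

/-- The transfer operator of a piece is a finite linear combination of evaluations. -/
theorem pieceOp_eq_sum (q : ℝ) (e : Piece) (x : List (Fin N)) (hx : x.length = e.bot.length) :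
    ∃ (ι : Type) (_ : Fintype ι) (c : ι → ℝ) (y : ι → List (Fin N)),
      (∀ j, (y j).length = e.top.length) ∧
      ∀ G x', pieceOp q e G (x ++ x') = ∑ j, c j * G (y j ++ x') := by
  cases e with
  | cup d =>
    obtain rfl := List.eq_nil_of_length_eq_zero hx
    exact ⟨Fin N, inferInstance, _, fun a => [a, a], fun _ => rfl, fun G x' => rfl⟩
  | cap d =>
    obtain ⟨a, b, rfl⟩ := List.length_eq_two.1 hx
    exact ⟨Unit, inferInstance, fun _ => if a = b then (if d then 1 else bendWeight q a) else 0,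
      fun _ => [], fun _ => rfl, fun G x' => by simp [pieceOp]⟩
  | double s t =>
    obtain ⟨a, b, rfl⟩ := List.length_eq_two.1 hx
    exact ⟨Unit, inferInstance, fun _ => 1, fun _ => [b, a], fun _ => rfl,
      fun G x' => by simp [pieceOp]⟩
  | cross o s t =>
    obtain ⟨a, b, rfl⟩ := List.length_eq_two.1 hx
    cases s <;> cases t
    · exact ⟨Bool, inferInstance, fun j => if j then passWeight q o a b else turnWeight q o b a,
        fun j => if j then [b, a] else [a, b], by simp [Piece.top],
        fun G x' => by simp [pieceOp]⟩
    · exact ⟨Option (Fin N), inferInstance,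
        fun j => j.elim (passWeight q (!o) a b) fun c =>
          if a = b then bendWeight q a * (bendWeight q c)⁻¹ * turnWeight q (!o) a c else 0,
        fun j => j.elim [b, a] fun c => [c, c], by rintro (_ | _) <;> simp [Piece.top],
        fun G x' => by simp [pieceOp, Fintype.sum_option]⟩
    · exact ⟨Option (Fin N), inferInstance,
        fun j => j.elim (passWeight q (!o) a b) fun c =>
          if a = b then turnWeight q (!o) c a else 0,
        fun j => j.elim [b, a] fun c => [c, c], by rintro (_ | _) <;> simp [Piece.top],
        fun G x' => by simp [pieceOp, Fintype.sum_option]⟩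
    · exact ⟨Bool, inferInstance, fun j => if j then passWeight q o a b else turnWeight q o a b,
        fun j => if j then [b, a] else [a, b], by simp [Piece.top],
        fun G x' => by simp [pieceOp]⟩

theorem Layer.Step.op_eq_sum {ℓ : Layer} {a b : List Bool} (h : ℓ.Step a b) (q : ℝ)
    {x : List (Fin N)} (hx : x.length = a.length) :
    ∃ (ι : Type) (_ : Fintype ι) (c : ι → ℝ) (y : ι → List (Fin N)),
      (∀ j, (y j).length = b.length) ∧ ∀ G, layerOp q ℓ G x = ∑ j, c j * G (y j) := by
  obtain ⟨l, r, hl, rfl, rfl⟩ := h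
  simp only [List.length_append] at hx
  obtain ⟨ι, _, c, y, hy, h⟩ := pieceOp_eq_sum q ℓ.piece
    ((x.drop ℓ.pos).take ℓ.piece.bot.length) (by simp; omega)
  refine ⟨ι, inferInstance, c,
    fun j => x.take ℓ.pos ++ y j ++ (x.drop ℓ.pos).drop ℓ.piece.bot.length, ?_, ?_⟩
  · intro j
    simp [hy]; omega
  · intro G
    have := h (fun y => G (x.take ℓ.pos ++ y)) ((x.drop ℓ.pos).drop ℓ.piece.bot.length)
    rw [List.take_append_drop] at this
    simpa [layerOp] using this

theorem Runs.wordOp_congr {w : List Layer} {a b : List Bool} (h : Runs w a b) (q : ℝ)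
    {G G' : List (Fin N) → ℝ} (hG : ∀ y, y.length = b.length → G y = G' y)
    {x : List (Fin N)} (hx : x.length = a.length) : wordOp q w G x = wordOp q w G' x := by
  induction w generalizing a x with
  | nil => obtain rfl := h; exact hG x hx
  | cons ℓ w ih =>
    obtain ⟨c, h1, h2⟩ := h
    obtain ⟨ι, _, k, y, hy, he⟩ := h1.op_eq_sum q hx
    simp only [wordOp_cons, he]
    exact Finset.sum_congr rfl fun j _ => by rw [ih h2 (hy j)]

theorem wordOp_exchange (q : ℝ) (k : ℕ) (e f : Piece) (G : List (Fin N) → ℝ)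
    {x y z x' : List (Fin N)} (hx : x.length = e.bot.length) (hy : y.length = k)
    (hz : z.length = f.bot.length) :
    wordOp q [⟨0, e⟩, ⟨e.top.length + k, f⟩] G (x ++ (y ++ (z ++ x'))) =
      wordOp q [⟨e.bot.length + k, f⟩, ⟨0, e⟩] G (x ++ (y ++ (z ++ x'))) := by
  obtain ⟨ι, _, c, u, hu, he⟩ := pieceOp_eq_sum q e x hx
  obtain ⟨κ, _, d, v, hv, hf⟩ := pieceOp_eq_sum q f z hz
  have h2 : ∀ (t : List (Fin N)) (n : ℕ) (H : List (Fin N) → ℝ), t.length = n →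
      layerOp q ⟨n + k, f⟩ H (t ++ (y ++ (z ++ x'))) =
        ∑ j, d j * H (t ++ (y ++ (v j ++ x'))) := by
    intro t n H ht
    have h3 := layerOp_shift q 0 (n + k) f H (l := t ++ y) (by simp [ht, hy]) (z ++ x')
    rw [List.append_assoc] at h3
    simp only [add_zero] at h3
    rw [h3, layerOp_zero, hf]
    simp
  simp only [wordOp_cons, wordOp_nil, layerOp_zero]
  rw [he, h2 x _ _ hx]
  simp only [layerOp_zero, he]
  simp only [h2 _ _ _ (hu _), Finset.mul_sum]
  rw [Finset.sum_comm]
  exact Finset.sum_congr rfl fun _ _ => Finset.sum_congr rfl fun _ _ => by ring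

/-! ### Identities between the weights -/

theorem bendWeight_ne_zero {q : ℝ} (hq : q ≠ 0) (a : Fin N) : bendWeight q a ≠ 0 :=
  zpow_ne_zero _ hq

theorem passWeight_comm (q : ℝ) (o : Bool) (a b : Fin N) :
    passWeight q o a b = passWeight q o b a := by
  simp [passWeight, eq_comm]

theorem turnWeight_self (q : ℝ) (o : Bool) (a : Fin N) : turnWeight q o a a = 0 := by
  simp [turnWeight]

theorem pass_mul_pass {q : ℝ} (hq : q ≠ 0) (o : Bool) (a b : Fin N) :
    passWeight q o a b * passWeight q (!o) a b = 1 := by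
  have := pow_ne_zero N hq
  cases o <;> simp only [passWeight, Bool.not_true, Bool.not_false, if_true] <;>
    split_ifs <;> simp_all <;> field_simp

theorem turn_mul_turn (q : ℝ) (o : Bool) (a b : Fin N) :
    turnWeight q o a b * turnWeight q (!o) a b = 0 := by
  cases o <;> rcases lt_trichotomy a b with h | h | h <;>
    simp [turnWeight, h, h.le, not_lt.2]

theorem pass_mul_turn {q : ℝ} (hq : q ≠ 0) (o : Bool) (a b : Fin N) :
    passWeight q o a b * turnWeight q (!o) b a + turnWeight q o a b * passWeight q (!o) a b = 0 := by
  have := pow_ne_zero N hq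
  rcases lt_trichotomy a b with h | rfl | h
  · cases o <;> simp [turnWeight, passWeight, h, h.not_gt, h.ne]; field_simp; ring
  · simp [turnWeight_self]
  · cases o <;> simp [turnWeight, passWeight, h, h.not_gt, h.ne']; field_simp; ring

theorem sum_telescope (g : ℕ → ℝ) {i j : ℕ} (hij : i ≤ j) (hj : j ≤ N) :
    ∑ a : Fin N, (if i ≤ (a : ℕ) ∧ (a : ℕ) < j then g (a + 1) - g a else 0) = g j - g i := by
  rw [Fin.sum_univ_eq_sum_range (fun a => if i ≤ a ∧ a < j then g (a + 1) - g a else 0) N,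
    ← Finset.sum_filter, ← Finset.sum_Ico_sub g hij]
  refine Finset.sum_congr ?_ fun _ _ => rfl
  ext a
  simp only [Finset.mem_filter, Finset.mem_range, Finset.mem_Ico]
  omega

theorem sub_inv_mul_bend {q : ℝ} (hq : q ≠ 0) (a : Fin N) :
    (q - q⁻¹) * bendWeight q a = q ^ ((N : ℤ) - 2 * (a : ℕ)) - q ^ ((N : ℤ) - 2 * ((a : ℕ) + 1)) := by
  have h1 : (N : ℤ) - 2 * (a : ℕ) = (N - 1 - 2 * (a : ℕ)) + 1 := by ring
  have h2 : (N : ℤ) - 2 * ((a : ℕ) + 1) = (N - 1 - 2 * (a : ℕ)) - 1 := by ring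
  rw [h1, h2, zpow_add_one₀ hq, zpow_sub_one₀ hq, bendWeight]
  ring

theorem mul_bend {q : ℝ} (hq : q ≠ 0) (a : Fin N) :
    q * bendWeight q a = q ^ ((N : ℤ) - 2 * (a : ℕ)) := by
  have h1 : (N : ℤ) - 2 * (a : ℕ) = (N - 1 - 2 * (a : ℕ)) + 1 := by ring
  rw [h1, zpow_add_one₀ hq, bendWeight, mul_comm]

theorem inv_mul_bend {q : ℝ} (hq : q ≠ 0) (a : Fin N) :
    q⁻¹ * bendWeight q a = q ^ ((N : ℤ) - 2 * ((a : ℕ) + 1)) := by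
  have h2 : (N : ℤ) - 2 * ((a : ℕ) + 1) = (N - 1 - 2 * (a : ℕ)) - 1 := by ring
  rw [h2, zpow_sub_one₀ hq, bendWeight, mul_comm]

theorem sum_bend {q : ℝ} (hq : q ≠ 0) {i j : ℕ} (hij : i ≤ j) (hj : j ≤ N) :
    ∑ a : Fin N, (if i ≤ (a : ℕ) ∧ (a : ℕ) < j then (q - q⁻¹) * bendWeight q a else 0) =
      q ^ ((N : ℤ) - 2 * (i : ℕ)) - q ^ ((N : ℤ) - 2 * (j : ℕ)) := by
  have := sum_telescope (fun k : ℕ => -q ^ ((N : ℤ) - 2 * k)) hij hj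
  rw [show q ^ ((N : ℤ) - 2 * (i : ℕ)) - q ^ ((N : ℤ) - 2 * (j : ℕ)) =
    -q ^ ((N : ℤ) - 2 * (j : ℕ)) - -q ^ ((N : ℤ) - 2 * (i : ℕ)) by ring, ← this]
  refine Finset.sum_congr rfl fun a _ => ?_
  rw [sub_inv_mul_bend hq]
  push_cast
  congr 1
  ring

theorem sum_bend_inv {q : ℝ} (hq : q ≠ 0) {i j : ℕ} (hij : i ≤ j) (hj : j ≤ N) :
    ∑ a : Fin N, (if i ≤ (a : ℕ) ∧ (a : ℕ) < j then (q - q⁻¹) * (bendWeight q a)⁻¹ else 0) =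
      (q ^ ((N : ℤ) - 2 * (j : ℕ)))⁻¹ - (q ^ ((N : ℤ) - 2 * (i : ℕ)))⁻¹ := by
  have := sum_telescope (fun k : ℕ => (q ^ ((N : ℤ) - 2 * k))⁻¹) hij hj
  rw [← this]
  refine Finset.sum_congr rfl fun a _ => ?_
  push_cast
  rw [← mul_bend hq, ← inv_mul_bend hq]
  have := bendWeight_ne_zero hq a
  congr 1
  field_simp

theorem curl_bend {q : ℝ} (hq : q ≠ 0) (o : Bool) (b : Fin N) :
    passWeight q o b b * bendWeight q b + ∑ a, turnWeight q o a b * bendWeight q a = 1 := by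
  have hN := pow_ne_zero N hq
  cases o
  · have h := sum_bend (N := N) hq (i := b + 1) (j := N) (by omega) le_rfl
    have e : ∑ a, turnWeight q false a b * bendWeight q a = -q ^ N *
        ∑ a : Fin N, (if (b : ℕ) + 1 ≤ (a : ℕ) ∧ (a : ℕ) < N then (q - q⁻¹) * bendWeight q a
          else 0) := by
      rw [Finset.mul_sum]
      refine Finset.sum_congr rfl fun a _ => ?_
      simp only [turnWeight, Fin.lt_def, Nat.succ_le_iff, Fin.is_lt, and_true,
        Bool.false_eq_true, if_false]
      split_ifs <;> ring
    rw [e, h]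
    simp only [passWeight, Bool.false_eq_true, if_false, if_true]
    rw [mul_assoc, inv_mul_bend hq]
    have h3 : (N : ℤ) - 2 * (N : ℕ) = -(N : ℤ) := by ring
    rw [h3, zpow_neg, zpow_natCast]
    push_cast
    field_simp
    ring
  · have h := sum_bend (N := N) hq (i := 0) (j := b) (by omega) (by omega)
    have e : ∑ a, turnWeight q true a b * bendWeight q a = (q ^ N)⁻¹ *
        ∑ a : Fin N, (if 0 ≤ (a : ℕ) ∧ (a : ℕ) < b then (q - q⁻¹) * bendWeight q a
          else 0) := by
      rw [Finset.mul_sum]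
      refine Finset.sum_congr rfl fun a _ => ?_
      simp only [turnWeight, Fin.lt_def, Nat.zero_le, true_and, if_true]
      split_ifs <;> ring
    rw [e, h]
    simp only [passWeight, if_true]
    rw [mul_assoc, mul_bend hq]
    simp
    field_simp
    ring

theorem curl_bend_inv {q : ℝ} (hq : q ≠ 0) (o : Bool) (b : Fin N) :
    passWeight q o b b * (bendWeight q b)⁻¹ + ∑ a, turnWeight q o b a * (bendWeight q a)⁻¹ = 1 := by
  have hN := pow_ne_zero N hq
  cases o
  · have h := sum_bend_inv (N := N) hq (i := 0) (j := b) (by omega) (by omega)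
    have e : ∑ a, turnWeight q false b a * (bendWeight q a)⁻¹ = -q ^ N *
        ∑ a : Fin N, (if 0 ≤ (a : ℕ) ∧ (a : ℕ) < b then (q - q⁻¹) * (bendWeight q a)⁻¹
          else 0) := by
      rw [Finset.mul_sum]
      refine Finset.sum_congr rfl fun a _ => ?_
      simp only [turnWeight, Fin.lt_def, Nat.zero_le,
        true_and, Bool.false_eq_true, if_false]
      split_ifs <;> ring
    rw [e, h, ← mul_bend hq]
    simp [passWeight]
    field_simp
    ring
  · have h := sum_bend_inv (N := N) hq (i := b + 1) (j := N) (by omega) le_rfl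
    have e : ∑ a, turnWeight q true b a * (bendWeight q a)⁻¹ = (q ^ N)⁻¹ *
        ∑ a : Fin N, (if (b : ℕ) + 1 ≤ (a : ℕ) ∧ (a : ℕ) < N then (q - q⁻¹) * (bendWeight q a)⁻¹
          else 0) := by
      rw [Finset.mul_sum]
      refine Finset.sum_congr rfl fun a _ => ?_
      simp only [turnWeight, Fin.lt_def, Nat.succ_le_iff, Fin.is_lt, and_true, if_true]
      split_ifs <;> ring
    rw [e, h]
    push_cast
    rw [← inv_mul_bend hq]
    have h3 : (N : ℤ) - 2 * (N : ℤ) = -(N : ℤ) := by ring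
    rw [h3, zpow_neg, zpow_natCast]
    simp [passWeight]
    field_simp
    ring

theorem turn_bend {q : ℝ} (hq : q ≠ 0) (o : Bool) (b c : Fin N) :
    turnWeight q o c b * passWeight q (!o) c c * bendWeight q c +
      passWeight q o b b * bendWeight q b * turnWeight q (!o) b c +
      ∑ a, turnWeight q o a b * turnWeight q (!o) a c * bendWeight q a = 0 := by
  have hN := pow_ne_zero N hq
  have e : ∀ i j : Fin N, ∑ a : Fin N, (if i < a ∧ a < j then
      -((q - q⁻¹) * ((q - q⁻¹) * bendWeight q a)) else 0) = -((q - q⁻¹) *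
        ∑ a : Fin N, (if (i : ℕ) + 1 ≤ (a : ℕ) ∧ (a : ℕ) < j then (q - q⁻¹) * bendWeight q a
          else 0)) := by
    intro i j
    rw [Finset.mul_sum, ← Finset.sum_neg_distrib]
    refine Finset.sum_congr rfl fun a _ => ?_
    simp only [Fin.lt_def, Nat.succ_le_iff]
    split_ifs <;> simp
  cases o
  · have h : ∀ a, turnWeight q false a b * turnWeight q (!false) a c * bendWeight q a =
        if b < a ∧ a < c then -((q - q⁻¹) * ((q - q⁻¹) * bendWeight q a)) else 0 := by
      intro a
      simp only [turnWeight, Bool.not_false, if_true, Bool.false_eq_true, if_false]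
      split_ifs <;> (try field_simp) <;> simp_all
    rw [Finset.sum_congr rfl fun a _ => h a, e]
    rcases lt_or_ge b c with hbc | hbc
    · rw [sum_bend hq (by simpa [Nat.succ_le_iff] using hbc) (by omega)]
      push_cast
      rw [← mul_bend hq, ← inv_mul_bend hq]
      simp [turnWeight, passWeight, hbc]
      field_simp
      ring
    · rw [Finset.sum_eq_zero]
      · simp [turnWeight, hbc.not_gt]
      · intro a _
        have : ¬ ((b : ℕ) + 1 ≤ a ∧ (a : ℕ) < c) := by
          rw [Fin.le_def] at hbc; omega
        exact if_neg this
  · have h : ∀ a, turnWeight q true a b * turnWeight q (!true) a c * bendWeight q a =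
        if c < a ∧ a < b then -((q - q⁻¹) * ((q - q⁻¹) * bendWeight q a)) else 0 := by
      intro a
      simp only [turnWeight, Bool.not_true, if_true, Bool.false_eq_true, if_false]
      split_ifs <;> (try field_simp) <;> simp_all
    rw [Finset.sum_congr rfl fun a _ => h a, e]
    rcases lt_or_ge c b with hbc | hbc
    · rw [sum_bend hq (by simpa [Nat.succ_le_iff] using hbc) (by omega)]
      push_cast
      rw [← mul_bend hq, ← inv_mul_bend hq]
      simp [turnWeight, passWeight, hbc]
      field_simp
      ring
    · rw [Finset.sum_eq_zero]
      · simp [turnWeight, hbc.not_gt]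
      · intro a _
        have : ¬ ((c : ℕ) + 1 ≤ a ∧ (a : ℕ) < b) := by
          rw [Fin.le_def] at hbc; omega
        exact if_neg this

theorem turn_bend_inv {q : ℝ} (hq : q ≠ 0) (o : Bool) (b c : Fin N) :
    passWeight q o b b * (bendWeight q b)⁻¹ * turnWeight q (!o) c b +
      turnWeight q o b c * passWeight q (!o) c c * (bendWeight q c)⁻¹ +
      ∑ a, turnWeight q o b a * turnWeight q (!o) c a * (bendWeight q a)⁻¹ = 0 := by
  have hN := pow_ne_zero N hq
  have e : ∀ i j : Fin N, ∑ a : Fin N, (if i < a ∧ a < j then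
      -((q - q⁻¹) * ((q - q⁻¹) * (bendWeight q a)⁻¹)) else 0) = -((q - q⁻¹) *
        ∑ a : Fin N, (if (i : ℕ) + 1 ≤ (a : ℕ) ∧ (a : ℕ) < j then
          (q - q⁻¹) * (bendWeight q a)⁻¹ else 0)) := by
    intro i j
    rw [Finset.mul_sum, ← Finset.sum_neg_distrib]
    refine Finset.sum_congr rfl fun a _ => ?_
    simp only [Fin.lt_def, Nat.succ_le_iff]
    split_ifs <;> simp
  have hb := bendWeight_ne_zero hq b
  have hc := bendWeight_ne_zero hq c
  cases o
  · have h : ∀ a, turnWeight q false b a * turnWeight q (!false) c a * (bendWeight q a)⁻¹ =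
        if c < a ∧ a < b then -((q - q⁻¹) * ((q - q⁻¹) * (bendWeight q a)⁻¹)) else 0 := by
      intro a
      have ha := bendWeight_ne_zero hq a
      simp only [turnWeight, Bool.not_false, if_true, Bool.false_eq_true, if_false]
      split_ifs <;> (try field_simp) <;> simp_all
    rw [Finset.sum_congr rfl fun a _ => h a, e]
    rcases lt_or_ge c b with hbc | hbc
    · rw [sum_bend_inv hq (by simpa [Nat.succ_le_iff] using hbc) (by omega)]
      push_cast
      rw [← mul_bend hq, ← inv_mul_bend hq]
      simp [turnWeight, passWeight, hbc]
      field_simp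
      ring
    · rw [Finset.sum_eq_zero]
      · simp [turnWeight, hbc.not_gt]
      · intro a _
        have : ¬ ((c : ℕ) + 1 ≤ a ∧ (a : ℕ) < b) := by
          rw [Fin.le_def] at hbc; omega
        exact if_neg this
  · have h : ∀ a, turnWeight q true b a * turnWeight q (!true) c a * (bendWeight q a)⁻¹ =
        if b < a ∧ a < c then -((q - q⁻¹) * ((q - q⁻¹) * (bendWeight q a)⁻¹)) else 0 := by
      intro a
      have ha := bendWeight_ne_zero hq a
      simp only [turnWeight, Bool.not_true, if_true, Bool.false_eq_true, if_false]
      split_ifs <;> (try field_simp) <;> simp_all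
    rw [Finset.sum_congr rfl fun a _ => h a, e]
    rcases lt_or_ge b c with hbc | hbc
    · rw [sum_bend_inv hq (by simpa [Nat.succ_le_iff] using hbc) (by omega)]
      push_cast
      rw [← mul_bend hq, ← inv_mul_bend hq]
      simp [turnWeight, passWeight, hbc]
      field_simp
      ring
    · rw [Finset.sum_eq_zero]
      · simp [turnWeight, hbc.not_gt]
      · intro a _
        have : ¬ ((b : ℕ) + 1 ≤ a ∧ (a : ℕ) < c) := by
          rw [Fin.le_def] at hbc; omega
        exact if_neg this

end StateSum

end OrientedLinks

namespace OrientedLinks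

section StateSum

variable {N : ℕ}

theorem wordOp_zigzagRight {q : ℝ} (hq : q ≠ 0) (s : Bool) (G : List (Fin N) → ℝ) (a : Fin N)
    (x : List (Fin N)) :
    wordOp q [⟨1, .cup (!s)⟩, ⟨0, .cap s⟩] G (a :: x) = G (a :: x) := by
  have := bendWeight_ne_zero hq a
  cases s <;> simp [pieceOp, this]

theorem wordOp_zigzagLeft {q : ℝ} (hq : q ≠ 0) (s : Bool) (G : List (Fin N) → ℝ) (a : Fin N)
    (x : List (Fin N)) :
    wordOp q [⟨0, .cup s⟩, ⟨1, .cap (!s)⟩] G (a :: x) = G (a :: x) := by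
  have := bendWeight_ne_zero hq a
  cases s <;> simp [pieceOp, this]

theorem wordOp_capSlide {q : ℝ} (hq : q ≠ 0) (o d s : Bool) (G : List (Fin N) → ℝ)
    (a b c : Fin N) (x : List (Fin N)) :
    wordOp q [⟨0, .cross o d s⟩, ⟨1, .cap d⟩] G (a :: b :: c :: x) =
      wordOp q [⟨1, .cross (!o) s (!d)⟩, ⟨0, .cap d⟩] G (a :: b :: c :: x) := by
  have ha := bendWeight_ne_zero hq a
  have hb := bendWeight_ne_zero hq b
  have hc := bendWeight_ne_zero hq c
  cases d <;> cases s <;> simp [pieceOp] <;> by_cases h1 : a = c <;> by_cases h2 : a = b <;>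
    by_cases h3 : b = c <;> (try subst h1) <;> (try subst h2) <;> (try subst h3) <;> simp_all
  all_goals first
    | exact Or.inl (passWeight_comm _ _ _ _)
    | field_simp

theorem wordOp_cupSlide {q : ℝ} (hq : q ≠ 0) (o d s : Bool) (G : List (Fin N) → ℝ)
    (a : Fin N) (x : List (Fin N)) :
    wordOp q [⟨1, .cup d⟩, ⟨0, .cross o s d⟩] G (a :: x) =
      wordOp q [⟨0, .cup d⟩, ⟨1, .cross (!o) (!d) s⟩] G (a :: x) := by
  have ha := bendWeight_ne_zero hq a
  cases d <;> cases s <;>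
    simp [pieceOp, mul_add, Finset.sum_add_distrib, passWeight_comm q _ a, Finset.mul_sum,
      ← mul_assoc, inv_mul_cancel₀ ha]

theorem wordOp_capCurl {q : ℝ} (hq : q ≠ 0) (o d : Bool) (G : List (Fin N) → ℝ)
    (a b : Fin N) (x : List (Fin N)) :
    wordOp q [⟨0, .cross o d (!d)⟩, ⟨0, .cap (!d)⟩] G (a :: b :: x) =
      wordOp q [⟨0, .cap d⟩] G (a :: b :: x) := by
  rcases eq_or_ne a b with rfl | h
  · have ha := bendWeight_ne_zero hq a
    cases d <;> simp [pieceOp]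
    · have := curl_bend_inv hq (!o) a
      have e : ∑ c, bendWeight q a * (bendWeight q c)⁻¹ * turnWeight q (!o) a c * G x =
          bendWeight q a * (∑ c, turnWeight q (!o) a c * (bendWeight q c)⁻¹) * G x := by
        rw [Finset.mul_sum, Finset.sum_mul]
        exact Finset.sum_congr rfl fun _ _ => by ring
      rw [e, eq_sub_of_add_eq' this]
      field_simp
      ring
    · have := curl_bend hq (!o) a
      have e : ∑ c, turnWeight q (!o) c a * (bendWeight q c * G x) =
          (∑ c, turnWeight q (!o) c a * bendWeight q c) * G x := by
        rw [Finset.sum_mul]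
        exact Finset.sum_congr rfl fun _ _ => by ring
      rw [e, eq_sub_of_add_eq' this]
      ring
  · cases d <;> simp [pieceOp, h, h.symm]

theorem wordOp_cupCurl {q : ℝ} (hq : q ≠ 0) (o d : Bool) (G : List (Fin N) → ℝ)
    (x : List (Fin N)) :
    wordOp q [⟨0, .cup d⟩, ⟨0, .cross o d (!d)⟩] G x =
      wordOp q [⟨0, .cup (!d)⟩] G x := by
  cases d <;> simp [pieceOp, mul_add, Finset.sum_add_distrib, Finset.mul_sum]
  · rw [Finset.sum_comm, ← Finset.sum_add_distrib]
    refine Finset.sum_congr rfl fun c _ => ?_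
    have hc := bendWeight_ne_zero hq c
    have := curl_bend hq (!o) c
    have e : ∑ b, bendWeight q b * (bendWeight q c)⁻¹ * turnWeight q (!o) b c * G (c :: c :: x) =
        (∑ b, turnWeight q (!o) b c * bendWeight q b) * (bendWeight q c)⁻¹ * G (c :: c :: x) := by
      rw [Finset.sum_mul, Finset.sum_mul]
      exact Finset.sum_congr rfl fun _ _ => by ring
    rw [e, eq_sub_of_add_eq' this]
    field_simp
    ring
  · rw [Finset.sum_comm, ← Finset.sum_add_distrib]
    refine Finset.sum_congr rfl fun c _ => ?_
    have := curl_bend_inv hq (!o) c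
    have e : ∑ b, (bendWeight q b)⁻¹ * (turnWeight q (!o) c b * G (c :: c :: x)) =
        (∑ b, turnWeight q (!o) c b * (bendWeight q b)⁻¹) * G (c :: c :: x) := by
      rw [Finset.sum_mul]
      exact Finset.sum_congr rfl fun _ _ => by ring
    rw [e, eq_sub_of_add_eq' this]
    ring

theorem wordOp_reidemeisterTwo {q : ℝ} (hq : q ≠ 0) (o s t : Bool) (G : List (Fin N) → ℝ)
    (a b : Fin N) (x : List (Fin N)) :
    wordOp q [⟨0, .cross o s t⟩, ⟨0, .cross (!o) t s⟩] G (a :: b :: x) = G (a :: b :: x) := by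
  have h1 := pass_mul_pass hq o a b
  have h1' := pass_mul_pass hq (!o) a b
  have h4 : ∀ c : Fin N, bendWeight q c ≠ 0 := bendWeight_ne_zero hq
  rw [Bool.not_not] at h1'
  cases s <;> cases t <;> simp [pieceOp]
  · have h2 := pass_mul_turn hq o b a
    have h3 := turn_mul_turn q o b a
    simp only [passWeight_comm q _ b a] at *
    linear_combination G (a :: b :: x) * (h1 + h3) + G (b :: a :: x) * h2
  · rcases eq_or_ne a b with rfl | hab
    · have key : ∑ c, G (c :: c :: x) * bendWeight q a *
          (passWeight q (!o) a a * (bendWeight q a)⁻¹ * turnWeight q o c a +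
          turnWeight q (!o) a c * passWeight q o c c * (bendWeight q c)⁻¹ +
          ∑ e, turnWeight q (!o) a e * turnWeight q o c e * (bendWeight q e)⁻¹) = 0 := by
        refine Finset.sum_eq_zero fun c _ => ?_
        have := turn_bend_inv hq (!o) a c
        rw [Bool.not_not] at this
        rw [this, mul_zero]
      simp only [mul_add, Finset.sum_add_distrib, Finset.mul_sum, if_true] at key ⊢
      rw [Finset.sum_comm (f := fun c e => G (c :: c :: x) * bendWeight q a *
        (turnWeight q (!o) a e * turnWeight q o c e * (bendWeight q e)⁻¹))] at key
      rw [← add_assoc]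
      rw [add_assoc (_ * _), add_assoc (_ * _)]
      have h5 : passWeight q (!o) a a * (passWeight q o a a * G (a :: a :: x)) =
        G (a :: a :: x) := by rw [← mul_assoc, h1', one_mul]
      rw [h5, add_eq_left, ← key]
      refine congrArg₂ _ (congrArg₂ _ ?_ ?_) ?_
      · refine Finset.sum_congr rfl fun c _ => ?_
        have := h4 a
        field_simp
      · refine Finset.sum_congr rfl fun c _ => ?_
        ring
      · refine Finset.sum_congr rfl fun c _ => Finset.sum_congr rfl fun e _ => ?_
        ring
    · simp only [hab, hab.symm, if_false, passWeight_comm q _ b a]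
      linear_combination G (a :: b :: x) * h1'
  · rcases eq_or_ne a b with rfl | hab
    · have key : ∑ c, G (c :: c :: x) * (bendWeight q c)⁻¹ *
          (turnWeight q (!o) c a * passWeight q o c c * bendWeight q c +
          passWeight q (!o) a a * bendWeight q a * turnWeight q o a c +
          ∑ e, turnWeight q (!o) e a * turnWeight q o e c * bendWeight q e) = 0 := by
        refine Finset.sum_eq_zero fun c _ => ?_
        have := turn_bend hq (!o) a c
        rw [Bool.not_not] at this
        rw [this, mul_zero]
      simp only [mul_add, Finset.sum_add_distrib, Finset.mul_sum, if_true] at key ⊢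
      rw [Finset.sum_comm (f := fun c e => G (c :: c :: x) * (bendWeight q c)⁻¹ *
        (turnWeight q (!o) e a * turnWeight q o e c * bendWeight q e))] at key
      rw [add_comm (∑ c, _) (∑ c, _)] at key
      rw [← add_assoc]
      rw [add_assoc (_ * _), add_assoc (_ * _)]
      have h5 : passWeight q (!o) a a * (passWeight q o a a * G (a :: a :: x)) =
        G (a :: a :: x) := by rw [← mul_assoc, h1', one_mul]
      rw [h5, add_eq_left, ← key]
      refine congrArg₂ _ (congrArg₂ _ ?_ ?_) ?_
      · refine Finset.sum_congr rfl fun c _ => ?_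
        ring
      · refine Finset.sum_congr rfl fun c _ => ?_
        have := h4 c
        field_simp
      · refine Finset.sum_congr rfl fun c _ => Finset.sum_congr rfl fun e _ => ?_
        ring
    · simp only [hab, hab.symm, if_false, passWeight_comm q _ b a]
      linear_combination G (a :: b :: x) * h1'
  · have h2 := pass_mul_turn hq o a b
    have h3 := turn_mul_turn q o a b
    simp only [passWeight_comm q _ b a] at *
    linear_combination G (a :: b :: x) * (h1 + h3) + G (b :: a :: x) * h2

theorem wordOp_braid {q : ℝ} (hq : q ≠ 0) (G : List (Fin N) → ℝ)
    (a b c : Fin N) (x : List (Fin N)) :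
    wordOp q [⟨0, .cross true true true⟩, ⟨1, .cross true true true⟩, ⟨0, .cross true true true⟩] G
      (a :: b :: c :: x) =
    wordOp q [⟨1, .cross true true true⟩, ⟨0, .cross true true true⟩, ⟨1, .cross true true true⟩] G
      (a :: b :: c :: x) := by
  have hN := pow_ne_zero N hq
  simp only [wordOp_cons, wordOp_nil, layerOp_zero, layerOp_one_cons, pieceOp]
  rcases lt_trichotomy a b with h1 | h1 | h1 <;> rcases lt_trichotomy b c with h2 | h2 | h2 <;>
    rcases lt_trichotomy a c with h3 | h3 | h3 <;>
    first
    | (exfalso; omega)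
    | (try subst h1; try subst h2; try subst h3
       simp [passWeight, turnWeight, *, ne_of_lt, ne_of_gt, not_lt_of_gt]
       try field_simp
       try ring)

/-! ### Invariance of state sums -/

theorem BasicRule.wordOp_eq {p p' : List Layer} (h : BasicRule p p') {q : ℝ} (hq : q ≠ 0)
    {a b : List Bool} (hr : Runs p a b) (G : List (Fin N) → ℝ) {x : List (Fin N)}
    (hx : x.length = a.length) : wordOp q p G x = wordOp q p' G x := by
  have two : ∀ (s t : Bool) (r : List Bool), a = s :: t :: r → ∃ k l y, x = k :: l :: y := by
    rintro s t r rfl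
    match x, hx with
    | k :: l :: y, _ => exact ⟨k, l, y, rfl⟩
  have one : ∀ (s : Bool) (r : List Bool), a = s :: r → ∃ k y, x = k :: y := by
    rintro s r rfl
    match x, hx with
    | k :: y, _ => exact ⟨k, y, rfl⟩
  have three : ∀ (s t u : Bool) (r : List Bool), a = s :: t :: u :: r →
      ∃ k l m y, x = k :: l :: m :: y := by
    rintro s t u r rfl
    match x, hx with
    | k :: l :: m :: y, _ => exact ⟨k, l, m, y, rfl⟩
  have exch : ∀ (k : ℕ) (e f : Piece), Runs [⟨e.bot.length + k, f⟩, ⟨0, e⟩] a b →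
      wordOp q [⟨0, e⟩, ⟨e.top.length + k, f⟩] G x =
        wordOp q [⟨e.bot.length + k, f⟩, ⟨0, e⟩] G x := by
    rintro k e f ⟨c, ⟨l, r, hl, rfl, -⟩, -⟩
    simp only [List.length_append] at hx hl
    have := wordOp_exchange q k e f G (x := x.take e.bot.length)
      (y := (x.drop e.bot.length).take k)
      (z := ((x.drop e.bot.length).drop k).take f.bot.length)
      (x' := ((x.drop e.bot.length).drop k).drop f.bot.length)
      (by simp; omega) (by simp; omega) (by simp; omega)
    simpa only [List.take_append_drop] using this
  cases h with
  | exchange k e f => exact exch k e f ((BasicRule.exchange k e f).runs hr)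
  | exchangeRev k e f => exact (exch k e f hr).symm
  | zigzagRight s =>
    obtain ⟨k, y, rfl⟩ : ∃ k y, x = k :: y := by
      obtain ⟨z, r, rfl, -⟩ := runs_one.1 hr
      exact one _ _ rfl
    exact wordOp_zigzagRight hq s G k y
  | zigzagLeft s =>
    obtain ⟨k, y, rfl⟩ : ∃ k y, x = k :: y := by
      obtain ⟨r, rfl, hr⟩ := runs_zero.1 hr
      obtain ⟨z, r', h1, -⟩ := runs_one.1 hr
      simp only [Piece.top, Piece.bot, List.cons_append, List.nil_append, List.cons.injEq] at h1
      obtain ⟨-, -, rfl⟩ := h1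
      exact one _ _ rfl
    exact wordOp_zigzagLeft hq s G k y
  | capSlide o d s =>
    obtain ⟨k, l, m, y, rfl⟩ : ∃ k l m y, x = k :: l :: m :: y := by
      obtain ⟨z, r, rfl, -⟩ := runs_one.1 ((BasicRule.capSlide o d s).runs hr)
      exact three _ _ _ _ rfl
    exact wordOp_capSlide hq o d s G k l m y
  | capSlideRev o d s =>
    obtain ⟨k, l, m, y, rfl⟩ : ∃ k l m y, x = k :: l :: m :: y := by
      obtain ⟨z, r, rfl, -⟩ := runs_one.1 hr
      exact three _ _ _ _ rfl
    exact (wordOp_capSlide hq o d s G k l m y).symm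
  | cupSlide o d s =>
    obtain ⟨k, y, rfl⟩ : ∃ k y, x = k :: y := by
      obtain ⟨z, r, rfl, -⟩ := runs_one.1 hr
      exact one _ _ rfl
    exact wordOp_cupSlide hq o d s G k y
  | cupSlideRev o d s =>
    obtain ⟨k, y, rfl⟩ : ∃ k y, x = k :: y := by
      obtain ⟨z, r, rfl, -⟩ := runs_one.1 ((BasicRule.cupSlideRev o d s).runs hr)
      exact one _ _ rfl
    exact (wordOp_cupSlide hq o d s G k y).symm
  | capCurl o d =>
    obtain ⟨k, l, y, rfl⟩ : ∃ k l y, x = k :: l :: y := by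
      obtain ⟨r, rfl, -⟩ := runs_zero.1 hr
      exact two _ _ _ rfl
    exact wordOp_capCurl hq o d G k l y
  | capCurlRev o d =>
    obtain ⟨k, l, y, rfl⟩ : ∃ k l y, x = k :: l :: y := by
      obtain ⟨r, rfl, -⟩ := runs_zero.1 hr
      exact two _ _ _ rfl
    exact (wordOp_capCurl hq o d G k l y).symm
  | cupCurl o d => exact wordOp_cupCurl hq o d G x
  | cupCurlRev o d => exact (wordOp_cupCurl hq o d G x).symm
  | reidemeisterTwo o s t =>
    obtain ⟨k, l, y, rfl⟩ : ∃ k l y, x = k :: l :: y := by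
      obtain ⟨r, rfl, -⟩ := runs_zero.1 hr
      exact two _ _ _ rfl
    exact wordOp_reidemeisterTwo hq o s t G k l y

theorem Rewrites.wordOp_eq_of_sound {R : List Layer → List Layer → Prop} {q : ℝ}
    (hR : ∀ p p', R p p' → Rule p p')
    (hs : ∀ p p', R p p' → ∀ a b, Runs p a b → ∀ (G : List (Fin N) → ℝ) (x : List (Fin N)),
      x.length = a.length → wordOp q p G x = wordOp q p' G x)
    {w w' : List Layer} (h : Rewrites R w w') {a b : List Bool} (hr : Runs w a b)
    (G : List (Fin N) → ℝ) {x : List (Fin N)} (hx : x.length = a.length) :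
    wordOp q w G x = wordOp q w' G x := by
  induction h with
  | refl => rfl
  | @head u v p p' w i hp _ ih =>
    rw [← ih ((Rewrites.head (hR _ _ hp) (.refl _)).runs hr)]
    simp only [wordOp_append]
    obtain ⟨d, h1, -⟩ := Runs_append.1 hr
    obtain ⟨c, h2, h3⟩ := Runs_append.1 h1
    refine h2.wordOp_congr q (fun y hy => ?_) hx
    obtain ⟨ℓ, p, rfl⟩ := List.exists_cons_of_ne_nil (hR _ _ hp).ne_nil
    obtain ⟨l, a', b', rfl, rfl, rfl, h4⟩ := runs_shift_cons h3
    rw [List.length_append] at hy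
    rw [← List.take_append_drop l.length y, wordOp_shift q _ _ _ (by simp; omega),
      wordOp_shift q _ _ _ (by simp; omega)]
    exact hs _ _ hp _ _ h4 _ _ (by simp; omega)

theorem Rewrites.wordOp_eq_of_basic {q : ℝ} (hq : q ≠ 0) {w w' : List Layer}
    (h : Rewrites BasicRule w w') {a b : List Bool} (hr : Runs w a b)
    (G : List (Fin N) → ℝ) {x : List (Fin N)} (hx : x.length = a.length) :
    wordOp q w G x = wordOp q w' G x :=
  h.wordOp_eq_of_sound (fun _ _ => .basic) (fun _ _ hp _ _ hr G _ hx => hp.wordOp_eq hq hr G hx)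
    hr G hx

/-- State sums are invariant under a third Reidemeister move. -/
def RespectsThree (N : ℕ) (q : ℝ) (a b c s t u : Bool) : Prop :=
  ∀ (G : List (Fin N) → ℝ) (x : List (Fin N)), 3 ≤ x.length →
    wordOp q [⟨0, .cross a s t⟩, ⟨1, .cross b s u⟩, ⟨0, .cross c t u⟩] G x =
      wordOp q [⟨1, .cross c t u⟩, ⟨0, .cross b s u⟩, ⟨1, .cross a s t⟩] G x

theorem exists_strands {x : List (Fin N)} (hx : 3 ≤ x.length) (s t u : Bool) :
    ∃ r : List Bool, x.length = (s :: t :: u :: r).length :=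
  ⟨List.replicate (x.length - 3) true, by simp; omega⟩

theorem RespectsThree.swapLeft {q : ℝ} (hq : q ≠ 0) {a b c s t u : Bool}
    (h : RespectsThree N q a b c s t u) : RespectsThree N q (!a) c b t s u := by
  intro G x hx
  obtain ⟨r, hr⟩ := exists_strands hx t s u
  have e1 : Rewrites BasicRule [⟨0, .cross (!a) t s⟩, ⟨0, .cross a s t⟩, ⟨1, .cross b s u⟩,
      ⟨0, .cross c t u⟩, ⟨1, .cross (!a) t s⟩]
      [⟨1, .cross b s u⟩, ⟨0, .cross c t u⟩, ⟨1, .cross (!a) t s⟩] := by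
    have := Rewrites.of_rule_zero (BasicRule.reidemeisterTwo (!a) t s)
    rw [Bool.not_not] at this
    exact this.right _
  have e2 : Rewrites BasicRule [⟨0, .cross (!a) t s⟩, ⟨1, .cross c t u⟩, ⟨0, .cross b s u⟩,
      ⟨1, .cross a s t⟩, ⟨1, .cross (!a) t s⟩]
      [⟨0, .cross (!a) t s⟩, ⟨1, .cross c t u⟩, ⟨0, .cross b s u⟩] := by
    have := Rewrites.of_rule (BasicRule.reidemeisterTwo a s t) 1
    exact this.left [⟨0, .cross (!a) t s⟩, ⟨1, .cross c t u⟩, ⟨0, .cross b s u⟩]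
  have r1 : Runs [⟨0, .cross (!a) t s⟩, ⟨0, .cross a s t⟩, ⟨1, .cross b s u⟩,
      ⟨0, .cross c t u⟩, ⟨1, .cross (!a) t s⟩] (t :: s :: u :: r) (u :: s :: t :: r) := by
    simp [runs_zero, runs_one, Piece.bot, Piece.top, Runs.eq_1]
  have r2 : Runs [⟨0, .cross (!a) t s⟩, ⟨1, .cross c t u⟩, ⟨0, .cross b s u⟩,
      ⟨1, .cross a s t⟩, ⟨1, .cross (!a) t s⟩] (t :: s :: u :: r) (u :: s :: t :: r) := by
    simp [runs_zero, runs_one, Piece.bot, Piece.top, Runs.eq_1]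
  have r3 : Runs [⟨0, .cross (!a) t s⟩] (t :: s :: u :: r) (s :: t :: u :: r) := by
    simp [runs_zero, Piece.bot, Piece.top, Runs.eq_1]
  rw [← e1.wordOp_eq_of_basic hq r1 G hr, ← e2.wordOp_eq_of_basic hq r2 G hr]
  exact (r3.wordOp_congr q (fun y hy => h (wordOp q [⟨1, .cross (!a) t s⟩] G) y
    (by simp at hy; omega)) hr).symm

theorem RespectsThree.swapRight {q : ℝ} (hq : q ≠ 0) {a b c s t u : Bool}
    (h : RespectsThree N q a b c s t u) : RespectsThree N q b a (!c) s u t := by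
  intro G x hx
  obtain ⟨r, hr⟩ := exists_strands hx s u t
  have e1 : Rewrites BasicRule [⟨1, .cross (!c) u t⟩, ⟨0, .cross a s t⟩, ⟨1, .cross b s u⟩,
      ⟨0, .cross c t u⟩, ⟨0, .cross (!c) u t⟩]
      [⟨1, .cross (!c) u t⟩, ⟨0, .cross a s t⟩, ⟨1, .cross b s u⟩] := by
    have := Rewrites.of_rule_zero (BasicRule.reidemeisterTwo c t u)
    exact this.left [⟨1, .cross (!c) u t⟩, ⟨0, .cross a s t⟩, ⟨1, .cross b s u⟩]
  have e2 : Rewrites BasicRule [⟨1, .cross (!c) u t⟩, ⟨1, .cross c t u⟩, ⟨0, .cross b s u⟩,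
      ⟨1, .cross a s t⟩, ⟨0, .cross (!c) u t⟩]
      [⟨0, .cross b s u⟩, ⟨1, .cross a s t⟩, ⟨0, .cross (!c) u t⟩] := by
    have := Rewrites.of_rule (BasicRule.reidemeisterTwo (!c) u t) 1
    rw [Bool.not_not] at this
    exact this.right _
  have r1 : Runs [⟨1, .cross (!c) u t⟩, ⟨0, .cross a s t⟩, ⟨1, .cross b s u⟩,
      ⟨0, .cross c t u⟩, ⟨0, .cross (!c) u t⟩] (s :: u :: t :: r) (t :: u :: s :: r) := by
    simp [runs_zero, runs_one, Piece.bot, Piece.top, Runs.eq_1]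
  have r2 : Runs [⟨1, .cross (!c) u t⟩, ⟨1, .cross c t u⟩, ⟨0, .cross b s u⟩,
      ⟨1, .cross a s t⟩, ⟨0, .cross (!c) u t⟩] (s :: u :: t :: r) (t :: u :: s :: r) := by
    simp [runs_zero, runs_one, Piece.bot, Piece.top, Runs.eq_1]
  have r3 : Runs [⟨1, .cross (!c) u t⟩] (s :: u :: t :: r) (s :: t :: u :: r) := by
    simp [runs_one, Piece.bot, Piece.top, Runs.eq_1]
  rw [← e1.wordOp_eq_of_basic hq r1 G hr, ← e2.wordOp_eq_of_basic hq r2 G hr]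
  exact (r3.wordOp_congr q (fun y hy => h (wordOp q [⟨0, .cross (!c) u t⟩] G) y
    (by simp at hy; omega)) hr).symm

theorem RespectsThree.rotate {q : ℝ} (hq : q ≠ 0) {a b c s t u : Bool}
    (h : RespectsThree N q a b c s t u) : RespectsThree N q c (!a) (!b) t u (!s) := by
  intro G x hx
  obtain ⟨r, hr⟩ := exists_strands hx t u (!s)
  have ex : ∀ (o o' s t s' t' : Bool), Rewrites BasicRule
      [⟨1, .cross o s t⟩, ⟨3, .cross o' s' t'⟩] [⟨3, .cross o' s' t'⟩, ⟨1, .cross o s t⟩] :=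
    fun _ _ _ _ _ _ => Rewrites.exchange (by simp [Piece.bot]) (by simp [Piece.bot, Piece.top])
  have cup : ∀ (i : ℕ) (o s t d : Bool), Rewrites BasicRule
      [⟨0, .cup d⟩, ⟨i + 2, .cross o s t⟩] [⟨i, .cross o s t⟩, ⟨0, .cup d⟩] :=
    fun _ _ _ _ _ => Rewrites.exchange (by simp [Piece.bot]) (by simp [Piece.bot, Piece.top])
  have zz : Rewrites BasicRule [⟨0, .cup (!s)⟩, ⟨1, .cap s⟩] [] := by
    have := Rewrites.of_rule_zero (BasicRule.zigzagLeft (!s))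
    rwa [Bool.not_not] at this
  have slide : ∀ (i : ℕ) (o t : Bool), Rewrites BasicRule
      [⟨i, .cross o s t⟩, ⟨i + 1, .cap s⟩] [⟨i + 1, .cross (!o) t (!s)⟩, ⟨i, .cap s⟩] :=
    fun i o t => Rewrites.of_rule (BasicRule.capSlide o s t) i
  have e1 : Rewrites BasicRule [⟨0, .cup (!s)⟩, ⟨1, .cross a s t⟩, ⟨2, .cross b s u⟩,
      ⟨1, .cross c t u⟩, ⟨3, .cap s⟩]
      [⟨1, .cross (!b) u (!s)⟩, ⟨0, .cross (!a) t (!s)⟩, ⟨1, .cross c t u⟩] := by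
    refine .trans (v := [⟨0, .cup (!s)⟩, ⟨1, .cross a s t⟩, ⟨2, .cross b s u⟩,
      ⟨3, .cap s⟩, ⟨1, .cross c t u⟩]) ?_ ?_
    · exact (Rewrites.exchange (i := 1) (j := 3) (j' := 3) (e := .cross c t u) (f := .cap s)
        (by simp [Piece.bot]) (by simp [Piece.bot, Piece.top])).left
        [⟨0, .cup (!s)⟩, ⟨1, .cross a s t⟩, ⟨2, .cross b s u⟩]
    refine .trans ((slide 2 b u).ctx [⟨0, .cup (!s)⟩, ⟨1, .cross a s t⟩] [⟨1, .cross c t u⟩]) ?_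
    refine .trans ((ex a (!b) s t u (!s)).ctx [⟨0, .cup (!s)⟩]
      [⟨2, .cap s⟩, ⟨1, .cross c t u⟩]) ?_
    refine .trans ((slide 1 a t).ctx [⟨0, .cup (!s)⟩, ⟨3, .cross (!b) u (!s)⟩]
      [⟨1, .cross c t u⟩]) ?_
    refine .trans ((cup 1 (!b) u (!s) (!s)).ctx [] [⟨2, .cross (!a) t (!s)⟩, ⟨1, .cap s⟩,
      ⟨1, .cross c t u⟩]) ?_
    refine .trans ((cup 0 (!a) t (!s) (!s)).ctx [⟨1, .cross (!b) u (!s)⟩] [⟨1, .cap s⟩,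
      ⟨1, .cross c t u⟩]) ?_
    exact zz.ctx [⟨1, .cross (!b) u (!s)⟩, ⟨0, .cross (!a) t (!s)⟩] [⟨1, .cross c t u⟩]
  have e2 : Rewrites BasicRule [⟨0, .cup (!s)⟩, ⟨2, .cross c t u⟩, ⟨1, .cross b s u⟩,
      ⟨2, .cross a s t⟩, ⟨3, .cap s⟩]
      [⟨0, .cross c t u⟩, ⟨1, .cross (!a) t (!s)⟩, ⟨0, .cross (!b) u (!s)⟩] := by
    refine .trans ((slide 2 a t).ctx [⟨0, .cup (!s)⟩, ⟨2, .cross c t u⟩, ⟨1, .cross b s u⟩] []) ?_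
    refine .trans ((ex b (!a) s u t (!s)).ctx [⟨0, .cup (!s)⟩, ⟨2, .cross c t u⟩]
      [⟨2, .cap s⟩]) ?_
    refine .trans ((slide 1 b u).ctx [⟨0, .cup (!s)⟩, ⟨2, .cross c t u⟩,
      ⟨3, .cross (!a) t (!s)⟩] []) ?_
    refine .trans ((cup 0 c t u (!s)).ctx [] [⟨3, .cross (!a) t (!s)⟩,
      ⟨2, .cross (!b) u (!s)⟩, ⟨1, .cap s⟩]) ?_
    refine .trans ((cup 1 (!a) t (!s) (!s)).ctx [⟨0, .cross c t u⟩]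
      [⟨2, .cross (!b) u (!s)⟩, ⟨1, .cap s⟩]) ?_
    refine .trans ((cup 0 (!b) u (!s) (!s)).ctx [⟨0, .cross c t u⟩, ⟨1, .cross (!a) t (!s)⟩]
      [⟨1, .cap s⟩]) ?_
    exact zz.ctx [⟨0, .cross c t u⟩, ⟨1, .cross (!a) t (!s)⟩, ⟨0, .cross (!b) u (!s)⟩] []
  have rcap : Layer.Step ⟨3, .cap s⟩ ((!s) :: u :: t :: s :: (!s) :: r) ((!s) :: u :: t :: r) :=
    ⟨[!s, u, t], r, rfl, rfl, rfl⟩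
  have rb : Layer.Step ⟨2, .cross b s u⟩ ((!s) :: t :: s :: u :: (!s) :: r)
      ((!s) :: t :: u :: s :: (!s) :: r) := ⟨[!s, t], (!s) :: r, rfl, rfl, rfl⟩
  have rc : Layer.Step ⟨2, .cross c t u⟩ ((!s) :: s :: t :: u :: (!s) :: r)
      ((!s) :: s :: u :: t :: (!s) :: r) := ⟨[!s, s], (!s) :: r, rfl, rfl, rfl⟩
  have ra : Layer.Step ⟨2, .cross a s t⟩ ((!s) :: u :: s :: t :: (!s) :: r)
      ((!s) :: u :: t :: s :: (!s) :: r) := ⟨[!s, u], (!s) :: r, rfl, rfl, rfl⟩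
  have r1 : Runs [⟨0, .cup (!s)⟩, ⟨1, .cross a s t⟩, ⟨2, .cross b s u⟩,
      ⟨1, .cross c t u⟩, ⟨3, .cap s⟩] (t :: u :: (!s) :: r) ((!s) :: u :: t :: r) :=
    ⟨(!s) :: s :: t :: u :: (!s) :: r, ⟨[], _, rfl, rfl, by simp [Piece.top]⟩,
      _, ⟨[!s], _, rfl, rfl, rfl⟩, _, rb, _, ⟨[!s], _, rfl, rfl, rfl⟩, _, rcap, rfl⟩
  have r2 : Runs [⟨0, .cup (!s)⟩, ⟨2, .cross c t u⟩, ⟨1, .cross b s u⟩,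
      ⟨2, .cross a s t⟩, ⟨3, .cap s⟩] (t :: u :: (!s) :: r) ((!s) :: u :: t :: r) :=
    ⟨(!s) :: s :: t :: u :: (!s) :: r, ⟨[], _, rfl, rfl, by simp [Piece.top]⟩,
      _, rc, _, ⟨[!s], _, rfl, rfl, rfl⟩, _, ra, _, rcap, rfl⟩
  have r3 : Runs [⟨0, .cup (!s)⟩] (t :: u :: (!s) :: r) ((!s) :: s :: t :: u :: (!s) :: r) :=
    ⟨_, ⟨[], _, rfl, rfl, by simp [Piece.top]⟩, rfl⟩
  rw [← e1.wordOp_eq_of_basic hq r1 G hr, ← e2.wordOp_eq_of_basic hq r2 G hr]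
  refine (r3.wordOp_congr q (fun y hy => ?_) hr).symm
  obtain ⟨k, y, rfl⟩ : ∃ k z, y = k :: z := by
    match y, hy with
    | k :: z, _ => exact ⟨k, z, rfl⟩
  have s1 := wordOp_shift q [⟨0, .cross a s t⟩, ⟨1, .cross b s u⟩, ⟨0, .cross c t u⟩] 1
    (wordOp q [⟨3, .cap s⟩] G) (l := [k]) rfl y
  have s2 := wordOp_shift q [⟨1, .cross c t u⟩, ⟨0, .cross b s u⟩, ⟨1, .cross a s t⟩] 1
    (wordOp q [⟨3, .cap s⟩] G) (l := [k]) rfl y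
  have s3 := h (fun y => wordOp q [⟨3, .cap s⟩] G ([k] ++ y)) y (by simp at hy; omega)
  exact s1.trans (s3.trans s2.symm)

/-- State sums are invariant under the third Reidemeister moves with given orientations. -/
def RespectsAllThree (N : ℕ) (q : ℝ) (s t u : Bool) : Prop :=
  ∀ a b c : Bool, (a = c → b = a) → RespectsThree N q a b c s t u

theorem RespectsAllThree.swapLeft {q : ℝ} (hq : q ≠ 0) {s t u : Bool}
    (h : RespectsAllThree N q s t u) : RespectsAllThree N q t s u := by
  intro a b c habc
  have := (h (!a) c b (by revert habc; cases a <;> cases b <;> cases c <;> simp)).swapLeft hq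
  rwa [Bool.not_not] at this

theorem RespectsAllThree.swapRight {q : ℝ} (hq : q ≠ 0) {s t u : Bool}
    (h : RespectsAllThree N q s t u) : RespectsAllThree N q s u t := by
  intro a b c habc
  have := (h b a (!c) (by revert habc; cases a <;> cases b <;> cases c <;> simp)).swapRight hq
  rwa [Bool.not_not] at this

theorem RespectsAllThree.rotate {q : ℝ} (hq : q ≠ 0) {s t u : Bool}
    (h : RespectsAllThree N q s t u) : RespectsAllThree N q t u (!s) := by
  intro a b c habc
  have := (h (!b) (!c) a (by revert habc; cases a <;> cases b <;> cases c <;> simp)).rotate hq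
  rwa [Bool.not_not, Bool.not_not] at this

theorem respectsAllThree {q : ℝ} (hq : q ≠ 0) (s t u : Bool) : RespectsAllThree N q s t u := by
  have h0 : RespectsThree N q true true true true true true := by
    intro G x hx
    match x, hx with
    | k :: l :: m :: y, _ => exact wordOp_braid hq G k l m y
  have h1 : RespectsAllThree N q true true true := by
    intro a b c habc
    have l := h0.swapLeft hq
    have r := h0.swapRight hq
    have lr := l.swapRight hq
    have rl := r.swapLeft hq
    have lrl := lr.swapLeft hq
    cases a <;> cases b <;> cases c <;> simp_all
  have h2 : RespectsAllThree N q true true false := h1.rotate hq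
  have h3 : RespectsAllThree N q true false false := h2.rotate hq
  have h4 : RespectsAllThree N q false false false := h3.rotate hq
  have h5 := h2.swapRight hq
  have h6 := h3.swapLeft hq
  cases s <;> cases t <;> cases u
  exacts [h4, h6.swapRight hq, h6, h5.swapLeft hq, h3, h5, h2, h1]

theorem Rule.wordOp_eq {p p' : List Layer} (h : Rule p p') {q : ℝ} (hq : q ≠ 0)
    {a b : List Bool} (hr : Runs p a b) (G : List (Fin N) → ℝ) {x : List (Fin N)}
    (hx : x.length = a.length) : wordOp q p G x = wordOp q p' G x := by
  rcases h with h | ⟨k, l, m, s, t, u, h⟩ | ⟨k, l, m, s, t, u, h⟩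
  · exact h.wordOp_eq hq hr G hx
  · obtain ⟨z, r, rfl, -⟩ := runs_one.1 ((Rule.reidemeisterThree k l m s t u h).runs hr)
    exact respectsAllThree hq s t u k l m h G x (by simp [Piece.bot] at hx; omega)
  · obtain ⟨z, r, rfl, -⟩ := runs_one.1 hr
    exact (respectsAllThree hq s t u k l m h G x (by simp [Piece.bot] at hx; omega)).symm

/-- The state sum of a closed word. -/
noncomputable def stateSum (N : ℕ) (q : ℝ) (w : List Layer) : ℝ :=
  wordOp (N := N) q w (fun _ => 1) []

theorem stateSum_eq_of_rule {q : ℝ} (hq : q ≠ 0) {x y p p' : List Layer} {i : ℕ} (h : Rule p p')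
    (hr : Runs (x ++ shift i p ++ y) [] []) :
    stateSum N q (x ++ shift i p ++ y) = stateSum N q (x ++ shift i p' ++ y) :=
  (Rewrites.head h (.refl _)).wordOp_eq_of_sound (fun _ _ h => h)
    (fun _ _ hp _ _ hr G _ hx => hp.wordOp_eq hq hr G hx) hr _ rfl

theorem Move.stateSum_eq {q : ℝ} (hq : q ≠ 0) {D E : LinkDiagram} (h : Move D E) :
    stateSum N q D.1.word = stateSum N q E.1.word := by
  obtain ⟨x, y, p, p', hm, hD, hE⟩ := h
  obtain ⟨i, p, p', hr, rfl, rfl⟩ := hm.exists_rule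
  rw [hD, hE]
  exact stateSum_eq_of_rule hq hr (hD ▸ D.1.closed)

end StateSum

end OrientedLinks

namespace OrientedLinks

/-! ### The skein relation for state sums -/

section StateSum

variable {N : ℕ}

theorem Runs.wordOp_linear {w : List Layer} {a b : List Bool} (h : Runs w a b) (q α β γ : ℝ)
    {G₁ G₂ G₃ : List (Fin N) → ℝ}
    (hG : ∀ y, y.length = b.length → α * G₁ y - β * G₂ y = γ * G₃ y)
    {x : List (Fin N)} (hx : x.length = a.length) :
    α * wordOp q w G₁ x - β * wordOp q w G₂ x = γ * wordOp q w G₃ x := by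
  induction w generalizing a x with
  | nil => obtain rfl := h; exact hG x hx
  | cons ℓ w ih =>
    obtain ⟨c, h1, h2⟩ := h
    obtain ⟨ι, _, k, y, hy, he⟩ := h1.op_eq_sum q hx
    simp only [wordOp_cons, he, Finset.mul_sum, ← Finset.sum_sub_distrib]
    refine Finset.sum_congr rfl fun j _ => ?_
    linear_combination k j * ih h2 (hy j)

theorem passWeight_skein {q : ℝ} (hq : q ≠ 0) (a b : Fin N) :
    q ^ N * passWeight q true a b - (q ^ N)⁻¹ * passWeight q false a b =
      if a = b then q - q⁻¹ else 0 := by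
  have := pow_ne_zero N hq
  by_cases h : a = b
  · simp [passWeight, h]; field_simp
  · simp [passWeight, h, this]

theorem turnWeight_skein {q : ℝ} (hq : q ≠ 0) (a b : Fin N) :
    q ^ N * turnWeight q true a b - (q ^ N)⁻¹ * turnWeight q false a b =
      if a = b then 0 else q - q⁻¹ := by
  have := pow_ne_zero N hq
  rcases lt_trichotomy a b with h | rfl | h
  · simp [turnWeight, h, h.not_gt, h.ne]; field_simp
  · simp [turnWeight]
  · simp [turnWeight, h, h.not_gt, h.ne']; field_simp

theorem turnWeight_skein_mul {q : ℝ} (hq : q ≠ 0) (a b : Fin N) (z : ℝ) :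
    q ^ N * (turnWeight q true a b * z) - (q ^ N)⁻¹ * (turnWeight q false a b * z) =
      (q - q⁻¹) * z - if a = b then (q - q⁻¹) * z else 0 := by
  have := turnWeight_skein hq a b
  by_cases h : a = b
  · simp only [h, if_true, turnWeight_self]; ring
  · simp only [h, if_false] at this ⊢
    linear_combination z * this

theorem wordOp_skein_zero {q : ℝ} (hq : q ≠ 0) (s t : Bool) (G : List (Fin N) → ℝ) (a b : Fin N)
    (x : List (Fin N)) :
    q ^ N * wordOp q [posCross 0 s t] G (a :: b :: x) -
      (q ^ N)⁻¹ * wordOp q [negCross 0 s t] G (a :: b :: x) =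
      (q - q⁻¹) * wordOp q (smoothing 0 s t) G (a :: b :: x) := by
  have h1 := passWeight_skein hq a b
  have h2 := turnWeight_skein hq a b
  have h3 := turnWeight_skein hq b a
  cases s <;> cases t <;> simp [posCross, negCross, smoothing, pieceOp]
  · rcases eq_or_ne a b with rfl | h
    · simp [turnWeight_self] at h1 ⊢
      linear_combination G (a :: a :: x) * h1
    · simp only [h, h.symm, if_false] at h1 h3
      linear_combination G (b :: a :: x) * h1 + G (a :: b :: x) * h3
  · rcases eq_or_ne a b with rfl | h
    · have key : ∀ c, q ^ N * (bendWeight q a * (bendWeight q c)⁻¹ * turnWeight q true a c *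
          G (c :: c :: x)) - (q ^ N)⁻¹ * (bendWeight q a * (bendWeight q c)⁻¹ *
          turnWeight q false a c * G (c :: c :: x)) =
          (q - q⁻¹) * (bendWeight q a * ((bendWeight q c)⁻¹ * G (c :: c :: x))) -
          if a = c then (q - q⁻¹) * (bendWeight q a * ((bendWeight q c)⁻¹ * G (c :: c :: x)))
            else 0 := by
        intro c
        rw [← turnWeight_skein_mul hq]
        ring
      simp only [if_true] at h1 ⊢
      have e : ∀ A B C D E F : ℝ, A * (B + C) - D * (E + F) = (A * B - D * E) + (A * C - D * F) :=
        by intros; ring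
      rw [e, Finset.mul_sum, Finset.mul_sum, ← Finset.sum_sub_distrib,
        Finset.sum_congr rfl fun c _ => key c, Finset.sum_sub_distrib]
      simp only [Finset.sum_ite_eq, Finset.mem_univ, if_true, Finset.mul_sum]
      have ha := bendWeight_ne_zero hq a
      rw [mul_inv_cancel_left₀ ha]
      linear_combination G (a :: a :: x) * h1
    · simp only [h, if_false, add_zero] at h1 ⊢
      linear_combination G (b :: a :: x) * h1
  · rcases eq_or_ne a b with rfl | h
    · have e : ∀ A B C D E F : ℝ, A * (B + C) - D * (E + F) = (A * B - D * E) + (A * C - D * F) :=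
        by intros; ring
      simp only [if_true] at h1 ⊢
      rw [e, Finset.mul_sum, Finset.mul_sum, ← Finset.sum_sub_distrib,
        Finset.sum_congr rfl fun c _ => turnWeight_skein_mul hq c a _, Finset.sum_sub_distrib]
      simp only [Finset.sum_ite_eq', Finset.mem_univ, if_true, Finset.mul_sum]
      linear_combination G (a :: a :: x) * h1
    · simp only [h, if_false, add_zero] at h1 ⊢
      linear_combination G (b :: a :: x) * h1
  · rcases eq_or_ne a b with rfl | h
    · simp [turnWeight_self] at h1 ⊢
      linear_combination G (a :: a :: x) * h1
    · simp only [h, if_false] at h1 h2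
      linear_combination G (b :: a :: x) * h1 + G (a :: b :: x) * h2

theorem shift_smoothing (i : ℕ) (s t : Bool) : smoothing i s t = shift i (smoothing 0 s t) := by
  unfold smoothing
  split_ifs <;> rfl

theorem stateSum_skein {q : ℝ} (hq : q ≠ 0) {x y : List Layer} {i : ℕ} {s t : Bool}
    (h : Runs (x ++ [posCross i s t] ++ y) [] []) :
    q ^ N * stateSum N q (x ++ [posCross i s t] ++ y) -
      (q ^ N)⁻¹ * stateSum N q (x ++ [negCross i s t] ++ y) =
      (q - q⁻¹) * stateSum N q (x ++ smoothing i s t ++ y) := by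
  simp only [stateSum, wordOp_append]
  obtain ⟨d, h1, -⟩ := Runs_append.1 h
  obtain ⟨c, h2, c', ⟨l, r, rfl, rfl, -⟩, -⟩ := Runs_append.1 h1
  refine h2.wordOp_linear q _ _ _ (fun z hz => ?_) rfl
  simp only [posCross, Piece.bot, List.length_append, List.length_cons, List.length_nil] at hz
  obtain ⟨a, b, z', hz'⟩ : ∃ a b z', z.drop l.length = a :: b :: z' := by
    have : (z.drop l.length).length = 2 + r.length := by simp; omega
    generalize z.drop l.length = u at this
    match u, this with
    | a :: b :: u, _ => exact ⟨a, b, u, rfl⟩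
    | [], h => simp at h; omega
    | [a], h => simp at h; omega
  have hl : (z.take l.length).length = l.length := by simp; omega
  have e1 : [posCross l.length s t] = shift l.length [posCross 0 s t] := rfl
  have e2 : [negCross l.length s t] = shift l.length [negCross 0 s t] := rfl
  have e3 := shift_smoothing l.length s t
  rw [e1, e2, e3, ← List.take_append_drop l.length z, hz', wordOp_shift q _ _ _ hl,
    wordOp_shift q _ _ _ hl, wordOp_shift q _ _ _ hl]
  exact wordOp_skein_zero hq s t _ a b z'

/-- The state sum of a circle. -/
noncomputable def circleWeight (N : ℕ) (q : ℝ) : ℝ := ∑ a : Fin N, (bendWeight q a)⁻¹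

theorem circleWeight_pos {q : ℝ} (hq : 0 < q) (hN : 0 < N) : 0 < circleWeight N q := by
  have : Nonempty (Fin N) := ⟨⟨0, hN⟩⟩
  exact Finset.sum_pos (fun a _ => inv_pos.2 (zpow_pos hq _)) Finset.univ_nonempty

theorem circleWeight_mul {q : ℝ} (hq : q ≠ 0) :
    (q - q⁻¹) * circleWeight N q = q ^ N - (q ^ N)⁻¹ := by
  have h := sum_bend_inv (N := N) hq (i := 0) (j := N) (by omega) le_rfl
  simp only [Nat.zero_le, Fin.is_lt, and_self, if_true, ← Finset.mul_sum] at h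
  rw [circleWeight, h]
  have h3 : (N : ℤ) - 2 * (N : ℕ) = -(N : ℤ) := by ring
  have h4 : (N : ℤ) - 2 * (0 : ℕ) = (N : ℤ) := by simp
  rw [h3, h4, zpow_neg, zpow_natCast, inv_inv]

theorem stateSum_circles (q : ℝ) (n : ℕ) : stateSum N q (circles n) = circleWeight N q ^ n := by
  induction n with
  | zero => simp [stateSum, circles]
  | succ n ih =>
    have e : circles (n + 1) = [⟨0, .cup true⟩, ⟨0, .cap true⟩] ++ circles n := by
      simp [circles, List.replicate_succ]
    have ih' : wordOp q (circles n) (fun _ : List (Fin N) => (1 : ℝ)) [] = circleWeight N q ^ n := ih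
    rw [stateSum, e, wordOp_append]
    simp [pieceOp, ih', ← Finset.sum_mul, pow_succ', circleWeight]

end StateSum

end OrientedLinks

namespace OrientedLinks

/-! ### State sums count components -/

section Colouring

variable {N : ℕ}

theorem passWeight_one (o : Bool) (a b : Fin N) : passWeight 1 o a b = 1 := by
  cases o <;> simp [passWeight]

theorem turnWeight_one (o : Bool) (a b : Fin N) : turnWeight 1 o a b = 0 := by
  cases o <;> simp [turnWeight]

theorem bendWeight_one (a : Fin N) : bendWeight 1 a = 1 := one_zpow _

theorem pieceOp_one_cross (o s t : Bool) (G : List (Fin N) → ℝ) (x : List (Fin N)) :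
    pieceOp 1 (.cross o s t) G x = pieceOp 1 (.double s t) G x := by
  rcases x with _ | ⟨a, _ | ⟨b, x⟩⟩ <;> cases s <;> cases t <;>
    simp [pieceOp, passWeight_one, turnWeight_one]

/-- The lists of colours `x` below and `y` above a layer agree along its arcs. -/
def ColorStep (ℓ : Layer) (x y : List (Fin N)) : Prop :=
  y.length = x.length - ℓ.piece.bot.length + ℓ.piece.top.length ∧
  (∀ p < ℓ.pos, x[p]? = y[p]?) ∧
  (∀ p, x[ℓ.pos + ℓ.piece.bot.length + p]? = y[ℓ.pos + ℓ.piece.top.length + p]?) ∧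
  match ℓ.piece with
  | .cup _ => y[ℓ.pos]? = y[ℓ.pos + 1]?
  | .cap _ => x[ℓ.pos]? = x[ℓ.pos + 1]?
  | .cross _ _ _ => x[ℓ.pos]? = y[ℓ.pos + 1]? ∧ x[ℓ.pos + 1]? = y[ℓ.pos]?
  | .double _ _ => x[ℓ.pos]? = y[ℓ.pos + 1]? ∧ x[ℓ.pos + 1]? = y[ℓ.pos]?

theorem colorStep_append_iff (e : Piece) (l m r y : List (Fin N)) (hm : m.length = e.bot.length) :
    ColorStep ⟨l.length, e⟩ (l ++ m ++ r) y ↔ ∃ m' : List (Fin N), m'.length = e.top.length ∧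
      y = l ++ m' ++ r ∧ match (generalizing := false) e with
      | .cup _ => m'[0]? = m'[1]?
      | .cap _ => m[0]? = m[1]?
      | .cross _ _ _ => m' = m.reverse
      | .double _ _ => m' = m.reverse := by
  have key : (y.length = (l ++ m ++ r).length - e.bot.length + e.top.length ∧
      (∀ p < l.length, (l ++ m ++ r)[p]? = y[p]?) ∧
      (∀ p, (l ++ m ++ r)[l.length + e.bot.length + p]? = y[l.length + e.top.length + p]?)) ↔
      ∃ m' : List (Fin N), m'.length = e.top.length ∧ y = l ++ m' ++ r := by
    constructor
    · rintro ⟨h1, h2, h3⟩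
      simp only [List.length_append, hm] at h1
      refine ⟨(y.drop l.length).take e.top.length, by simp; omega, ?_⟩
      have h4 : l = y.take l.length := by
        apply List.ext_getElem?
        intro p
        rw [List.getElem?_take]
        split_ifs with hp
        · rw [← h2 p hp, List.append_assoc, List.getElem?_append_left hp]
        · exact List.getElem?_eq_none (by omega)
      have h5 : r = (y.drop l.length).drop e.top.length := by
        apply List.ext_getElem?
        intro p
        rw [List.drop_drop, List.getElem?_drop, ← h3, ← hm, ← List.length_append,
          List.getElem?_append_right (by omega)]
        simp
      conv_lhs => rw [← List.take_append_drop l.length y, ← h4,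
        ← List.take_append_drop e.top.length (y.drop l.length), ← h5]
      simp
    · rintro ⟨m', h1, rfl⟩
      refine ⟨by simp; omega, fun p hp => ?_, fun p => ?_⟩
      · rw [List.append_assoc, List.append_assoc, List.getElem?_append_left hp,
          List.getElem?_append_left hp]
      · rw [← hm, ← h1, ← List.length_append, ← List.length_append,
          List.getElem?_append_right (by omega), List.getElem?_append_right (by omega)]
        simp
  have g0 : ∀ u : List (Fin N), u.length = 2 → (l ++ u ++ r)[l.length]? = u[0]? := by
    intro u hu
    rw [List.append_assoc, List.getElem?_append_right le_rfl,
      List.getElem?_append_left (by omega), Nat.sub_self]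
  have g1 : ∀ u : List (Fin N), u.length = 2 → (l ++ u ++ r)[l.length + 1]? = u[1]? := by
    intro u hu
    rw [List.append_assoc, List.getElem?_append_right (by omega),
      List.getElem?_append_left (by omega), Nat.add_sub_cancel_left]
  have hrev : ∀ u v : List (Fin N), u.length = 2 → v.length = 2 →
      ((u[0]? = v[1]? ∧ u[1]? = v[0]?) ↔ v = u.reverse) := by
    intro u v hu hv
    obtain ⟨a, b, rfl⟩ := List.length_eq_two.1 hu
    obtain ⟨c, d, rfl⟩ := List.length_eq_two.1 hv
    simp [and_comm, eq_comm]
  have main : ∀ (C : List (Fin N) → Prop) (C' : List (Fin N) → Prop),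
      (∀ m', m'.length = e.top.length → (C (l ++ m' ++ r) ↔ C' m')) →
      ((y.length = (l ++ m ++ r).length - e.bot.length + e.top.length ∧
      (∀ p < l.length, (l ++ m ++ r)[p]? = y[p]?) ∧
      (∀ p, (l ++ m ++ r)[l.length + e.bot.length + p]? = y[l.length + e.top.length + p]?) ∧
      C y) ↔ ∃ m' : List (Fin N), m'.length = e.top.length ∧ y = l ++ m' ++ r ∧ C' m') := by
    intro C C' hC
    constructor
    · rintro ⟨h1, h2, h3, h4⟩
      obtain ⟨m', h5, rfl⟩ := key.1 ⟨h1, h2, h3⟩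
      exact ⟨m', h5, rfl, (hC m' h5).1 h4⟩
    · rintro ⟨m', h5, h6, h7⟩
      obtain ⟨h1, h2, h3⟩ := key.2 ⟨m', h5, h6⟩
      exact ⟨h1, h2, h3, h6 ▸ (hC m' h5).2 h7⟩
  cases e with
  | cup d =>
    exact main (fun y => y[l.length]? = y[l.length + 1]?) (fun m' => m'[0]? = m'[1]?)
      fun m' h => by rw [g0 m' h, g1 m' h]
  | cap d =>
    exact main (fun _ => (l ++ m ++ r)[l.length]? = (l ++ m ++ r)[l.length + 1]?)
      (fun _ => m[0]? = m[1]?) fun m' h => by rw [g0 m hm, g1 m hm]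
  | cross o s t =>
    exact main (fun y => (l ++ m ++ r)[l.length]? = y[l.length + 1]? ∧
      (l ++ m ++ r)[l.length + 1]? = y[l.length]?) (fun m' => m' = m.reverse)
      fun m' h => by rw [g0 m hm, g1 m hm, g0 m' h, g1 m' h, hrev m m' hm h]
  | double s t =>
    exact main (fun y => (l ++ m ++ r)[l.length]? = y[l.length + 1]? ∧
      (l ++ m ++ r)[l.length + 1]? = y[l.length]?) (fun m' => m' = m.reverse)
      fun m' h => by rw [g0 m hm, g1 m hm, g0 m' h, g1 m' h, hrev m m' hm h]

theorem Layer.Step.exists_finset {ℓ : Layer} {a b : List Bool} (h : ℓ.Step a b)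
    {x : List (Fin N)} (hx : x.length = a.length) :
    ∃ T : Finset (List (Fin N)), (∀ y, y ∈ T ↔ ColorStep ℓ x y) ∧
      (∀ y ∈ T, y.length = b.length) ∧ ∀ G, layerOp 1 ℓ G x = ∑ y ∈ T, G y := by
  obtain ⟨i, e⟩ := ℓ
  obtain ⟨l', r', hl, rfl, rfl⟩ := h
  simp only [List.length_append] at hx hl
  obtain ⟨l, m, r, rfl, h1, h2, h3⟩ : ∃ l m r, x = l ++ m ++ r ∧ l.length = l'.length ∧
      m.length = e.bot.length ∧ r.length = r'.length :=
    ⟨x.take i, (x.drop i).take e.bot.length, (x.drop i).drop e.bot.length, by simp,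
      by simp; omega, by simp; omega, by simp; omega⟩
  obtain rfl : l.length = i := h1.trans hl
  have hop : ∀ G, layerOp 1 ⟨l.length, e⟩ G (l ++ m ++ r) =
      pieceOp 1 e (fun y => G (l ++ y)) (m ++ r) := fun G => by
    simp [layerOp]
  simp only [colorStep_append_iff e l m r _ h2, hop]
  have hlen : ∀ m' : List (Fin N), m'.length = e.top.length →
      (l ++ m' ++ r).length = (l' ++ e.top ++ r').length := fun m' h => by
    simp [h, h1, h3]
  cases e with
  | cup d =>
    obtain rfl := List.eq_nil_of_length_eq_zero h2
    refine ⟨Finset.univ.map ⟨fun a => l ++ [a, a] ++ r, fun a b hab => by simpa using hab⟩,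
      fun y => ?_, fun y hy => ?_, fun G => ?_⟩
    · simp only [Finset.mem_map, Finset.mem_univ, true_and]
      constructor
      · rintro ⟨a, rfl⟩
        exact ⟨[a, a], rfl, rfl, rfl⟩
      · rintro ⟨m', hm, rfl, h⟩
        obtain ⟨a, b, rfl⟩ := List.length_eq_two.1 hm
        obtain rfl : a = b := by simpa using h
        exact ⟨a, rfl⟩
    · simp only [Finset.mem_map, Finset.mem_univ, true_and] at hy
      obtain ⟨a, rfl⟩ := hy
      exact hlen _ rfl
    · simp [pieceOp, bendWeight_one]
  | cap d =>
    obtain ⟨a, b, rfl⟩ := List.length_eq_two.1 h2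
    refine ⟨if a = b then {l ++ r} else ∅, fun y => ?_, fun y hy => ?_, fun G => ?_⟩
    · split_ifs with h
      · subst h
        constructor
        · intro hy
          exact ⟨[], rfl, by simpa using hy, rfl⟩
        · rintro ⟨m', hm, rfl, -⟩
          obtain rfl := List.eq_nil_of_length_eq_zero hm
          simp
      · simp [h]
    · split_ifs at hy with h
      · obtain rfl := Finset.mem_singleton.1 hy
        simpa using hlen [] rfl
      · simp at hy
    · split_ifs with h <;> simp [pieceOp, bendWeight_one, h]
  | cross o s t =>
    obtain ⟨a, b, rfl⟩ := List.length_eq_two.1 h2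
    refine ⟨{l ++ [b, a] ++ r}, fun y => ?_, fun y hy => ?_, fun G => ?_⟩
    · simp [Piece.top]
    · obtain rfl := Finset.mem_singleton.1 hy
      exact hlen _ rfl
    · rw [ pieceOp_one_cross]
      simp [pieceOp]
  | double s t =>
    obtain ⟨a, b, rfl⟩ := List.length_eq_two.1 h2
    refine ⟨{l ++ [b, a] ++ r}, fun y => ?_, fun y hy => ?_, fun G => ?_⟩
    · simp [Piece.top]
    · obtain rfl := Finset.mem_singleton.1 hy
      exact hlen _ rfl
    · simp [pieceOp]

/-- The colourings of the horizontal lines of a word with the colours `x` at the bottom. -/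
def Colourings (w : List Layer) (x : List (Fin N)) : Set (ℕ → List (Fin N)) :=
  {φ | φ 0 = x ∧ ∀ n, match w[n]? with
    | some ℓ => ColorStep ℓ (φ n) (φ (n + 1))
    | none => φ (n + 1) = []}

theorem colourings_nil (x : List (Fin N)) :
    Colourings [] x = {fun n => if n = 0 then x else []} := by
  ext φ
  simp only [Colourings, List.getElem?_nil, Set.mem_ofPred_eq, Set.mem_singleton_iff]
  constructor
  · rintro ⟨h0, h⟩
    funext n
    cases n with
    | zero => simpa using h0
    | succ n => simpa using h n
  · rintro rfl
    simp

theorem colourings_cons (ℓ : Layer) (w : List Layer) (x : List (Fin N))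
    {T : Finset (List (Fin N))} (hT : ∀ y, y ∈ T ↔ ColorStep ℓ x y) :
    Colourings (ℓ :: w) x =
      ⋃ y ∈ T, (fun φ n => Nat.casesOn n x fun m => φ m) '' Colourings w y := by
  ext φ
  simp only [Set.mem_iUnion, hT, exists_prop, Set.mem_image]
  constructor
  · rintro ⟨rfl, h⟩
    refine ⟨φ 1, h 0, fun n => φ (n + 1), ⟨rfl, fun n => h (n + 1)⟩, ?_⟩
    funext n
    cases n <;> rfl
  · rintro ⟨y, hy, φ, ⟨rfl, h⟩, rfl⟩
    refine ⟨rfl, fun n => ?_⟩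
    cases n with
    | zero => exact hy
    | succ n => exact h n

theorem Runs.ncard_colourings {w : List Layer} {a b : List Bool} (h : Runs w a b)
    {x : List (Fin N)} (hx : x.length = a.length) :
    (Colourings w x).Finite ∧ ((Colourings w x).ncard : ℝ) = wordOp 1 w (fun _ => 1) x := by
  induction w generalizing a x with
  | nil => simp [colourings_nil]
  | cons ℓ w ih =>
    obtain ⟨c, h1, h2⟩ := h
    obtain ⟨T, hT, hl, hs⟩ := h1.exists_finset hx
    have inj : Function.Injective
        (fun (φ : ℕ → List (Fin N)) n => (Nat.casesOn n x fun m => φ m : List (Fin N))) := by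
      intro φ ψ h
      funext n
      exact congrFun h (n + 1)
    have fin : ∀ y ∈ T, ((fun (φ : ℕ → List (Fin N)) n =>
        (Nat.casesOn n x fun m => φ m : List (Fin N))) '' Colourings w y).Finite :=
      fun y hy => (ih h2 (hl y hy)).1.image _
    rw [colourings_cons ℓ w x hT, wordOp_cons, hs]
    refine ⟨T.finite_toSet.biUnion fin, ?_⟩
    have hdisj : (T : Set (List (Fin N))).PairwiseDisjoint
        fun y => (fun (φ : ℕ → List (Fin N)) n =>
          (Nat.casesOn n x fun m => φ m : List (Fin N))) '' Colourings w y := by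
      intro y _ y' _ hyy
      refine Set.disjoint_left.2 ?_
      rintro _ ⟨φ, hφ, rfl⟩ ⟨ψ, hψ, hh⟩
      obtain rfl := inj hh
      exact hyy (hφ.1.symm.trans hψ.1)
    have hcard := T.finite_toSet.ncard_biUnion fin hdisj
    rw [finsum_mem_coe_finset] at hcard
    simp only [Finset.mem_coe] at hcard
    rw [hcard]
    push_cast
    refine Finset.sum_congr rfl fun y hy => ?_
    rw [Set.ncard_image_of_injective _ inj, (ih h2 (hl y hy)).2]

theorem width_succ {w : List Layer} {n : ℕ} {ℓ : Layer} (h : w[n]? = some ℓ) :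
    width w (n + 1) = width w n - ℓ.piece.bot.length + ℓ.piece.top.length := by
  simp [width, List.take_add_one, h]

theorem Runs.foldl_width {w : List Layer} {a b : List Bool} (h : Runs w a b) :
    w.foldl (fun c ℓ => c - ℓ.piece.bot.length + ℓ.piece.top.length) a.length = b.length := by
  induction w generalizing a with
  | nil => exact congrArg _ h
  | cons ℓ w ih =>
    obtain ⟨c, ⟨l, r, -, rfl, rfl⟩, h2⟩ := h
    rw [← ih h2, List.foldl_cons]
    congr 1
    simp; omega

theorem Runs.le_width {w : List Layer} {b : List Bool} (h : Runs w [] b) {n : ℕ} {ℓ : Layer}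
    (hn : w[n]? = some ℓ) : ℓ.pos + ℓ.piece.bot.length ≤ width w n := by
  obtain ⟨hlt, rfl⟩ := List.getElem?_eq_some_iff.1 hn
  have e : w = w.take n ++ w[n] :: w.drop (n + 1) := by simp
  rw [e] at h
  obtain ⟨c, h1, d, ⟨l, r, hl, rfl, -⟩, -⟩ := Runs_append.1 h
  have := h1.foldl_width
  rw [width]
  simp only [List.length_nil] at this
  rw [this]
  simp; omega

theorem Runs.width_eq_zero {w : List Layer} (h : Runs w [] []) {n : ℕ} (hn : w.length ≤ n) :
    width w n = 0 := by
  rw [width, List.take_of_length_le hn]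
  exact h.foldl_width

theorem SingularDiagram.finite_point (D : SingularDiagram) : Finite D.Point := by
  have hf : {x : ℕ × ℕ | x.2 < width D.word x.1}.Finite := by
    refine ((Finset.range D.word.length).finite_toSet.biUnion (t := fun n =>
      (fun p => (n, p)) '' Set.Iio (width D.word n))
      fun n _ => (Set.finite_Iio _).image _).subset ?_
    rintro ⟨n, p⟩ hx
    simp only [Set.mem_iUnion, Finset.coe_range, Set.mem_Iio, exists_prop]
    refine ⟨n, ?_, p, hx, rfl⟩
    by_contra! hn
    have hx' : p < width D.word n := hx
    rw [D.closed.width_eq_zero hn] at hx'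
    omega
  exact hf.to_subtype

theorem SingularDiagram.exists_point (D : SingularDiagram) : Nonempty D.Point := by
  obtain ⟨w, hw, hne⟩ := D
  cases w with
  | nil => exact absurd rfl hne
  | cons ℓ w =>
    obtain ⟨c, ⟨l, r, -, h, -⟩, -⟩ := hw
    refine ⟨⟨(1, 0), ?_⟩⟩
    obtain ⟨i, e⟩ := ℓ
    cases e <;> simp [Piece.bot] at h
    simp [width, Piece.bot, Piece.top]

theorem SingularDiagram.one_le_numComponents (D : SingularDiagram) : 1 ≤ D.numComponents := by
  have := D.finite_point
  have := D.exists_point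
  have : Nonempty (Quot fun x y : D.Point => Joined D.word x.1 y.1) :=
    this.map fun x => Quot.mk _ x
  exact Nat.card_pos

theorem SingularDiagram.card_colourings (D : SingularDiagram) :
    (Colourings (N := N) D.word []).ncard = N ^ D.numComponents := by
  have := D.finite_point
  have h0 : (Colourings (N := N) D.word []).ncard =
      Nat.card (Colourings (N := N) D.word []) := rfl
  have h1 : N ^ D.numComponents =
      Nat.card ((Quot fun x y : D.Point => Joined D.word x.1 y.1) → Fin N) := by
    rw [Nat.card_fun, Nat.card_fin]; rfl
  rw [h0, h1]
  symm
  let Φ : ((Quot fun x y : D.Point => Joined D.word x.1 y.1) → Fin N) → ℕ → List (Fin N) :=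
    fun g n => List.ofFn fun p : Fin (width D.word n) => g (Quot.mk _ ⟨(n, p), p.2⟩)
  have hΦ : ∀ g n p, (h : p < width D.word n) → (Φ g n)[p]? = some (g (Quot.mk _ ⟨(n, p), h⟩)) :=
    fun g n p h => by simp [Φ, h]
  have hΦ' : ∀ g n p, ¬ p < width D.word n → (Φ g n)[p]? = none :=
    fun g n p h => by simp only [Φ, List.getElem?_ofFn, h, dif_neg, not_false_iff]
  have hjoin : ∀ g n p n' p', Joined D.word (n, p) (n', p') →
      (p < width D.word n ↔ p' < width D.word n') → (Φ g n)[p]? = (Φ g n')[p']? := by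
    intro g n p n' p' hj hiff
    by_cases h : p < width D.word n
    · rw [hΦ g n p h, hΦ g n' p' (hiff.1 h)]
      exact congrArg (fun u => some (g u)) (Quot.sound hj)
    · rw [hΦ' g n p h, hΦ' g n' p' (fun h' => h (hiff.2 h'))]
  have hmem : ∀ g, Φ g ∈ Colourings (N := N) D.word [] := by
    intro g
    refine ⟨by simp [Φ, width], fun n => ?_⟩
    split
    · next ℓ hn =>
      have hw := width_succ hn
      have hle := D.closed.le_width hn
      obtain ⟨i, e⟩ := ℓ
      simp only at hw hle
      refine ⟨by simp [Φ, hw], fun p hp => ?_, fun p => ?_, ?_⟩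
      · exact hjoin g _ _ _ _ (.left hn hp) (by simp only at hp; omega)
      · exact hjoin g _ _ _ _ (.right hn) (by dsimp only; omega)
      · cases e with
        | cup d => exact hjoin g _ _ _ _ (.cup hn) (by simp [Piece.bot, Piece.top] at hw hle ⊢; omega)
        | cap d => exact hjoin g _ _ _ _ (.cap hn) (by simp [Piece.bot, Piece.top] at hw hle ⊢; omega)
        | cross o s t =>
          exact ⟨hjoin g _ _ _ _ (.crossRising hn)
              (by simp [Piece.bot, Piece.top] at hw hle ⊢; omega),
            hjoin g _ _ _ _ (.crossFalling hn) (by simp [Piece.bot, Piece.top] at hw hle ⊢; omega)⟩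
        | double s t =>
          exact ⟨hjoin g _ _ _ _ (.doubleRising hn)
              (by simp [Piece.bot, Piece.top] at hw hle ⊢; omega),
            hjoin g _ _ _ _ (.doubleFalling hn) (by simp [Piece.bot, Piece.top] at hw hle ⊢; omega)⟩
    · next hn =>
      have : width D.word (n + 1) = 0 :=
        D.closed.width_eq_zero (by have := List.getElem?_eq_none_iff.1 hn; omega)
      apply List.eq_nil_of_length_eq_zero
      simp [Φ, this]
  refine Nat.card_congr (Equiv.ofBijective (fun g => ⟨Φ g, hmem g⟩) ⟨fun g g' hgg => ?_, ?_⟩)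
  · have hgg' : Φ g = Φ g' := congrArg Subtype.val hgg
    funext u
    induction u using Quot.ind with
    | mk x =>
      obtain ⟨⟨n, p⟩, hx⟩ := x
      have := hΦ g n p hx
      rw [hgg', hΦ g' n p hx] at this
      exact (Option.some_injective _ this).symm
  · rintro ⟨φ, hφ0, hφ⟩
    have hlen : ∀ n, (φ n).length = width D.word n := by
      intro n
      induction n with
      | zero => simp [hφ0, width]
      | succ n ih =>
        have := hφ n
        rcases hn : D.word[n]? with _ | ℓ
        · rw [hn] at this
          rw [show φ (n + 1) = [] from this, D.closed.width_eq_zero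
            (by have := List.getElem?_eq_none_iff.1 hn; omega)]
          rfl
        · rw [hn] at this
          rw [width_succ hn, ← ih]
          exact this.1
    have hstep : ∀ n ℓ, D.word[n]? = some ℓ → ColorStep ℓ (φ n) (φ (n + 1)) := by
      intro n ℓ hn
      have := hφ n
      rw [hn] at this
      exact this
    have hφj : ∀ x y, Joined D.word x y → (φ x.1)[x.2]? = (φ y.1)[y.2]? := by
      intro x y hxy
      cases hxy with
      | left hn hp => exact (hstep _ _ hn).2.1 _ hp
      | right hn => exact (hstep _ _ hn).2.2.1 _
      | cup hn => exact (hstep _ _ hn).2.2.2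
      | cap hn => exact (hstep _ _ hn).2.2.2
      | crossRising hn => exact (hstep _ _ hn).2.2.2.1
      | crossFalling hn => exact (hstep _ _ hn).2.2.2.2
      | doubleRising hn => exact (hstep _ _ hn).2.2.2.1
      | doubleFalling hn => exact (hstep _ _ hn).2.2.2.2
    let g : (Quot fun x y : D.Point => Joined D.word x.1 y.1) → Fin N :=
      Quot.lift (fun x => (φ x.1.1)[x.1.2]'(by rw [hlen]; exact x.2)) fun x y hxy => by
        have := hφj _ _ hxy
        rw [List.getElem?_eq_getElem (by rw [hlen]; exact x.2),
          List.getElem?_eq_getElem (by rw [hlen]; exact y.2)] at this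
        exact Option.some_injective _ this
    refine ⟨g, Subtype.ext (funext fun n => List.ext_getElem (by simp [Φ, hlen]) ?_)⟩
    intro p h1 h2
    simp [Φ, g]

theorem SingularDiagram.stateSum_one (D : SingularDiagram) :
    stateSum N 1 D.word = (N : ℝ) ^ D.numComponents := by
  have h := (D.closed.ncard_colourings (N := N) (x := []) rfl).2
  rw [D.card_colourings] at h
  rw [stateSum, ← h]
  push_cast
  rfl

theorem SingularDiagram.numComponents_eq_of_stateSum {D E : SingularDiagram}
    (h : stateSum 2 1 D.word = stateSum 2 1 E.word) : D.numComponents = E.numComponents := by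
  rw [D.stateSum_one, E.stateSum_one] at h
  exact Nat.pow_right_injective le_rfl (by exact_mod_cast h)

theorem layerOp_one_cross (i : ℕ) (o s t : Bool) (G : List (Fin N) → ℝ) :
    layerOp 1 ⟨i, .cross o s t⟩ G = layerOp 1 ⟨i, .double s t⟩ G := by
  funext x
  simp only [layerOp, pieceOp_one_cross]

theorem VassilievTriple.numComponents_eq {D Dp Dm : SingularDiagram}
    (h : VassilievTriple D Dp Dm) :
    Dp.numComponents = D.numComponents ∧ Dm.numComponents = D.numComponents := by
  obtain ⟨x, y, i, s, t, h1, h2, h3⟩ := h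
  constructor <;> apply SingularDiagram.numComponents_eq_of_stateSum <;>
    simp [h1, h2, h3, stateSum, wordOp_append, posCross, negCross, layerOp_one_cross]

/-- The number of components of a link. -/
noncomputable def OrientedLink.components : OrientedLink → ℕ :=
  Quot.lift (fun D => D.1.numComponents) fun _ _ h =>
    SingularDiagram.numComponents_eq_of_stateSum (Move.stateSum_eq one_ne_zero h)

theorem SingularDiagram.Represents.components {D : SingularDiagram} {L : OrientedLink}
    (h : D.Represents L) : L.components = D.numComponents := by
  obtain ⟨_, rfl⟩ := h
  rfl

theorem OrientedLink.hasComponents_iff {L : OrientedLink} {μ : ℕ} :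
    L.HasComponents μ ↔ L.components = μ := by
  constructor
  · rintro ⟨D, h, rfl⟩
    exact h.components
  · rintro rfl
    induction L using Quot.ind with
    | mk D => exact ⟨D.1, ⟨D.2, rfl⟩, rfl⟩

theorem OrientedLink.one_le_components (L : OrientedLink) : 1 ≤ L.components := by
  induction L using Quot.ind with
  | mk D => exact D.1.one_le_numComponents

end Colouring

end OrientedLinks

namespace OrientedLinks

/-! ### The HOMFLYPT polynomial -/

theorem monomial_mul (k j k' j' : ℤ) :
    monomial k j * monomial k' j' = monomial (k + k') (j + j') := by
  simp [monomial, AddMonoidAlgebra.single_mul_single]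

theorem monomial_zero : monomial 0 0 = 1 := rfl

theorem monomial_mul_cancel (k j : ℤ) (F : Laurent) :
    monomial (-k) (-j) * (monomial k j * F) = F := by
  rw [← mul_assoc, monomial_mul, neg_add_cancel, neg_add_cancel, monomial_zero, one_mul]

theorem Laurent.eq_sum (F : Laurent) :
    F = ∑ m ∈ F.coeff.support, F.coeff m • monomial m.1 m.2 := by
  conv_lhs => rw [← AddMonoidAlgebra.sum_coeff_single F, Finsupp.sum]
  refine Finset.sum_congr rfl fun m _ => ?_
  rw [monomial, AddMonoidAlgebra.smul_single, smul_eq_mul, mul_one]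

/-- The evaluation of Laurent polynomials at units. -/
noncomputable def evalHom (v z : ℝˣ) : Laurent →ₐ[ℤ] ℝ :=
  AddMonoidAlgebra.lift ℤ ℝ (ℤ × ℤ)
    { toFun := fun m => (v : ℝ) ^ m.toAdd.1 * (z : ℝ) ^ m.toAdd.2
      map_one' := by simp
      map_mul' := fun m m' => by
        simp only [toAdd_mul, Prod.fst_add, Prod.snd_add, zpow_add₀ v.ne_zero, zpow_add₀ z.ne_zero]
        ring }

@[simp] theorem evalHom_monomial (v z : ℝˣ) (k j : ℤ) :
    evalHom v z (monomial k j) = (v : ℝ) ^ k * (z : ℝ) ^ j := by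
  simp [evalHom, monomial, AddMonoidAlgebra.lift_single]

theorem evalHom_eq_sum (v z : ℝˣ) (F : Laurent) :
    evalHom v z F = ∑ m ∈ F.coeff.support, (F.coeff m : ℝ) * ((v : ℝ) ^ m.1 * (z : ℝ) ^ m.2) := by
  conv_lhs => rw [Laurent.eq_sum F, map_sum]
  refine Finset.sum_congr rfl fun m _ => ?_
  rw [map_zsmul, evalHom_monomial, zsmul_eq_mul]

theorem eq_zero_of_infinite_zpow_sum_eq_zero {S : Finset ℤ} {c : ℤ → ℝ} {X : Set ℝ}
    (hX : X.Infinite) (h0 : ∀ x ∈ X, x ≠ 0) (h : ∀ x ∈ X, ∑ k ∈ S, c k * x ^ k = 0) {k : ℤ}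
    (hk : k ∈ S) : c k = 0 := by
  obtain ⟨M, hM⟩ : ∃ M : ℕ, ∀ k ∈ S, 0 ≤ k + M := by
    refine ⟨∑ k ∈ S, k.natAbs, fun k hk => ?_⟩
    have := Finset.single_le_sum (f := fun k : ℤ => k.natAbs) (fun _ _ => Nat.zero_le _) hk
    have h0 : -(k.natAbs : ℤ) ≤ k := by omega
    have h1 : (k.natAbs : ℤ) ≤ (∑ k ∈ S, k.natAbs : ℕ) := by exact_mod_cast this
    linarith
  let p : Polynomial ℝ := ∑ k ∈ S, Polynomial.monomial (k + M).toNat (c k)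
  have hp : p = 0 := by
    refine Polynomial.eq_zero_of_infinite_isRoot p (hX.mono fun x hx => ?_)
    have : p.eval x = x ^ M * ∑ k ∈ S, c k * x ^ k := by
      simp only [p, Polynomial.eval_finsetSum, Polynomial.eval_monomial, Finset.mul_sum]
      refine Finset.sum_congr rfl fun k hk => ?_
      rw [← zpow_natCast x (k + M).toNat, Int.toNat_of_nonneg (hM k hk), zpow_add₀ (h0 x hx),
        zpow_natCast]
      ring
    change p.eval x = 0
    rw [this, h x hx, mul_zero]
  have hc := congrArg (fun p => Polynomial.coeff p (k + M).toNat) hp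
  simp only [p, Polynomial.finsetSum_coeff, Polynomial.coeff_monomial, Polynomial.coeff_zero] at hc
  rw [Finset.sum_eq_single_of_mem k hk fun k' hk' hne => if_neg fun e => hne (by
    have := hM k hk; have := hM k' hk'; omega), if_pos rfl] at hc
  exact hc

theorem Laurent.eq_zero_of_evalHom {F : Laurent} {Z : Set ℝˣ} (hZ : Z.Infinite)
    (h : ∀ z ∈ Z, ∃ X : Set ℝˣ, X.Infinite ∧ ∀ v ∈ X, evalHom v z F = 0) : F = 0 := by
  have hinf : ∀ {Y : Set ℝˣ}, Y.Infinite → (((↑) : ℝˣ → ℝ) '' Y).Infinite :=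
    fun hY => hY.image Units.val_injective.injOn
  have h1 : ∀ z ∈ Z, ∀ k ∈ F.coeff.support.image Prod.fst,
      ∑ j ∈ F.coeff.support.image Prod.snd, (F.coeff (k, j) : ℝ) * (z : ℝ) ^ j = 0 := by
    intro z hz k hk
    obtain ⟨X, hX, hX0⟩ := h z hz
    refine eq_zero_of_infinite_zpow_sum_eq_zero (S := F.coeff.support.image Prod.fst)
      (c := fun k => ∑ j ∈ F.coeff.support.image Prod.snd, (F.coeff (k, j) : ℝ) * (z : ℝ) ^ j)
      (hinf hX) ?_ ?_ hk
    · rintro _ ⟨v, -, rfl⟩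
      exact v.ne_zero
    · rintro _ ⟨v, hv, rfl⟩
      rw [← hX0 v hv, evalHom_eq_sum]
      simp only [Finset.sum_mul]
      rw [← Finset.sum_product']
      symm
      refine Finset.sum_subset_zero_on_sdiff Finset.subset_product (fun m hm => ?_) fun m _ => ?_
      · have : F.coeff m = 0 := by simpa using (Finset.mem_sdiff.1 hm).2
        simp [this]
      · ring
  refine AddMonoidAlgebra.ext (Finsupp.ext fun m => ?_)
  by_contra hm
  have hm' : m ∈ F.coeff.support := Finsupp.mem_support_iff.2 hm
  have h2 := eq_zero_of_infinite_zpow_sum_eq_zero (S := F.coeff.support.image Prod.snd)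
    (c := fun j => (F.coeff (m.1, j) : ℝ)) (hinf hZ)
    (by rintro _ ⟨z, -, rfl⟩; exact z.ne_zero)
    (by rintro _ ⟨z, hz, rfl⟩; exact h1 z hz m.1 (Finset.mem_image_of_mem _ hm'))
    (Finset.mem_image_of_mem _ hm')
  exact hm (by exact_mod_cast h2)

/-- The parameters of a state sum: the deformation parameter and the number of colours. -/
structure StateSumParameter where
  q : ℝ
  one_lt : 1 < q
  N : ℕ
  pos : 0 < N

namespace StateSumParameter

variable (p : StateSumParameter)

theorem q_pos : 0 < p.q := one_pos.trans p.one_lt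

theorem sub_inv_pos : 0 < p.q - p.q⁻¹ := sub_pos.2 ((inv_lt_one_of_one_lt₀ p.one_lt).trans p.one_lt)

/-- The value of `v`. -/
noncomputable def v : ℝˣ := (Units.mk0 (p.q ^ p.N) (pow_pos p.q_pos _).ne')⁻¹

/-- The value of `z`. -/
noncomputable def z : ℝˣ := Units.mk0 _ p.sub_inv_pos.ne'

theorem v_inv_coe : (p.v : ℝ)⁻¹ = p.q ^ p.N := by simp [v]

theorem v_coe : (p.v : ℝ) = (p.q ^ p.N)⁻¹ := by rw [← v_inv_coe, inv_inv]

theorem z_coe : (p.z : ℝ) = p.q - p.q⁻¹ := rfl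

theorem eq_of_evalHom {F G : Laurent}
    (h : ∀ p : StateSumParameter, evalHom p.v p.z F = evalHom p.v p.z G) : F = G := by
  rw [← sub_eq_zero]
  let Z : Set ℝˣ := Set.range fun q : Set.Ioi (1 : ℝ) => (⟨q.1, q.2, 1, one_pos⟩ : StateSumParameter).z
  refine Laurent.eq_zero_of_evalHom (Z := Z) ?_ ?_
  · have : Infinite (Set.Ioi (1 : ℝ)) := (Set.Ioi_infinite 1).to_subtype
    refine Set.infinite_range_of_injective fun q q' hq => Subtype.ext ?_
    have e : (q.1 : ℝ) - q.1⁻¹ = q'.1 - q'.1⁻¹ := congrArg Units.val hq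
    have h1 : (1 : ℝ) < q.1 := q.2
    have h2 : (1 : ℝ) < q'.1 := q'.2
    by_contra hne
    rcases lt_or_gt_of_ne hne with hlt | hlt
    · have := (inv_lt_inv₀ (by linarith) (by linarith)).2 hlt
      linarith
    · have := (inv_lt_inv₀ (by linarith) (by linarith)).2 hlt
      linarith
  · rintro _ ⟨q, rfl⟩
    have hq : (1 : ℝ) < q.1 := q.2
    refine ⟨Set.range fun N : ℕ => (⟨q.1, q.2, N + 1, N.succ_pos⟩ : StateSumParameter).v, ?_, ?_⟩
    · refine Set.infinite_range_of_injective fun N N' hN => ?_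
      have e := congrArg (fun u : ℝˣ => (u : ℝ)) hN
      simp only [v_coe, inv_inj] at e
      have := pow_right_injective₀ (by linarith) hq.ne' e
      omega
    · rintro _ ⟨N, rfl⟩
      rw [map_sub, sub_eq_zero]
      exact h ⟨q.1, q.2, N + 1, N.succ_pos⟩

/-- The state sum of a link. -/
noncomputable def linkSum : OrientedLink → ℝ :=
  Quot.lift (fun D => stateSum p.N p.q D.1.word) fun _ _ h => Move.stateSum_eq p.q_pos.ne' h

theorem linkSum_eq {D : SingularDiagram} {L : OrientedLink} (h : D.Represents L) :
    p.linkSum L = stateSum p.N p.q D.word := by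
  obtain ⟨_, rfl⟩ := h
  rfl

theorem linkSum_skein {Lp Lm Lo : OrientedLink} (h : SkeinTriple Lp Lm Lo) :
    (p.v : ℝ)⁻¹ * p.linkSum Lp - p.v * p.linkSum Lm = p.z * p.linkSum Lo := by
  obtain ⟨Dp, Dm, Do, hp, hm, ho, x, y, i, s, t, ep, em, eo⟩ := h
  rw [p.linkSum_eq hp, p.linkSum_eq hm, p.linkSum_eq ho, ep, em, eo, v_inv_coe, v_coe, z_coe]
  exact stateSum_skein p.q_pos.ne' (ep ▸ Dp.closed)

theorem circleWeight_pos : 0 < circleWeight p.N p.q := OrientedLinks.circleWeight_pos p.q_pos p.pos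

end StateSumParameter

/-- The factor by which the HOMFLYPT polynomial changes when a distant unknot is added. -/
noncomputable def circleFactor : Laurent := monomial (-1) (-1) - monomial 1 (-1)

theorem evalHom_circleFactor (p : StateSumParameter) :
    evalHom p.v p.z circleFactor = circleWeight p.N p.q := by
  have h := circleWeight_mul (N := p.N) p.q_pos.ne'
  rw [← p.v_coe, ← p.v_inv_coe, ← p.z_coe] at h
  have hz := p.z.ne_zero
  simp only [circleFactor, map_sub, evalHom_monomial, zpow_neg, zpow_one]
  field_simp
  field_simp at h
  linarith

theorem exists_evalHom_eq_linkSum (L : OrientedLink) : ∃ F : Laurent, ∀ p : StateSumParameter,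
    evalHom p.v p.z F * circleWeight p.N p.q = p.linkSum L := by
  induction L using skein_induction with
  | hcirc n h =>
    refine ⟨circleFactor ^ n, fun p => ?_⟩
    rw [map_pow, evalHom_circleFactor, p.linkSum_eq h.represents, ← pow_succ]
    exact (stateSum_circles _ _).symm
  | hskein Lp Lm Lo h ho =>
    obtain ⟨Fo, ho⟩ := ho
    constructor
    · rintro ⟨Fp, hp⟩
      refine ⟨monomial (-2) 0 * Fp - monomial (-1) 1 * Fo, fun p => ?_⟩
      have := p.linkSum_skein h
      have hv := inv_mul_cancel₀ p.v.ne_zero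
      rw [← hp, ← ho] at this
      simp only [map_sub, map_mul, evalHom_monomial, zpow_neg, zpow_ofNat]
      linear_combination (p.v : ℝ)⁻¹ * this + p.linkSum Lm * hv
    · rintro ⟨Fm, hm⟩
      refine ⟨monomial 2 0 * Fm + monomial 1 1 * Fo, fun p => ?_⟩
      have := p.linkSum_skein h
      have hv := inv_mul_cancel₀ p.v.ne_zero
      rw [← hm, ← ho] at this
      simp only [map_add, map_mul, evalHom_monomial, zpow_ofNat]
      linear_combination -(p.v : ℝ) * this + p.linkSum Lp * hv

/-- The HOMFLYPT polynomial. -/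
noncomputable def homflypt (L : OrientedLink) : Laurent := (exists_evalHom_eq_linkSum L).choose

theorem evalHom_homflypt (L : OrientedLink) (p : StateSumParameter) :
    evalHom p.v p.z (homflypt L) * circleWeight p.N p.q = p.linkSum L :=
  (exists_evalHom_eq_linkSum L).choose_spec p

theorem isHOMFLYPT_homflypt : IsHOMFLYPT homflypt where
  skein Lp Lm Lo h := by
    refine StateSumParameter.eq_of_evalHom fun p => ?_
    refine mul_right_cancel₀ p.circleWeight_pos.ne' ?_
    have := p.linkSum_skein h
    simp only [← evalHom_homflypt] at this
    simp only [map_sub, map_mul, evalHom_monomial, zpow_neg, zpow_one, zpow_zero, mul_one, one_mul]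
    linear_combination this
  unknot L h := by
    refine StateSumParameter.eq_of_evalHom fun p => ?_
    refine mul_right_cancel₀ p.circleWeight_pos.ne' ?_
    rw [evalHom_homflypt, p.linkSum_eq h, map_one, one_mul]
    exact (stateSum_circles p.q 1).trans (pow_one _)

theorem IsLinkWord.link_congr {w w' : List Layer} (e : w = w') (h : IsLinkWord w)
    (h' : IsLinkWord w') : h.link = h'.link := by
  subst e
  rfl

theorem isLinkWord_circles (n : ℕ) : IsLinkWord (circles (n + 1)) where
  closed := by
    induction n with
    | zero => exact unknotDiagram.closed
    | succ n ih => rw [circles_succ]; exact Runs_append.2 ⟨_, ih, unknotDiagram.closed⟩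
  ne_nil := by simp [circles_succ]
  noDouble := by
    induction n with
    | zero => rfl
    | succ n ih => rw [circles_succ, List.countP_append, ih]; rfl

theorem isLinkWord_curl (n : ℕ) (o : Bool) :
    IsLinkWord ((circles n ++ [⟨0, .cup true⟩]) ++ [⟨0, .cross o true false⟩] ++
      [⟨0, .cap false⟩]) where
  closed := by
    have h : Runs (circles n) [] [] := by
      cases n with
      | zero => rfl
      | succ n => exact (isLinkWord_circles n).closed
    simp only [List.append_assoc]
    exact Runs_append.2 ⟨_, h, _, ⟨[], [], rfl, rfl, rfl⟩, _, ⟨[], [], rfl, rfl, rfl⟩, _,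
      ⟨[], [], rfl, rfl, rfl⟩, rfl⟩
  ne_nil := by simp
  noDouble := by
    cases n with
    | zero => rfl
    | succ n => simp [(isLinkWord_circles n).noDouble, Layer.isDouble]

theorem link_curl (n : ℕ) (o : Bool) :
    (isLinkWord_curl n o).link = (isLinkWord_circles n).link := by
  have e : (circles n ++ [⟨0, .cup true⟩]) ++ [⟨0, .cross o true false⟩] ++ [⟨0, .cap false⟩] =
      (circles n ++ [⟨0, .cup true⟩]) ++ shift 0 [⟨0, .cross o true false⟩, ⟨0, .cap false⟩] ++
      [] := by simp
  have h := isLinkWord_curl n o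
  rw [e] at h
  obtain ⟨h', hh⟩ := IsLinkWord.rule (.basic (.capCurl o true)) h
  exact (IsLinkWord.link_congr e _ h).trans
    (hh.symm.trans (IsLinkWord.link_congr (by simp [circles_succ]) _ _))

theorem isLinkWord_smooth_curl (n : ℕ) : IsLinkWord ((circles n ++ [⟨0, .cup true⟩]) ++
    smoothing 0 true false ++ [⟨0, .cap false⟩]) :=
  (isLinkWord_curl n true).smooth

theorem link_smooth_curl (n : ℕ) :
    (isLinkWord_smooth_curl n).link = (isLinkWord_circles (n + 1)).link := by
  have e : (circles (n + 1) ++ [⟨0, .cup true⟩]) ++ [⟨0, .cross true true false⟩] ++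
      [⟨0, .cap false⟩] = circles (n + 1) ++ shift 0 [⟨0, .cup true⟩, ⟨0, .cross true true false⟩] ++
      [⟨0, .cap false⟩] := by simp
  have h := isLinkWord_curl (n + 1) true
  rw [e] at h
  obtain ⟨h', hh⟩ := IsLinkWord.rule (.basic (.cupCurl true true)) h
  exact (IsLinkWord.link_congr (by simp [circles_succ, smoothing]) _ _).trans
    (hh.trans ((IsLinkWord.link_congr e _ h).symm.trans (link_curl (n + 1) true)))

theorem skeinTriple_circles (n : ℕ) : SkeinTriple (isLinkWord_circles n).link
    (isLinkWord_circles n).link (isLinkWord_circles (n + 1)).link := by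
  have h : SkeinTriple (isLinkWord_curl n false).link (isLinkWord_curl n true).link
      (isLinkWord_smooth_curl n).link :=
    skeinTriple_of_words (s := true) (t := false) _ _ _
  rwa [link_curl, link_curl, link_smooth_curl] at h

theorem IsHOMFLYPT.circles {P : OrientedLink → Laurent} (hP : IsHOMFLYPT P) (n : ℕ) :
    P (isLinkWord_circles n).link = circleFactor ^ n := by
  induction n with
  | zero => exact hP.unknot _ (isLinkWord_circles 0).represents
  | succ n ih =>
    have h := hP.skein _ _ _ (skeinTriple_circles n)
    rw [ih, ← sub_mul] at h
    have := congrArg (monomial (-0) (-1) * ·) h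
    simp only [monomial_mul_cancel, mul_sub, sub_mul] at this
    rw [← this, pow_succ', circleFactor, sub_mul]
    simp only [← mul_assoc, monomial_mul, neg_zero, zero_add, add_zero]

theorem IsHOMFLYPT.unique {P Q : OrientedLink → Laurent} (hP : IsHOMFLYPT P) (hQ : IsHOMFLYPT Q) :
    Q = P := by
  funext L
  induction L using skein_induction with
  | hcirc n h => exact (hQ.circles n).trans (hP.circles n).symm
  | hskein Lp Lm Lo h ho =>
    have h1 := hP.skein _ _ _ h
    have h2 := hQ.skein _ _ _ h
    rw [ho, ← h1] at h2
    constructor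
    · intro hp
      rw [hp, sub_right_inj] at h2
      rw [← monomial_mul_cancel 1 0 (Q Lm), h2, monomial_mul_cancel]
    · intro hm
      rw [hm, sub_left_inj] at h2
      rw [← monomial_mul_cancel (-1) 0 (Q Lp), h2, monomial_mul_cancel]

end OrientedLinks

namespace OrientedLinks

/-! ### The Vassiliev extension -/

section Resolve

variable {A : Type*} [AddCommGroup A]

/-- The alternating sum of the values of `g` over all ways to replace the singular crossings of a
word by positive and negative ones. -/
def resolve (g : List Layer → A) : List Layer → A
  | [] => g []
  | ⟨i, .double s t⟩ :: w =>
    resolve (fun u => g (posCross i s t :: u)) w - resolve (fun u => g (negCross i s t :: u)) w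
  | ⟨i, .cup d⟩ :: w => resolve (fun u => g (⟨i, .cup d⟩ :: u)) w
  | ⟨i, .cap d⟩ :: w => resolve (fun u => g (⟨i, .cap d⟩ :: u)) w
  | ⟨i, .cross o s t⟩ :: w => resolve (fun u => g (⟨i, .cross o s t⟩ :: u)) w

theorem resolve_of_not_isDouble (g : List Layer → A) {ℓ : Layer} (h : ℓ.isDouble = false)
    (w : List Layer) : resolve g (ℓ :: w) = resolve (fun u => g (ℓ :: u)) w := by
  obtain ⟨i, e⟩ := ℓ
  cases e with
  | double s t => simp [Layer.isDouble] at h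
  | _ => rfl

theorem resolve_append (g : List Layer → A) (x y : List Layer) :
    resolve g (x ++ y) = resolve (fun u => resolve (fun u' => g (u ++ u')) y) x := by
  induction x generalizing g with
  | nil => rfl
  | cons ℓ x ih =>
    obtain ⟨i, e⟩ := ℓ
    cases e <;> simp only [List.cons_append, resolve, ih]

theorem resolve_sub (g g' : List Layer → A) (w : List Layer) :
    resolve (fun u => g u - g' u) w = resolve g w - resolve g' w := by
  induction w generalizing g g' with
  | nil => rfl
  | cons ℓ w ih =>
    obtain ⟨i, e⟩ := ℓ
    cases e with
    | double s t => simp only [resolve, ih]; abel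
    | _ => exact ih _ _

theorem resolve_mul {R : Type*} [Ring R] (c : R) (g : List Layer → R) (w : List Layer) :
    resolve (fun u => c * g u) w = c * resolve g w := by
  induction w generalizing g with
  | nil => rfl
  | cons ℓ w ih =>
    obtain ⟨i, e⟩ := ℓ
    cases e with
    | double s t => simp only [resolve, ih, mul_sub]
    | _ => exact ih _

/-- The layer `m` is not singular and has the same ends as `ℓ`. -/
def Layer.ResolvesTo (ℓ m : Layer) : Prop :=
  m.pos = ℓ.pos ∧ m.piece.bot = ℓ.piece.bot ∧ m.piece.top = ℓ.piece.top ∧ m.isDouble = false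

theorem Layer.resolvesTo_self {ℓ : Layer} (h : ℓ.isDouble = false) : ℓ.ResolvesTo ℓ :=
  ⟨rfl, rfl, rfl, h⟩

theorem resolve_congr {g g' : List Layer → A} {w : List Layer}
    (h : ∀ u, List.Forall₂ Layer.ResolvesTo w u → g u = g' u) : resolve g w = resolve g' w := by
  induction w generalizing g g' with
  | nil => exact h _ .nil
  | cons ℓ w ih =>
    obtain ⟨i, e⟩ := ℓ
    cases e with
    | double s t =>
      exact congrArg₂ (· - ·) (ih fun u hu => h _ (.cons ⟨rfl, rfl, rfl, rfl⟩ hu))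
        (ih fun u hu => h _ (.cons ⟨rfl, rfl, rfl, rfl⟩ hu))
    | _ => exact ih fun u hu => h _ (.cons ⟨rfl, rfl, rfl, rfl⟩ hu)

theorem resolve_eq_self (g : List Layer → A) {w : List Layer} (h : w.countP Layer.isDouble = 0) :
    resolve g w = g w := by
  induction w generalizing g with
  | nil => rfl
  | cons ℓ w ih =>
    have hℓ : ℓ.isDouble = false := by
      by_contra hc
      simp [Bool.not_eq_false _ ▸ hc] at h
    rw [resolve_of_not_isDouble g hℓ, ih]
    simpa [hℓ] using h

theorem resolve_double (g : List Layer → A) (x y : List Layer) (i : ℕ) (s t : Bool) :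
    resolve g (x ++ [⟨i, .double s t⟩] ++ y) =
      resolve g (x ++ [posCross i s t] ++ y) - resolve g (x ++ [negCross i s t] ++ y) := by
  simp only [List.append_assoc, resolve_append _ x, ← resolve_sub]
  rfl

theorem Runs.of_resolvesTo {w u : List Layer} {a b : List Bool} (h : Runs w a b)
    (hu : List.Forall₂ Layer.ResolvesTo w u) : Runs u a b := by
  induction hu generalizing a with
  | nil => exact h
  | cons hr _ ih =>
    obtain ⟨c, ⟨l, r, h1, h2, h3⟩, h4⟩ := h
    obtain ⟨e1, e2, e3, -⟩ := hr
    exact ⟨c, ⟨l, r, h1.trans e1.symm, by rw [h2, e2], by rw [h3, e3]⟩, ih h4⟩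

theorem countP_of_resolvesTo {w u : List Layer} (hu : List.Forall₂ Layer.ResolvesTo w u) :
    u.countP Layer.isDouble = 0 := by
  induction hu with
  | nil => rfl
  | cons hr _ ih => simp [hr.2.2.2, ih]

open Classical in
/-- An invariant of links as a function on words, extended by `0`. -/
noncomputable def onWords (P : OrientedLink → A) (w : List Layer) : A :=
  if h : IsLinkWord w then P h.link else 0

theorem IsLinkWord.onWords {w : List Layer} (h : IsLinkWord w) (P : OrientedLink → A) :
    onWords P w = P h.link := dif_pos h

end Resolve

theorem exists_double {w : List Layer} (h : w.countP Layer.isDouble ≠ 0) :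
    ∃ x y i s t, w = x ++ [⟨i, .double s t⟩] ++ y := by
  obtain ⟨⟨i, e⟩, hℓ, hd⟩ := List.countP_pos_iff.1 (Nat.pos_of_ne_zero h)
  cases e with
  | double s t =>
    obtain ⟨x, y, rfl⟩ := List.append_of_mem hℓ
    exact ⟨x, y, i, s, t, by simp⟩
  | _ => simp [Layer.isDouble] at hd

theorem runs_double_iff {x y : List Layer} {i : ℕ} {s t : Bool} (o : Bool) {a b : List Bool} :
    Runs (x ++ [⟨i, .double s t⟩] ++ y) a b ↔ Runs (x ++ [⟨i, .cross o s t⟩] ++ y) a b := by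
  simp only [Runs_append]
  rfl

theorem SingularDiagram.exists_vassilievTriple {D : SingularDiagram} (h : D.doublePoints ≠ 0) :
    ∃ Dp Dm : SingularDiagram, VassilievTriple D Dp Dm ∧
      Dp.doublePoints + 1 = D.doublePoints ∧ Dm.doublePoints + 1 = D.doublePoints := by
  obtain ⟨x, y, i, s, t, e⟩ := exists_double h
  have hr := D.closed
  rw [e] at hr
  refine ⟨⟨x ++ [posCross i s t] ++ y, (runs_double_iff _).1 hr, by simp⟩,
    ⟨x ++ [negCross i s t] ++ y, (runs_double_iff _).1 hr, by simp⟩,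
    ⟨x, y, i, s, t, e, rfl, rfl⟩, ?_, ?_⟩ <;>
  · simp only [doublePoints, e, List.countP_append, List.countP_singleton]
    simp [posCross, negCross, Layer.isDouble]
    omega

/-! ### Moments of Laurent polynomials -/

/-- The functional `∑ a_{kj} v ^ k z ^ j ↦ ∑ a_{kj} p(k)` for fixed `j`. -/
noncomputable def moment (j : ℤ) (p : Polynomial ℚ) : Laurent →+ ℚ :=
  (Finsupp.liftAddHom fun m : ℤ × ℤ =>
    (AddMonoidHom.mulRight (if m.2 = j then p.eval (m.1 : ℚ) else 0)).comp
      (Int.castAddHom ℚ)).comp AddMonoidAlgebra.coeffAddEquiv.toAddMonoidHom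

theorem moment_apply (j : ℤ) (p : Polynomial ℚ) (F : Laurent) :
    moment j p F = F.coeff.sum fun m a => (a : ℚ) * if m.2 = j then p.eval (m.1 : ℚ) else 0 := rfl

theorem moment_single (j : ℤ) (p : Polynomial ℚ) (m : ℤ × ℤ) (a : ℤ) :
    moment j p (AddMonoidAlgebra.single m a) = a * if m.2 = j then p.eval (m.1 : ℚ) else 0 := by
  rw [moment_apply, AddMonoidAlgebra.coeff_single, Finsupp.sum_single_index (by simp)]

theorem moment_sub (j : ℤ) (p p' : Polynomial ℚ) (F : Laurent) :
    moment j (p - p') F = moment j p F - moment j p' F := by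
  simp only [moment_apply, Finsupp.sum, ← Finset.sum_sub_distrib]
  refine Finset.sum_congr rfl fun m _ => ?_
  split_ifs <;> simp [mul_sub]

theorem moment_zero (j : ℤ) (F : Laurent) : moment j 0 F = 0 := by simp [moment_apply]

theorem moment_monomial_mul (j : ℤ) (p : Polynomial ℚ) (k i : ℤ) (F : Laurent) :
    moment j p (monomial k i * F) = moment (j - i) (Polynomial.taylor (k : ℚ) p) F := by
  induction F using AddMonoidAlgebra.induction_linear with
  | zero => simp
  | add F G hF hG => rw [mul_add, map_add, map_add, hF, hG]
  | single m a =>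
    rw [monomial, AddMonoidAlgebra.single_mul_single, moment_single, moment_single,
      Polynomial.taylor_eval]
    have : i + m.2 = j ↔ m.2 = j - i := by omega
    simp [this, add_comm]

/-- All moments `∑ a_{kj} p(k)` with `natDegree p + j < d` vanish. -/
def VanishesTo (d : ℤ) (F : Laurent) : Prop :=
  ∀ (j : ℤ) (p : Polynomial ℚ), p.natDegree + j < d → moment j p F = 0

namespace VanishesTo

variable {d : ℤ} {F G : Laurent}

theorem mono {d' : ℤ} (h : VanishesTo d F) (hd : d' ≤ d) : VanishesTo d' F :=
  fun j p hp => h j p (by omega)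

theorem add (hF : VanishesTo d F) (hG : VanishesTo d G) : VanishesTo d (F + G) :=
  fun j p hp => by rw [map_add, hF j p hp, hG j p hp, add_zero]

theorem neg (hF : VanishesTo d F) : VanishesTo d (-F) :=
  fun j p hp => by rw [map_neg, hF j p hp, neg_zero]

theorem monomial_mul (hF : VanishesTo d F) (k i : ℤ) : VanishesTo (d + i) (monomial k i * F) :=
  fun j p hp => by
    rw [moment_monomial_mul]
    exact hF _ _ (by rw [Polynomial.natDegree_taylor]; omega)

theorem monomial_mul_sub (hF : VanishesTo d F) (k : ℤ) :
    VanishesTo (d + 1) (monomial k 0 * F - F) := fun j p hp => by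
  rw [map_sub, moment_monomial_mul, sub_zero, ← moment_sub]
  by_cases h0 : Polynomial.taylor (k : ℚ) p - p = 0
  · rw [h0, moment_zero]
  · refine hF _ _ ?_
    have hp0 : Polynomial.taylor (k : ℚ) p ≠ 0 := by
      rintro h
      have : p = 0 := (Polynomial.taylor_injective (k : ℚ)) (by rw [h, map_zero])
      simp [this] at h0
    have h1 := Polynomial.degree_sub_lt_left (Polynomial.degree_taylor p (k : ℚ)) hp0
      (Polynomial.leadingCoeff_taylor (k : ℚ) p)
    have h2 := Polynomial.natDegree_lt_natDegree h0 h1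
    rw [Polynomial.natDegree_taylor] at h2
    omega

theorem one : VanishesTo 0 1 := fun j p hp => by
  rw [AddMonoidAlgebra.one_def, moment_single, if_neg, mul_zero]
  rintro rfl
  simp at hp
  omega

theorem circleFactor_mul (hF : VanishesTo d F) : VanishesTo d (circleFactor * F) := by
  have h := (((hF.monomial_mul_sub 2).monomial_mul (-1) (-1)).neg).mono (d' := d) (by omega)
  convert h using 1
  rw [circleFactor, mul_sub, ← mul_assoc, OrientedLinks.monomial_mul]
  norm_num [sub_mul]

theorem skein {Fp Fm Fo : Laurent}
    (h : monomial (-1) 0 * Fp - monomial 1 0 * Fm = monomial 0 1 * Fo) :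
    Fp - Fm = (monomial 2 0 * Fm - Fm) + monomial 1 1 * Fo := by
  have := congrArg (monomial 1 0 * ·) h
  simp only [mul_sub, ← mul_assoc, OrientedLinks.monomial_mul] at this
  norm_num [monomial_zero] at this
  rw [← this]
  abel

end VanishesTo

section HOMFLYPT

variable {P : OrientedLink → Laurent}

theorem IsHOMFLYPT.vanishesTo (hP : IsHOMFLYPT P) (L : OrientedLink) : VanishesTo 0 (P L) := by
  induction L using skein_induction with
  | hcirc n h =>
    rw [show P h.link = circleFactor ^ n from hP.circles n]
    clear h
    induction n with
    | zero => exact .one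
    | succ n ih => rw [pow_succ']; exact ih.circleFactor_mul
  | hskein Lp Lm Lo h ho =>
    have hs := hP.skein _ _ _ h
    constructor
    · intro hp
      have := ((hp.monomial_mul (-2) 0).add
        ((ho.monomial_mul (-1) 1).mono (d' := 0 + 0) (by omega)).neg)
      rw [add_zero] at this
      convert this using 1
      have := congrArg (monomial (-1) 0 * ·) hs
      simp only [mul_sub, ← mul_assoc, OrientedLinks.monomial_mul] at this
      norm_num [monomial_zero] at this
      linear_combination -this
    · intro hm
      have := ((hm.monomial_mul 2 0).add ((ho.monomial_mul 1 1).mono (d' := 0 + 0) (by omega)))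
      rw [add_zero] at this
      convert this using 1
      have := VanishesTo.skein hs
      linear_combination this

theorem IsHOMFLYPT.resolve_skein (hP : IsHOMFLYPT P) {x y : List Layer} {i : ℕ} {s t : Bool}
    (h : Runs (x ++ [posCross i s t] ++ y) [] []) :
    monomial (-1) 0 * resolve (onWords P) (x ++ [posCross i s t] ++ y) -
      monomial 1 0 * resolve (onWords P) (x ++ [negCross i s t] ++ y) =
      monomial 0 1 * resolve (onWords P) (x ++ smoothing i s t ++ y) := by
  have key : ∀ (o : Bool) (u u' : List Layer), List.Forall₂ Layer.ResolvesTo x u →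
      List.Forall₂ Layer.ResolvesTo y u' → IsLinkWord (u ++ [⟨i, .cross o s t⟩] ++ u') := by
    intro o u u' hu hu'
    have h1 : Runs (x ++ [⟨i, .cross o s t⟩] ++ y) [] [] := runs_change_cross o h
    refine ⟨h1.of_resolvesTo ?_, by simp, ?_⟩
    · exact List.rel_append (List.rel_append hu (.cons (Layer.resolvesTo_self rfl) .nil)) hu'
    · simp [List.countP_append, countP_of_resolvesTo hu, countP_of_resolvesTo hu', Layer.isDouble]
  simp only [List.append_assoc, resolve_append _ x, ← resolve_mul, ← resolve_sub]
  refine resolve_congr fun u hu => ?_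
  simp only [resolve_append _ _ y]
  have e1 : ∀ (o : Bool) (g : List Layer → Laurent),
      resolve g [⟨i, .cross o s t⟩] = g [⟨i, .cross o s t⟩] := fun _ _ => rfl
  simp only [posCross, negCross, e1, resolve_eq_self _ (smoothing_countP i s t),
    ← resolve_sub]
  refine resolve_congr fun u' hu' => ?_
  have hp := key (s == t) u u' hu hu'
  have hm := key (s != t) u u' hu hu'
  have hk := hP.skein _ _ _ (skeinTriple_of_words hp hm hp.smooth)
  simp only [← List.append_assoc]
  rw [hp.onWords P, hm.onWords P, hp.smooth.onWords P]
  exact hk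

theorem IsHOMFLYPT.vanishesTo_resolve (hP : IsHOMFLYPT P) (d : ℕ) {w : List Layer}
    (hr : Runs w [] []) (hne : w ≠ []) (hd : w.countP Layer.isDouble = d) :
    VanishesTo d (resolve (onWords P) w) := by
  induction d generalizing w with
  | zero =>
    rw [resolve_eq_self _ hd, IsLinkWord.onWords ⟨hr, hne, hd⟩]
    exact hP.vanishesTo _
  | succ d ih =>
    obtain ⟨x, y, i, s, t, rfl⟩ := exists_double (w := w) (by omega)
    have hp : Runs (x ++ [posCross i s t] ++ y) [] [] := (runs_double_iff _).1 hr
    have hm : Runs (x ++ [negCross i s t] ++ y) [] [] := (runs_double_iff _).1 hr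
    simp only [List.countP_append, List.countP_singleton, Layer.isDouble, if_true] at hd
    have h1 := ih hm (by simp) (by simp [negCross, Layer.isDouble]; omega)
    have h0 := ih (runs_smooth hp) (smooth_ne_nil hp) (by
      simp only [List.countP_append, smoothing_countP]; omega)
    rw [resolve_double, VanishesTo.skein (hP.resolve_skein hp)]
    push_cast
    exact (h1.monomial_mul_sub 2).add (h0.monomial_mul 1 1)

/-- Functionals on Laurent polynomials that depend on finitely many moments give Vassiliev
invariants, also when they are cut off according to the number of components. -/
theorem IsHOMFLYPT.isVassiliev (hP : IsHOMFLYPT P) {A : Type*} [AddCommGroup A]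
    (φ : Laurent →+ A) (hφ : ∃ d : ℤ, ∀ F, VanishesTo d F → φ F = 0) (c : ℕ → Prop)
    [DecidablePred c] : IsVassiliev fun L => if c L.components then φ (P L) else 0 := by
  obtain ⟨d, hφ⟩ := hφ
  refine ⟨d.toNat, fun D => if c D.numComponents then φ (resolve (onWords P) D.word) else 0,
    ?_, ?_, ?_⟩
  · intro D L h
    dsimp only
    rw [h.components]
    obtain ⟨h0, h1⟩ := h
    rw [resolve_eq_self _ h0, (D.isLinkWord h0).onWords, ← h1]
    rfl
  · intro D Dp Dm h
    simp only [h.numComponents_eq.1, h.numComponents_eq.2]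
    obtain ⟨x, y, i, s, t, e1, e2, e3⟩ := h
    rw [e1, e2, e3, resolve_double, map_sub]
    split_ifs <;> simp
  · intro D hD
    dsimp only
    rw [hφ _ ((hP.vanishesTo_resolve _ D.closed D.nonempty hD).mono (by push_cast; omega)), ite_self]

end HOMFLYPT

theorem IsVassiliev.restrict {A : Type*} [AddCommGroup A] {v : OrientedLink → A}
    (h : IsVassiliev v) (μ : ℕ) : IsVassilievOn μ fun L => v L.1 := by
  obtain ⟨n, V, h1, h2, h3⟩ := h
  exact ⟨n, fun D => V D.1, fun D L => h1 D.1 L.1, fun D Dp Dm => h2 D.1 Dp.1 Dm.1,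
    fun D => h3 D.1⟩

theorem IsVassilievLimit.restrict {f : OrientedLink → ℚ} (h : IsVassilievLimit f) (μ : ℕ) :
    IsVassilievLimitOn μ fun L => f L.1 := by
  obtain ⟨w, hw, hf⟩ := h
  exact ⟨fun n L => w n L.1, fun n => (hw n).restrict μ, fun L => hf L.1⟩

/-! ### Gluing over the number of components -/

theorem IsVassilievOn.glue {A : Type*} [AddCommGroup A] {n : ℕ}
    {v : ∀ μ : ℕ, OrientedLinkOf μ → A} (hv : ∀ μ ≤ n, IsVassilievOn μ (v μ)) :
    IsVassiliev fun L => if L.components ≤ n then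
      v L.components ⟨L, OrientedLink.hasComponents_iff.2 rfl⟩ else 0 := by
  have hv' : ∀ μ, ∃ o, μ ≤ n → IsVassilievOfOrderOn μ o (v μ) := fun μ => by
    by_cases h : μ ≤ n
    · obtain ⟨o, ho⟩ := hv μ h
      exact ⟨o, fun _ => ho⟩
    · exact ⟨0, fun h' => absurd h' h⟩
  choose o ho using hv'
  have ho' : ∀ μ, ∃ V : {D : SingularDiagram // D.numComponents = μ} → A, μ ≤ n →
      (∀ D L, D.1.Represents L.1 → V D = v μ L) ∧
      (∀ D Dp Dm, VassilievTriple D.1 Dp.1 Dm.1 → V D = V Dp - V Dm) ∧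
      ∀ D, D.1.doublePoints = o μ + 1 → V D = 0 := fun μ => by
    by_cases h : μ ≤ n
    · obtain ⟨V, hV⟩ := ho μ h
      exact ⟨V, fun _ => hV⟩
    · exact ⟨0, fun h' => absurd h' h⟩
  choose V hV using ho'
  have cast : ∀ {D : SingularDiagram} {μ : ℕ} (h : D.numComponents = μ),
      V D.numComponents ⟨D, rfl⟩ = V μ ⟨D, h⟩ := by
    rintro D _ rfl
    rfl
  have hmono : ∀ μ ≤ n, ∀ M, o μ ≤ M → ∀ D : {D : SingularDiagram // D.numComponents = μ},
      D.1.doublePoints = M + 1 → V μ D = 0 := by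
    intro μ hμ M hM
    induction M, hM using Nat.le_induction with
    | base => exact (hV μ hμ).2.2
    | succ M hM ih =>
      intro D hD
      obtain ⟨Dp, Dm, h, hp, hm⟩ := D.1.exists_vassilievTriple (by omega)
      rw [(hV μ hμ).2.1 D ⟨Dp, h.numComponents_eq.1.trans D.2⟩
        ⟨Dm, h.numComponents_eq.2.trans D.2⟩ h, ih _ (by dsimp only; omega),
        ih _ (by dsimp only; omega), sub_zero]
  refine ⟨(Finset.range (n + 1)).sup o, fun D => if D.numComponents ≤ n then
    V D.numComponents ⟨D, rfl⟩ else 0, ?_, ?_, ?_⟩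
  · intro D L h
    simp only [← h.components]
    split_ifs with hn
    · rw [cast h.components.symm]
      exact (hV _ hn).1 _ _ h
    · rfl
  · intro D Dp Dm h
    obtain ⟨hp, hm⟩ := h.numComponents_eq
    simp only [hp, hm]
    split_ifs with hn
    · rw [cast hp, cast hm]
      exact (hV _ hn).2.1 _ _ _ h
    · simp
  · intro D hD
    dsimp only
    split_ifs with hn
    · exact hmono _ hn _ (Finset.le_sup (Finset.mem_range.2 (by omega))) _ hD
    · rfl

theorem IsVassilievLimitOn.glue {f : OrientedLink → ℚ}
    (h : ∀ μ : ℕ, 1 ≤ μ → IsVassilievLimitOn μ fun L => f L.1) : IsVassilievLimit f := by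
  have h' : ∀ μ : ℕ, IsVassilievLimitOn μ fun L => f L.1 := by
    intro μ
    rcases Nat.eq_zero_or_pos μ with rfl | hμ
    · refine ⟨fun _ _ => 0, fun _ => ⟨0, 0, fun _ _ _ => rfl, fun _ _ _ _ => by simp,
        fun _ _ => rfl⟩, fun L => ?_⟩
      have := OrientedLink.hasComponents_iff.1 L.2
      have := L.1.one_le_components
      omega
    · exact h μ hμ
  choose w hw hf using h'
  refine ⟨_, fun n => IsVassilievOn.glue (n := n) (v := fun μ => w μ n) fun μ _ => hw μ n,
    fun L => ?_⟩
  refine (hf L.components ⟨L, OrientedLink.hasComponents_iff.2 rfl⟩).congr' ?_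
  filter_upwards [eventually_ge_atTop L.components] with n hn
  rw [if_pos hn]

end OrientedLinks

namespace OrientedLinks

/-! ### Invariants that depend on finitely many moments -/

theorem moment_eq_sum (j : ℤ) (p : Polynomial ℚ) (F : Laurent) {S : Finset ℤ}
    (hS : F.coeff.support.image Prod.fst ⊆ S) :
    moment j p F = ∑ k ∈ S, (F.coeff (k, j) : ℚ) * p.eval (k : ℚ) := by
  have h1 : F.coeff.support ⊆ S ×ˢ insert j (F.coeff.support.image Prod.snd) := fun m hm =>
    Finset.mem_product.2 ⟨hS (Finset.mem_image_of_mem _ hm),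
      Finset.mem_insert_of_mem (Finset.mem_image_of_mem _ hm)⟩
  rw [moment_apply, Finsupp.sum_of_support_subset _ h1 _ (by simp), Finset.sum_product]
  refine Finset.sum_congr rfl fun k _ => ?_
  simp

theorem coeffB_eq_moment (P : OrientedLink → Laurent) (m : ℕ) (j : ℤ) (L : OrientedLink) :
    coeffB P m j L =
      moment j (Polynomial.C (m.factorial : ℚ)⁻¹ * Polynomial.X ^ m) (P L) := by
  rw [moment_eq_sum _ _ _ (Finset.Subset.refl _), coeffB]
  refine Finset.sum_congr rfl fun k _ => ?_
  simp [coeffA]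
  ring

theorem factorial_mul_coeffB (P : OrientedLink → Laurent) (m : ℕ) (j : ℤ) (L : OrientedLink)
    {S : Finset ℤ} (hS : (P L).coeff.support.image Prod.fst ⊆ S) :
    (m.factorial : ℚ) * coeffB P m j L = ∑ k ∈ S, coeffA P k j L * (k : ℚ) ^ m := by
  rw [coeffB_eq_moment, moment_eq_sum _ _ _ hS, Finset.mul_sum]
  refine Finset.sum_congr rfl fun k _ => ?_
  have : (m.factorial : ℚ) ≠ 0 := by exact_mod_cast m.factorial_ne_zero
  simp [coeffA]
  field_simp

/-- The invariant `v` is an additive function of finitely many moments of `P`. -/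
def DependsOnMoments (P : OrientedLink → Laurent) {A : Type*} [AddCommGroup A]
    (v : OrientedLink → A) : Prop :=
  ∃ φ : Laurent →+ A, (∀ L, v L = φ (P L)) ∧ ∃ d : ℤ, ∀ F, VanishesTo d F → φ F = 0

section DependsOnMoments

variable {P : OrientedLink → Laurent} {A B : Type*} [AddCommGroup A] [AddCommGroup B]

theorem dependsOnMoments_coeffB (P : OrientedLink → Laurent) (m : ℕ) (j : ℤ) :
    DependsOnMoments P (coeffB P m j) :=
  ⟨_, coeffB_eq_moment P m j, m + j + 1, fun _ hF => hF _ _ (by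
    have := Polynomial.natDegree_C_mul_X_pow_le (m.factorial : ℚ)⁻¹ m
    omega)⟩

theorem DependsOnMoments.zero (P : OrientedLink → Laurent) :
    DependsOnMoments P (fun _ => (0 : A)) :=
  ⟨0, fun _ => rfl, 0, fun _ _ => rfl⟩

theorem DependsOnMoments.map {v : OrientedLink → A} (h : DependsOnMoments P v) (g : A →+ B) :
    DependsOnMoments P fun L => g (v L) := by
  obtain ⟨φ, h1, d, h2⟩ := h
  exact ⟨g.comp φ, fun L => congrArg g (h1 L), d, fun F hF => by simp [h2 F hF]⟩

theorem DependsOnMoments.add {v v' : OrientedLink → A} (h : DependsOnMoments P v)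
    (h' : DependsOnMoments P v') : DependsOnMoments P fun L => v L + v' L := by
  obtain ⟨φ, h1, d, h2⟩ := h
  obtain ⟨φ', h1', d', h2'⟩ := h'
  exact ⟨φ + φ', fun L => by simp [h1, h1'], max d d', fun F hF => by
    simp [h2 F (hF.mono (le_max_left _ _)), h2' F (hF.mono (le_max_right _ _))]⟩

theorem DependsOnMoments.sum {ι : Type*} {S : Finset ι} {v : ι → OrientedLink → A}
    (h : ∀ i ∈ S, DependsOnMoments P (v i)) : DependsOnMoments P fun L => ∑ i ∈ S, v i L := by
  classical
  induction S using Finset.induction_on with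
  | empty => exact .zero P
  | insert i S hi ih =>
    simp only [Finset.sum_insert hi]
    exact (h i (Finset.mem_insert_self i S)).add
      (ih fun k hk => h k (Finset.mem_insert_of_mem hk))

theorem dependsOnMoments_vandermondeS (P : OrientedLink → Laurent) (n : ℕ) (k j : ℤ) :
    DependsOnMoments P (vandermondeS P n k j) := by
  unfold vandermondeS
  split_ifs with h
  · exact .sum (S := Finset.univ) fun (r : Fin (2 * n + 1)) _ =>
      ((dependsOnMoments_coeffB P r j).map (.mulLeft (r.val.factorial : ℚ))).map
        (.mulLeft ((vandermondeM n)⁻¹ _ r))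
  · exact .zero P

theorem dependsOnMoments_fourierSum (P : OrientedLink → Laurent) (N : ℕ) (k j : ℤ) :
    DependsOnMoments P (fourierSum P N k j) :=
  .sum fun m _ => ((dependsOnMoments_coeffB P m j).map (Rat.castHom ℂ).toAddMonoidHom).map
    (.mulLeft (fourierLambda m k))

theorem DependsOnMoments.isVassiliev (hP : IsHOMFLYPT P) {v : OrientedLink → A}
    (h : DependsOnMoments P v) (n : ℕ) :
    IsVassiliev fun L => if L.components ≤ n then v L else 0 := by
  obtain ⟨φ, h1, h2⟩ := h
  simp only [h1]
  exact hP.isVassiliev φ h2 (· ≤ n)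

theorem DependsOnMoments.isVassilievOn (hP : IsHOMFLYPT P) {v : OrientedLink → A}
    (h : DependsOnMoments P v) (μ : ℕ) : IsVassilievOn μ fun L => v L.1 := by
  obtain ⟨φ, h1, h2⟩ := h
  simpa only [h1, if_true] using (hP.isVassiliev φ h2 fun _ => True).restrict μ

end DependsOnMoments

/-! ### The limits of the Vandermonde and Fourier approximations -/

theorem vandermondeM_eq (n : ℕ) : vandermondeM n =
    (Matrix.vandermonde fun c : Fin (2 * n + 1) => (c.val : ℚ) - n).transpose := rfl

theorem isUnit_det_vandermondeM (n : ℕ) : IsUnit (vandermondeM n).det := by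
  rw [isUnit_iff_ne_zero, vandermondeM_eq, Matrix.det_transpose, Matrix.det_vandermonde_ne_zero_iff]
  intro c c' h
  exact Fin.ext (by simpa using h)

theorem isUnit_vandermondeM (n : ℕ) : IsUnit (vandermondeM n) :=
  (Matrix.isUnit_iff_isUnit_det _).2 (isUnit_det_vandermondeM n)

theorem sum_Icc_eq_sum_fin (n : ℕ) (f : ℤ → ℚ) :
    ∑ k ∈ Finset.Icc (-(n : ℤ)) n, f k = ∑ c : Fin (2 * n + 1), f ((c.val : ℤ) - n) := by
  symm
  refine Finset.sum_bij (fun c _ => (c.val : ℤ) - n) (fun c _ => ?_) (fun c _ c' _ h => ?_)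
    (fun k hk => ?_) fun _ _ => rfl
  · rw [Finset.mem_Icc]; omega
  · exact Fin.ext (by omega)
  · rw [Finset.mem_Icc] at hk
    exact ⟨⟨(k + n).toNat, by omega⟩, Finset.mem_univ _, by simp; omega⟩

theorem vandermondeS_eq_coeffA (P : OrientedLink → Laurent) {n : ℕ} {k : ℤ} (j : ℤ)
    (L : OrientedLink) (hk : -(n : ℤ) ≤ k ∧ k ≤ n)
    (hS : (P L).coeff.support.image Prod.fst ⊆ Finset.Icc (-(n : ℤ)) n) :
    vandermondeS P n k j L = coeffA P k j L := by
  have h : (fun r : Fin (2 * n + 1) => (r.val.factorial : ℚ) * coeffB P r.val j L) =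
      (vandermondeM n).mulVec fun c => coeffA P ((c.val : ℤ) - n) j L := by
    funext r
    rw [factorial_mul_coeffB P r j L hS, sum_Icc_eq_sum_fin]
    simp only [Matrix.mulVec, dotProduct, vandermondeM, Matrix.of_apply]
    refine Finset.sum_congr rfl fun c _ => ?_
    push_cast
    ring
  rw [vandermondeS, dif_pos hk, h, Matrix.mulVec_mulVec,
    Matrix.nonsing_inv_mul _ (isUnit_det_vandermondeM n), Matrix.one_mulVec]
  congr 1
  simp
  omega

theorem eventually_vandermondeS_eq (P : OrientedLink → Laurent) (k j : ℤ) (L : OrientedLink) :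
    ∀ᶠ n : ℕ in atTop, vandermondeS P n k j L = coeffA P k j L := by
  have hk : ∀ l : ℤ, ∀ᶠ n : ℕ in atTop, -(n : ℤ) ≤ l ∧ l ≤ n := fun l => by
    filter_upwards [eventually_ge_atTop l.natAbs] with n hn
    omega
  have hS : ∀ᶠ n : ℕ in atTop, ∀ l ∈ (P L).coeff.support.image Prod.fst,
      -(n : ℤ) ≤ l ∧ l ≤ n := (Finset.eventually_all _).2 fun l _ => hk l
  filter_upwards [hk k, hS] with n h1 h2
  exact vandermondeS_eq_coeffA P j L h1 fun l hl => Finset.mem_Icc.2 (h2 l hl)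

theorem integral_exp_int (l : ℤ) :
    ∫ t in (0 : ℝ)..(2 * Real.pi), Complex.exp (Complex.I * l * t) =
      if l = 0 then 2 * (Real.pi : ℂ) else 0 := by
  split_ifs with h
  · simp [h]
  · have hc : Complex.I * (l : ℂ) ≠ 0 := mul_ne_zero Complex.I_ne_zero (by exact_mod_cast h)
    rw [integral_exp_mul_complex hc]
    have : Complex.I * (l : ℂ) * ((2 * Real.pi : ℝ) : ℂ) = l * (2 * Real.pi * Complex.I) := by
      push_cast
      ring
    rw [this, Complex.exp_int_mul_two_pi_mul_I]
    simp

theorem hasSum_of_eq {f g : ℕ → ℂ} {a : ℂ} (h : HasSum f a) (e : ∀ m, g m = f m) : HasSum g a :=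
  (funext e : g = f) ▸ h

theorem hasSum_fourierLambda (k l : ℤ) :
    HasSum (fun m : ℕ => fourierLambda m k * ((l : ℂ) ^ m / (m.factorial : ℂ)))
      (if l = k then 1 else 0) := by
  have hint : HasSum (fun m : ℕ => ∫ t in (0 : ℝ)..(2 * Real.pi),
      (Complex.I * (t : ℂ)) ^ m * Complex.exp (-(Complex.I * (k : ℂ) * (t : ℂ))) *
        ((l : ℂ) ^ m / (m.factorial : ℂ)))
      (∫ t in (0 : ℝ)..(2 * Real.pi), Complex.exp (Complex.I * (l - k : ℤ) * t)) := by
    refine intervalIntegral.hasSum_integral_of_dominated_convergence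
      (fun m _ => (2 * Real.pi * |(l : ℝ)|) ^ m / (m.factorial : ℝ)) (fun m => ?_) (fun m => ?_)
      (.of_forall fun t _ => Real.summable_pow_div_factorial _) intervalIntegrable_const
      (.of_forall fun t _ => ?_)
    · exact Continuous.aestronglyMeasurable (by fun_prop)
    · refine .of_forall fun t ht => ?_
      rw [Set.uIoc_of_le (by positivity)] at ht
      have he : ‖Complex.exp (-(Complex.I * (k : ℂ) * (t : ℂ)))‖ = 1 := by
        rw [Complex.norm_exp]
        simp
      rw [norm_mul, norm_mul, he, norm_pow, norm_mul, norm_div, norm_pow]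
      simp only [Complex.norm_I, Complex.norm_real, Complex.norm_intCast, Complex.norm_natCast,
        one_mul, mul_one, Real.norm_eq_abs, abs_of_pos ht.1]
      rw [← mul_div_assoc, ← mul_pow]
      have := ht.1.le
      gcongr
      exact ht.2
    · have h := (NormedSpace.expSeries_div_hasSum_exp (Complex.I * l * t : ℂ)).mul_left
        (Complex.exp (-(Complex.I * (k : ℂ) * (t : ℂ))))
      rw [← Complex.exp_eq_exp_ℂ, ← Complex.exp_add] at h
      have e : Complex.I * ((l - k : ℤ) : ℂ) * (t : ℂ) =
          -(Complex.I * k * t) + Complex.I * l * t := by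
        push_cast
        ring
      rw [e]
      refine hasSum_of_eq h fun m => ?_
      rw [show Complex.I * (l : ℂ) * (t : ℂ) = Complex.I * t * l by ring, mul_pow _ (l : ℂ)]
      ring
  have h := hint.mul_left (1 / (2 * (Real.pi : ℂ)))
  rw [integral_exp_int] at h
  have e : 1 / (2 * (Real.pi : ℂ)) * (if l - k = 0 then 2 * (Real.pi : ℂ) else 0) =
      if l = k then 1 else 0 := by
    have : (Real.pi : ℂ) ≠ 0 := by exact_mod_cast Real.pi_ne_zero
    simp only [sub_eq_zero]
    split_ifs
    · field_simp
    · simp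
  rw [e] at h
  refine hasSum_of_eq h fun m => ?_
  rw [intervalIntegral.integral_mul_const, fourierLambda]
  ring

theorem hasSum_fourierLambda_mul_coeffB (P : OrientedLink → Laurent) (k j : ℤ) (L : OrientedLink) :
    HasSum (fun m : ℕ => fourierLambda m k * ((coeffB P m j L : ℚ) : ℂ))
      ((coeffA P k j L : ℚ) : ℂ) := by
  have h := hasSum_sum (s := insert k ((P L).coeff.support.image Prod.fst)) fun l _ =>
    (hasSum_fourierLambda k l).mul_left ((coeffA P l j L : ℚ) : ℂ)
  have e : ∑ l ∈ insert k ((P L).coeff.support.image Prod.fst),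
      ((coeffA P l j L : ℚ) : ℂ) * (if l = k then 1 else 0) = ((coeffA P k j L : ℚ) : ℂ) := by
    simp
  rw [e] at h
  refine hasSum_of_eq h fun m => ?_
  have hm : (m.factorial : ℚ) ≠ 0 := by exact_mod_cast m.factorial_ne_zero
  have hB : coeffB P m j L = ∑ l ∈ insert k ((P L).coeff.support.image Prod.fst),
      coeffA P l j L * ((l : ℚ) ^ m / (m.factorial : ℚ)) := by
    rw [← mul_right_inj' hm, factorial_mul_coeffB P m j L (Finset.subset_insert _ _),
      Finset.mul_sum]
    refine Finset.sum_congr rfl fun l _ => ?_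
    field_simp
  rw [hB]
  push_cast
  rw [Finset.mul_sum]
  refine Finset.sum_congr rfl fun l _ => ?_
  ring

end OrientedLinks

open OrientedLinks in
theorem mainTheorem1 :
    -- gluing over the number of components
    (∀ f : OrientedLink → ℚ,
      (∀ μ : ℕ, 1 ≤ μ → IsVassilievLimitOn μ (fun L => f L.1)) ↔ IsVassilievLimit f) ∧
    -- the HOMFLYPT polynomial
    ∃ P : OrientedLink → Laurent, IsHOMFLYPT P ∧ (∀ Q, IsHOMFLYPT Q → Q = P) ∧
      (∀ n : ℕ, IsUnit (vandermondeM n)) ∧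
      (∀ μ : ℕ, 1 ≤ μ → ∀ (m : ℕ) (j : ℤ), IsVassilievOn μ (fun L => coeffB P m j L.1)) ∧
      ∀ k j : ℤ,
        -- links with a fixed number of components
        (∀ μ : ℕ, 1 ≤ μ →
          (∀ n : ℕ, IsVassilievOn μ (fun L => vandermondeS P n k j L.1)) ∧
          (∀ N : ℕ, IsVassilievOn μ (fun L => fourierSum P N k j L.1)) ∧
          IsVassilievLimitOn μ (fun L => coeffA P k j L.1)) ∧
        -- the explicit limits
        (∀ L, ∀ᶠ n : ℕ in atTop, vandermondeS P n k j L = coeffA P k j L) ∧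
        (∀ L, HasSum (fun m : ℕ => fourierLambda m k * ((coeffB P m j L : ℚ) : ℂ))
          ((coeffA P k j L : ℚ) : ℂ)) ∧
        -- all oriented links
        (∃ w : ℕ → OrientedLink → ℚ,
          (∀ (n μ : ℕ) (L : OrientedLink), L.HasComponents μ →
            w n L = if μ ≤ n then vandermondeS P n k j L else 0) ∧
          (∀ n, IsVassiliev (w n)) ∧
          ∀ L, Tendsto (fun n => w n L) atTop (𝓝 (coeffA P k j L))) ∧
        (∃ w : ℕ → OrientedLink → ℂ,
          (∀ (n μ : ℕ) (L : OrientedLink), L.HasComponents μ →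
            w n L = if μ ≤ n then fourierSum P n k j L else 0) ∧
          (∀ n, IsVassiliev (w n)) ∧
          ∀ L, Tendsto (fun n => w n L) atTop (𝓝 ((coeffA P k j L : ℚ) : ℂ))) ∧
        IsVassilievLimit (coeffA P k j) := by
  have hP := isHOMFLYPT_homflypt
  refine ⟨fun f => ⟨IsVassilievLimitOn.glue, fun h μ _ => h.restrict μ⟩, homflypt, hP, fun Q hQ => hP.unique hQ,
    isUnit_vandermondeM, fun μ _ m j => (dependsOnMoments_coeffB _ m j).isVassilievOn hP μ,
    fun k j => ?_⟩
  have hS : ∀ n, IsVassiliev fun L =>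
      if L.components ≤ n then vandermondeS homflypt n k j L else 0 :=
    fun n => (dependsOnMoments_vandermondeS _ n k j).isVassiliev hP n
  have hSlim : ∀ L : OrientedLink, Tendsto (fun n =>
      if L.components ≤ n then vandermondeS homflypt n k j L else 0) atTop
      (𝓝 (coeffA homflypt k j L)) := fun L => by
    refine tendsto_const_nhds.congr' ?_
    filter_upwards [eventually_vandermondeS_eq homflypt k j L,
      eventually_ge_atTop L.components] with n h1 h2
    rw [if_pos h2, h1]
  have hlim : IsVassilievLimit (coeffA homflypt k j) := ⟨_, hS, hSlim⟩
  refine ⟨fun μ _ => ⟨fun n => (dependsOnMoments_vandermondeS _ n k j).isVassilievOn hP μ,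
      fun N => (dependsOnMoments_fourierSum _ N k j).isVassilievOn hP μ, hlim.restrict μ⟩,
    eventually_vandermondeS_eq homflypt k j, hasSum_fourierLambda_mul_coeffB homflypt k j,
    ⟨_, fun n μ L h => by rw [OrientedLink.hasComponents_iff.1 h], hS, hSlim⟩,
    ⟨fun n L => if L.components ≤ n then fourierSum homflypt n k j L else 0,
      fun n μ L h => by simp only [OrientedLink.hasComponents_iff.1 h],
      fun n => (dependsOnMoments_fourierSum _ n k j).isVassiliev hP n, fun L => ?_⟩, hlim⟩
  have h := (tendsto_add_atTop_iff_nat 1).2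
    (hasSum_fourierLambda_mul_coeffB homflypt k j L).tendsto_sum_nat
  refine h.congr' ?_
  filter_upwards [eventually_ge_atTop L.components] with n hn
  rw [if_pos hn, fourierSum]
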